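/- Let $N\ge 0$ be an integer and fix $\lambda_2,\alpha,\lambda\in\mathbb C$ with $\mathrm{Re}\,\lambda_2>-1$, $\mathrm{Re}\,\alpha>0$, $\mathrm{Re}\,\lambda>0$; let $\lambda_1\in\mathbb C$ vary. Put $$\sigma_i=i(\lambda_1+\lambda(i-1)+\alpha),\quad a_i=i(\lambda_1+\lambda_2+\lambda(N+i-2)+\alpha+1),\quad b_i=-i(\lambda_2+\lambda(i-1)+\alpha)+N-i,\quad c_i=(N-i)(\lambda i+\alpha).$$ Let $Y^+$ be the upper bidiagonal $(N+1)\times(N+1)$ matrix whose row $p=0,\dots,N$ has diagonal entry $\sigma_{N-p}$ and superdiagonal entry $a_{N-p}$, and $Y^-$ the lower bidiagonal matrix whose row $p$ has diagonal entry $b_{N-p}$ and subdiagonal entry $c_{N-p}$. Consider on $(0,1)$ the Fuchsian system $$\frac{d\mathbf w}{dx}=\Big(\frac{Y^+}{x}+\frac{Y^-}{1-x}\Big)\mathbf w .\qquad(*)$$ For each $k=0,\dots,N$ let $n_k$ be a meromorphic function of $\lambda_1\in\mathbb C$, not identically zero (a choice of normalization, e.g. $n_k=1$). Call $\lambda_1$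 admissible if no two of $\sigma_0,\dots,\sigma_N$ differ by an integer, $a_1,\dots,a_N$ are nonzero, and every $n_k(\lambda_1)$ is (defined and) nonzero; the set of non-admissible $\lambda_1$ is closed and discrete. For $\mathrm{Re}\,\lambda_1>-1$ and $0<x<1$ let $H(x)=[H_{p,q}(x)]_{p,q=0,\dots,N}$, $$H_{p,q}(x)=\frac{\binom Nq}{\binom Np}(x-1)^{-p}\int_{(0,x)^q\times(x,1)^{N-q}}\prod_{l=1}^N t_l^{\lambda_1}(1-t_l)^{\lambda_2}|x-t_l|^{\alpha-1}\prod_{1\le j<k\le N}|t_k-t_j|^{2\lambda}\;e_p(t_1-x,\dots,t_N-x)\,dt,$$ with $e_p$ the $p$-th elementary symmetric polynomial; its first row consists of the integrals $I^{(\alpha)}_q(x)=H_{0,q}(x)$. Then: 1. (Frobenius series solutions.) For every admissible $\lambda_1$ and every $k$ there is a unique sequence of vectors $\mathbf p_l=\mathbf p_l(k,\lambda_1)\in\mathbb C^{N+1}$ $(l\ge0)$, with $\mathbf p_0\neq0$ of first component $n_k(\lambda_1)$, such that the series $\mathbf w_k(x)=x^{\sigma_k}\sum_{l\ge0}\mathbf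 p_lx^l$ converges and solves $(*)$ on $(0,1)$. For every $x\in(0,1)$ all entries of $W(x)=[\mathbf w_0(x),\dots,\mathbf w_N(x)]$ (in particular those of its first row) are meromorphic functions of $\lambda_1\in\mathbb C$. 2. (Integral solutions.) For $\mathrm{Re}\,\lambda_1>-1$ the integrals above converge absolutely, and for every $x\in(0,1)$ all entries of $H(x)$ (in particular the $I_q^{(\alpha)}(x)$) extend to meromorphic functions of $\lambda_1\in\mathbb C$. 3. (Connection matrix.) There is a matrix $C$, independent of $x$, whose entries are meromorphic functions of $\lambda_1\in\mathbb C$, such that $H(x)=W(x)C$ for all $x\in(0,1)$, for all admissible $\lambda_1$ with $\mathrm{Re}\,\lambda_1>-1$ and, for the continued $H$, for all $\lambda_1$ outside a closed discrete subset of $\mathbb C$. For admissible $\lambda_1$ with $\mathrm{Re}\,\lambda_1>-1$ it is the unique matrix with this property, and is already the unique matrix with $[I_q^{(\alpha)}(x)]_{q=0,\dots,N}=[(\mathbf w_k(x))_0]_{k=0,\dots,N}\,C$ for all $x\in(0,1)$. -/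

import Mathlib

open MeasureTheory Filter Set

noncomputable section

namespace SelbergFuchs

/-! Throughout, `l₁ l₂ l a` stand for the parameters `λ₁, λ₂, λ, α`. -/

/-- The exponents `σ_i = i (λ₁ + λ (i - 1) + α)`. -/
def sigma (l a l₁ : ℂ) (i : ℕ) : ℂ := i * (l₁ + l * (i - 1) + a)

/-- The superdiagonal coefficients `a_i = i (λ₁ + λ₂ + λ (N + i - 2) + α + 1)` of `Y⁺`. -/
def aCoeff (N : ℕ) (l₂ l a l₁ : ℂ) (i : ℕ) : ℂ := i * (l₁ + l₂ + l * (N + i - 2) + a + 1)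

/-- The diagonal coefficients `b_i = -i (λ₂ + λ (i - 1) + α) + N - i` of `Y⁻`. -/
def bCoeff (N : ℕ) (l₂ l a : ℂ) (i : ℕ) : ℂ := -i * (l₂ + l * (i - 1) + a) + N - i

/-- The subdiagonal coefficients `c_i = (N - i) (λ i + α)` of `Y⁻`. -/
def cCoeff (N : ℕ) (l a : ℂ) (i : ℕ) : ℂ := (N - i) * (l * i + a)

/-- The residue matrix `Y⁺` at `x = 0`: upper bidiagonal; row `p` (`0 ≤ p ≤ N`) has diagonal entry
`σ_{N-p}` and superdiagonal entry `a_{N-p}`. -/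
def Yplus (N : ℕ) (l₂ l a l₁ : ℂ) : Matrix (Fin (N + 1)) (Fin (N + 1)) ℂ :=
  Matrix.of fun p r =>
    if r.val = p.val then sigma l a l₁ (N - p.val)
    else if r.val = p.val + 1 then aCoeff N l₂ l a l₁ (N - p.val)
    else 0

/-- The matrix `Y⁻`: lower bidiagonal; row `p` has diagonal entry `b_{N-p}` and subdiagonal entry
`c_{N-p}`. -/
def Yminus (N : ℕ) (l₂ l a : ℂ) : Matrix (Fin (N + 1)) (Fin (N + 1)) ℂ :=
  Matrix.of fun p r =>
    if r.val = p.val then bCoeff N l₂ l a (N - p.val)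
    else if r.val + 1 = p.val then cCoeff N l a (N - p.val)
    else 0

/-- `w` solves the Fuchsian system `w' = (Y⁺ / x + Y⁻ / (1 - x)) w` on `(0, 1)`. -/
def IsSolution (N : ℕ) (l₂ l a l₁ : ℂ) (w : ℝ → Fin (N + 1) → ℂ) : Prop :=
  ∀ x ∈ Ioo (0 : ℝ) 1, HasDerivAt w
    (((x : ℂ)⁻¹ • Yplus N l₂ l a l₁ + (1 - (x : ℂ))⁻¹ • Yminus N l₂ l a).mulVec (w x)) x

/-- The function `x ↦ x ^ s * ∑_{m ≥ 0} p_m x ^ m` with vector coefficients `p_m`. -/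
def frobeniusSum {N : ℕ} (s : ℂ) (p : ℕ → Fin (N + 1) → ℂ) (x : ℝ) : Fin (N + 1) → ℂ :=
  (x : ℂ) ^ s • ∑' m : ℕ, (x : ℂ) ^ m • p m

/-- `p` is the coefficient sequence of a (logarithm-free) Frobenius series solution with exponent
`σ_k`: its leading coefficient is nonzero, the series converges on `(0, 1)`, and
`x ^ σ_k ∑ p_m x ^ m` solves the Fuchsian system there. -/
structure IsFrobeniusSolution (N : ℕ) (l₂ l a l₁ : ℂ) (k : ℕ) (p : ℕ → Fin (N + 1) → ℂ) :
    Prop where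
  leading_ne_zero : p 0 ≠ 0
  summable : ∀ x ∈ Ioo (0 : ℝ) 1, Summable fun m : ℕ => (x : ℂ) ^ m • p m
  isSolution : IsSolution N l₂ l a l₁ (frobeniusSum (sigma l a l₁ k) p)

/-- Generic values of `λ₁`: no two of the exponents `σ_0, …, σ_N` differ by an integer (in
particular they are distinct), and the superdiagonal entries `a_1, …, a_N` of `Y⁺` do not vanish
(so that the first component of every eigenvector of `Y⁺` is nonzero). -/
def Generic (N : ℕ) (l₂ l a l₁ : ℂ) : Prop :=
  (∀ j k : Fin (N + 1), j ≠ k → ∀ m : ℤ, sigma l a l₁ k - sigma l a l₁ j ≠ m) ∧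
  ∀ i ∈ Finset.Icc 1 N, aCoeff N l₂ l a l₁ i ≠ 0

/-- The integrand
`F(t; α; x) = ∏ t_j ^ λ₁ (1 - t_j) ^ λ₂ |x - t_j| ^ (α - 1) ∏_{j < k} |t_k - t_j| ^ (2 λ)`. -/
def integrandF (N : ℕ) (l₂ l a l₁ : ℂ) (x : ℝ) (t : Fin N → ℝ) : ℂ :=
  (∏ j, ((t j : ℂ) ^ l₁ * (1 - (t j : ℂ)) ^ l₂ * ((|x - t j| : ℝ) : ℂ) ^ (a - 1))) *
    ∏ j, ∏ k ∈ Finset.Ioi j, ((|t k - t j| : ℝ) : ℂ) ^ (2 * l)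

/-- The domain of integration: the first `q` variables lie in `(0, x)`, the others in `(x, 1)`. -/
def domain (N q : ℕ) (x : ℝ) : Set (Fin N → ℝ) :=
  Set.univ.pi fun j => if j.val < q then Ioo 0 x else Ioo x 1

/-- The integrand `F(t; α; x) e_p(t_1 - x, …, t_N - x)`, with `e_p` the elementary symmetric
polynomial. -/
def integrandJ (N p : ℕ) (l₂ l a l₁ : ℂ) (x : ℝ) (t : Fin N → ℝ) : ℂ :=
  integrandF N l₂ l a l₁ x t *
    MvPolynomial.eval (fun j => (t j : ℂ) - (x : ℂ)) (MvPolynomial.esymm (Fin N) ℂ p)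

/-- The integral `J_{p,q}(x)`. -/
def integralJ (N p q : ℕ) (l₂ l a l₁ : ℂ) (x : ℝ) : ℂ :=
  ∫ t in domain N q x, integrandJ N p l₂ l a l₁ x t

/-- The matrix of integral solutions, with entries
`H_{p,q}(x) = binom(N, q) (x - 1) ^ (-p) J_{p,q}(x) / binom(N, p)`. Its first row (`p = 0`) is
`I_q(x) = binom(N, q) J_{0,q}(x)`; the factor `1 / binom(N, p)` makes the columns satisfy the
Fuchsian system. -/
def integralMatrix (N : ℕ) (l₂ l a l₁ : ℂ) (x : ℝ) : Matrix (Fin (N + 1)) (Fin (N + 1)) ℂ :=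
  Matrix.of fun p q =>
    (N.choose q : ℂ) * ((N.choose p : ℂ)⁻¹ * ((x : ℂ) - 1) ^ (-(p.val : ℤ)) *
      integralJ N p q l₂ l a l₁ x)

end SelbergFuchs

end

namespace SelbergFuchs

open scoped Topology

/-! Frobenius solutions. At `x = 0` the residue matrix `Y⁺` is triangular with eigenvalues `σ_k`. If
no two of these differ by an integer, every eigenvector extends by the power series recursion to
exactly one series, and `a_i ≠ 0` makes the first component of an eigenvector nonzero, hence usable
as a normalization. The recursion telescopes to `(σ_k + m - Y⁺) p_m = Y⁻ (p_0 + ... + p_{m-1})`, so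
the coefficients are `O((1 + δ)^m)` for every `δ > 0`, with constants governed by finitely many of
them (`FrobeniusRecursion.norm_le`). This gives convergence on `(0, 1)` and meromorphy in `λ₁`
(`meromorphic_frobeniusSum`).

Integral solutions. Let `F` be the integrand. The `t_i`-derivatives of `t_i (1 - t_i) F` times `e_p`
of the other variables have integral zero; adding them to the `x`-derivative gives a three-term
system for the integrals (`ode_identity`), which the factors `(x - 1)^(-p) / binom(N, p)` turn into
the Fuchsian system. Boundary terms are absent when all exponents are large. The general case
follows by the identity theorem in a common shift `s` of the four parameters, applied to the
integrated form of the system (`integralJ_sub`).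

Continuation in `λ₁`. Expanding `∏ t_j = ∏ (x + (t_j - x))` expresses the first row of `H` at `λ₁ +
1` through all rows at `λ₁`. Differentiating this relation up to `N` times along the two systems
yields `R H(λ₁) = S H(λ₁ + 1)`, with `R` and `S` polynomial in `1 / λ₁`. At `1 / λ₁ = 0` the matrix
`R` becomes, in a basis of eigenvectors, a Vandermonde matrix times an invertible diagonal one; so
`R` is invertible for all but finitely many `λ₁` (`contigDet_ne_zero`), and `H(λ₁) = R⁻¹ S H(λ₁ +
1)` continues `H` to the left strip by strip.

Connection matrix. `W` is invertible on `(0, 1)` and `W⁻¹ H` does not depend on `x`, so `C =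
W(1/2)⁻¹ H(1/2)` is meromorphic. The first row suffices for uniqueness because a solution with
vanishing first component is zero, again by `a_i ≠ 0`. -/

theorem hasSum_of_eq {E : Type*} [AddCommMonoid E] [TopologicalSpace E] {f g : ℕ → E} {a b : E}
    (h : HasSum f a) (hfg : ∀ m, g m = f m) (hab : b = a) : HasSum g b := by
  rw [hab, funext hfg]; exact h

/-! ### Power series with vector coefficients on the unit disc. -/

section PowerSeries

variable {E : Type*} [NormedAddCommGroup E] [NormedSpace ℂ E] [FiniteDimensional ℂ E]

theorem exists_norm_coeff_le {E : Type*} [NormedAddCommGroup E] [NormedSpace ℂ E] {c : ℕ → E}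
    (h : ∀ x ∈ Ioo (0 : ℝ) 1, Summable fun m : ℕ => (x : ℂ) ^ m • c m)
    {ρ : ℝ} (hρ : ρ ∈ Ioo (0 : ℝ) 1) : ∃ C, 0 ≤ C ∧ ∀ m, ‖c m‖ * ρ ^ m ≤ C := by
  obtain ⟨C, hC⟩ := ((h ρ hρ).tendsto_atTop_zero.norm).bddAbove_range
  have hC' : ∀ m, ‖c m‖ * ρ ^ m ≤ C := fun m => by
    have := hC (mem_range_self m)
    simpa [norm_smul, abs_of_pos hρ.1, mul_comm] using this
  exact ⟨C, (by positivity : (0 : ℝ) ≤ ‖c 0‖).trans (by simpa using hC' 0), hC'⟩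

theorem summable_powerSeries_of_Ioo {c : ℕ → E}
    (h : ∀ x ∈ Ioo (0 : ℝ) 1, Summable fun m : ℕ => (x : ℂ) ^ m • c m) {z : ℂ} (hz : ‖z‖ < 1) :
    Summable fun m : ℕ => z ^ m • c m := by
  obtain ⟨ρ, h1, h2⟩ := exists_between hz
  have hρ : ρ ∈ Ioo (0 : ℝ) 1 := ⟨(norm_nonneg _).trans_lt h1, h2⟩
  have := (h ρ hρ).norm
  refine Summable.of_norm_bounded this fun m => ?_
  simp only [norm_smul, norm_pow, Complex.norm_real, Real.norm_eq_abs, abs_of_pos hρ.1]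
  gcongr

theorem hasDerivAt_powerSeries {c : ℕ → E}
    (h : ∀ x ∈ Ioo (0 : ℝ) 1, Summable fun m : ℕ => (x : ℂ) ^ m • c m) {z : ℂ} (hz : ‖z‖ < 1) :
    (Summable fun m : ℕ => z ^ m • ((m + 1 : ℂ) • c (m + 1))) ∧
    HasDerivAt (fun z : ℂ => ∑' m : ℕ, z ^ m • c m)
      (∑' m : ℕ, z ^ m • ((m + 1 : ℂ) • c (m + 1))) z := by
  have : CompleteSpace E := FiniteDimensional.complete ℂ E
  obtain ⟨r, h1, h2⟩ := exists_between hz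
  obtain ⟨ρ, h3, h4⟩ := exists_between h2
  have hr : 0 < r := (norm_nonneg _).trans_lt h1
  have hρ : ρ ∈ Ioo (0 : ℝ) 1 := ⟨hr.trans h3, h4⟩
  obtain ⟨C, hC0, hC⟩ := exists_norm_coeff_le h hρ
  have hq : ‖r / ρ‖ < 1 := by
    rw [Real.norm_eq_abs, abs_of_pos (div_pos hr hρ.1)]; exact (div_lt_one hρ.1).2 h3
  -- With `‖z‖ < r < ρ < 1`, boundedness of `‖c m‖ ρ ^ m` dominates the differentiated terms on the
  -- disc of radius `r` by a multiple of `m (r / ρ) ^ m`.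
  have hu : Summable fun m : ℕ => C / r * ((m : ℝ) ^ 1 * (r / ρ) ^ m) :=
    Summable.mul_left _ (summable_pow_mul_geometric_of_norm_lt_one 1 hq)
  have hbound : ∀ (m : ℕ) (y : ℂ), y ∈ Metric.ball (0 : ℂ) r →
      ‖((m : ℂ) * y ^ (m - 1)) • c m‖ ≤ C / r * ((m : ℝ) ^ 1 * (r / ρ) ^ m) := by
    intro m y hy
    rw [mem_ball_zero_iff] at hy
    rcases m with _ | m
    · simp
    have h5 : ‖c (m + 1)‖ ≤ C / ρ ^ (m + 1) := by
      rw [le_div_iff₀ (pow_pos hρ.1 _)]; exact hC _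
    have h6 : ‖y‖ ^ m ≤ r ^ m := by gcongr
    rw [norm_smul, norm_mul, norm_pow, Complex.norm_natCast, Nat.add_sub_cancel, pow_one, div_pow]
    calc ((m + 1 : ℕ) : ℝ) * ‖y‖ ^ m * ‖c (m + 1)‖
        ≤ ((m + 1 : ℕ) : ℝ) * r ^ m * (C / ρ ^ (m + 1)) := by gcongr
      _ = _ := by field_simp; ring
  have hz' : z ∈ Metric.ball (0 : ℂ) r := by simpa using h1
  have hsum : Summable fun m : ℕ => ((m : ℂ) * z ^ (m - 1)) • c m :=
    Summable.of_norm_bounded hu fun m => hbound m z hz'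
  have hder : ∀ (m : ℕ) (y : ℂ), y ∈ Metric.ball (0 : ℂ) r →
      HasDerivAt (fun z : ℂ => z ^ m • c m) (((m : ℂ) * y ^ (m - 1)) • c m) y :=
    fun m y _ => (hasDerivAt_pow m y).smul_const (c m)
  have hd := hasDerivAt_tsum_of_isPreconnected (g := fun (m : ℕ) (z : ℂ) => z ^ m • c m)
    (g' := fun (m : ℕ) (z : ℂ) => ((m : ℂ) * z ^ (m - 1)) • c m) hu Metric.isOpen_ball
    (convex_ball (0 : ℂ) r).isPreconnected
    hder hbound hz'
    (summable_powerSeries_of_Ioo h hz) hz'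
  have hs1 : Summable fun m : ℕ => z ^ m • ((m + 1 : ℂ) • c (m + 1)) := by
    refine ((summable_nat_add_iff 1).2 hsum).congr fun m => ?_
    rw [smul_smul, Nat.add_sub_cancel, mul_comm]; push_cast; rfl
  refine ⟨hs1, ?_⟩
  convert hd using 1
  rw [hsum.tsum_eq_zero_add]
  simp only [Nat.cast_zero, zero_mul, zero_smul, zero_add]
  refine tsum_congr fun m => ?_
  rw [smul_smul, Nat.add_sub_cancel, mul_comm]; push_cast; rfl

/-- The limit `x → 0⁺` isolates the constant term; division by `x` shifts the sequence, and the
argument repeats. -/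
theorem coeff_eq_zero_of_powerSeries_eq_zero {c : ℕ → E}
    (h : ∀ x ∈ Ioo (0 : ℝ) 1, Summable fun m : ℕ => (x : ℂ) ^ m • c m)
    (h0 : ∀ x ∈ Ioo (0 : ℝ) 1, ∑' m : ℕ, (x : ℂ) ^ m • c m = 0) (m : ℕ) : c m = 0 := by
  have key : ∀ c : ℕ → E, (∀ x ∈ Ioo (0 : ℝ) 1, Summable fun m : ℕ => (x : ℂ) ^ m • c m) →
      (∀ x ∈ Ioo (0 : ℝ) 1, ∑' m : ℕ, (x : ℂ) ^ m • c m = 0) → c 0 = 0 := by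
    intro c h h0
    have hc := (hasDerivAt_powerSeries h (z := 0) (by simp)).2.continuousAt
    have hc' : Tendsto (fun x : ℝ => ∑' m : ℕ, (x : ℂ) ^ m • c m) (𝓝[>] 0)
        (𝓝 (∑' m : ℕ, (0 : ℂ) ^ m • c m)) := by
      have h1 : Tendsto (fun x : ℝ => (x : ℂ)) (𝓝[>] 0) (𝓝 0) :=
        (Complex.continuous_ofReal.tendsto' 0 0 (by simp)).mono_left nhdsWithin_le_nhds
      exact hc.tendsto.comp h1
    have h2 : Tendsto (fun x : ℝ => ∑' m : ℕ, (x : ℂ) ^ m • c m) (𝓝[>] 0) (𝓝 0) := by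
      refine tendsto_const_nhds.congr' ?_
      filter_upwards [Ioo_mem_nhdsGT (zero_lt_one (α := ℝ))] with x hx using (h0 x hx).symm
    have h3 := tendsto_nhds_unique hc' h2
    rw [tsum_eq_single 0 (by intro b hb; simp [hb])] at h3
    simpa using h3
  induction m generalizing c with
  | zero => exact key c h h0
  | succ m ih =>
    have hx : ∀ x ∈ Ioo (0 : ℝ) 1, ∀ m : ℕ,
        (x : ℂ) ^ m • c (m + 1) = (x : ℂ)⁻¹ • ((x : ℂ) ^ (m + 1) • c (m + 1)) := by
      intro x hx m
      have : (x : ℂ) ≠ 0 := by exact_mod_cast hx.1.ne'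
      rw [smul_smul]; rw [pow_succ']; field_simp
    refine ih (c := fun m => c (m + 1)) (fun x hx' => ?_) fun x hx' => ?_
    · refine Summable.congr (((summable_nat_add_iff 1).2 (h x hx')).const_smul (x : ℂ)⁻¹) fun m => ?_
      exact (hx x hx' m).symm
    · simp_rw [hx x hx']
      have h1 := (h x hx').tsum_eq_zero_add
      rw [h0 x hx', key c h h0] at h1
      rw [tsum_const_smul'']
      simp only [smul_zero, zero_add] at h1
      rw [← h1, smul_zero]

end PowerSeries

/-! ### Frobenius series and the recursion for their coefficients. -/

/-- The recursion satisfied by the coefficients of a Frobenius series with exponent `s`. -/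
structure FrobeniusRecursion {N : ℕ} (A B : Matrix (Fin (N + 1)) (Fin (N + 1)) ℂ) (s : ℂ)
    (p : ℕ → Fin (N + 1) → ℂ) : Prop where
  zero : s • p 0 - A.mulVec (p 0) = 0
  succ : ∀ m : ℕ, (s + (m + 1 : ℕ)) • p (m + 1) - A.mulVec (p (m + 1)) =
    (s + m) • p m - A.mulVec (p m) + B.mulVec (p m)

theorem mulVec_tsum {n : ℕ} (A : Matrix (Fin n) (Fin n) ℂ) {f : ℕ → Fin n → ℂ}
    (hf : Summable f) : Summable (fun m => A.mulVec (f m)) ∧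
      A.mulVec (∑' m, f m) = ∑' m, A.mulVec (f m) := by
  have h := (LinearMap.toContinuousLinearMap A.mulVecLin).hasSum hf.hasSum
  exact ⟨h.summable, h.tsum_eq.symm⟩

/-- Multiplied by `x ^ (1 - s) (1 - x)`, the differential equation says that one power series
vanishes on `(0, 1)`; its coefficients are the defects of the recursion. -/
theorem isSolution_frobeniusSum_iff {N : ℕ} {l₂ l a l₁ s : ℂ} {p : ℕ → Fin (N + 1) → ℂ}
    (h : ∀ x ∈ Ioo (0 : ℝ) 1, Summable fun m : ℕ => (x : ℂ) ^ m • p m) :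
    IsSolution N l₂ l a l₁ (frobeniusSum s p) ↔
      FrobeniusRecursion (Yplus N l₂ l a l₁) (Yminus N l₂ l a) s p := by
  set A := Yplus N l₂ l a l₁
  set B := Yminus N l₂ l a
  -- The coefficients of `(1 - x) (s g + x g' - A g) - x B g`, where `g` is the sum of the series.
  let d : ℕ → Fin (N + 1) → ℂ := fun m => Nat.casesOn m (s • p 0 - A.mulVec (p 0)) fun m =>
    (s + (m + 1 : ℕ)) • p (m + 1) - A.mulVec (p (m + 1)) -
      ((s + m) • p m - A.mulVec (p m)) - B.mulVec (p m)
  have hd : FrobeniusRecursion A B s p ↔ ∀ m, d m = 0 := by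
    constructor
    · rintro ⟨h0, h1⟩ m
      rcases m with _ | m
      · exact h0
      · simp only [d, h1 m]; abel
    · intro hm
      refine ⟨hm 0, fun m => ?_⟩
      have := hm (m + 1)
      simp only [d] at this
      rw [sub_sub, sub_eq_zero] at this
      exact this
  have hkey : ∀ x ∈ Ioo (0 : ℝ) 1, Summable (fun m => (x : ℂ) ^ m • d m) ∧
      (HasDerivAt (frobeniusSum s p) (((x : ℂ)⁻¹ • A + (1 - (x : ℂ))⁻¹ • B).mulVec
        (frobeniusSum s p x)) x ↔ ∑' m, (x : ℂ) ^ m • d m = 0) := by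
    intro x hx
    have hxn : ‖(x : ℂ)‖ < 1 := by
      rw [Complex.norm_real, Real.norm_eq_abs, abs_of_pos hx.1]; exact hx.2
    have hx0 : (x : ℂ) ≠ 0 := by exact_mod_cast hx.1.ne'
    have hx1 : 1 - (x : ℂ) ≠ 0 := by
      rw [sub_ne_zero]; exact_mod_cast hx.2.ne'
    obtain ⟨hs, hderiv⟩ := hasDerivAt_powerSeries h hxn
    set g : Fin (N + 1) → ℂ := ∑' m : ℕ, (x : ℂ) ^ m • p m with hg
    set g' : Fin (N + 1) → ℂ := ∑' m : ℕ, (x : ℂ) ^ m • ((m + 1 : ℂ) • p (m + 1)) with hg'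
    have hw : HasDerivAt (frobeniusSum s p) ((x : ℂ) ^ s • g' + (s * (x : ℂ) ^ (s - 1)) • g) x := by
      have h1 : HasDerivAt (fun z : ℂ => z ^ s) (s * (x : ℂ) ^ (s - 1)) (x : ℂ) := by
        simpa using (hasDerivAt_id (x : ℂ)).cpow_const (c := s) (Or.inl (by simpa using hx.1))
      have h2 : HasDerivAt (fun z : ℂ => z ^ s • ∑' m : ℕ, z ^ m • p m)
        ((x : ℂ) ^ s • g' + (s * (x : ℂ) ^ (s - 1)) • g) (x : ℂ) := h1.smul hderiv
      have h3 := h2.scomp x Complex.ofRealCLM.hasDerivAt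
      simp only [Complex.ofRealCLM_apply, Complex.ofReal_one, one_smul] at h3
      exact h3
    have hS := h x hx
    have hS0 := (summable_nat_add_iff 1).2 hS
    have hg0 : g = p 0 + ∑' m : ℕ, (x : ℂ) ^ (m + 1) • p (m + 1) := by
      rw [hg, hS.tsum_eq_zero_add]; simp
    have hA := mulVec_tsum A hS
    have hB := mulVec_tsum B hS
    -- the series of `s g + x g' - A g`
    have hxg' : HasSum (fun m : ℕ => (x : ℂ) ^ m • ((m : ℂ) • p m)) ((x : ℂ) • g') := by
      rw [← hasSum_nat_add_iff' 1]
      simp only [Finset.range_one, Finset.sum_singleton, Nat.cast_zero, zero_smul, smul_zero,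
        sub_zero]
      refine hasSum_of_eq (hs.hasSum.const_smul (x : ℂ)) (fun m => ?_) rfl
      simp only [smul_smul]; congr 1; push_cast; ring
    have hh : HasSum (fun m : ℕ => (x : ℂ) ^ m • ((s + m) • p m - A.mulVec (p m)))
        (s • g + (x : ℂ) • g' - A.mulVec g) := by
      have hAs : HasSum (fun m => A.mulVec ((x : ℂ) ^ m • p m)) (A.mulVec g) := by
        rw [hg, hA.2]; exact hA.1.hasSum
      refine hasSum_of_eq (((hS.hasSum.const_smul s).add hxg').sub hAs) (fun m => ?_) rfl
      rw [Matrix.mulVec_smul, smul_sub, smul_smul, smul_smul, smul_smul, ← add_smul]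
      congr 2; ring
    have hBs : HasSum (fun m => (x : ℂ) ^ m • B.mulVec (p m)) (B.mulVec g) := by
      have := hB.1.hasSum
      rw [← hB.2] at this
      exact hasSum_of_eq this (fun m => by rw [Matrix.mulVec_smul]) rfl
    have hdsum : HasSum (fun m => (x : ℂ) ^ m • d m)
        ((1 - (x : ℂ)) • (s • g + (x : ℂ) • g' - A.mulVec g) - (x : ℂ) • B.mulVec g) := by
      rw [← hasSum_nat_add_iff' 1]
      have h1 := (hasSum_nat_add_iff' 1).2 hh
      have h2 := (h1.sub (hh.const_smul (x : ℂ))).sub (hBs.const_smul (x : ℂ))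
      refine hasSum_of_eq h2 (fun m => ?_) ?_
      · simp only [d, smul_sub, smul_smul, pow_succ', mul_assoc]
      · have hd0 : d 0 = s • p 0 - A.mulVec (p 0) := rfl
        simp only [Finset.range_one, Finset.sum_singleton, hd0, pow_zero, one_smul, Nat.cast_zero,
          add_zero, sub_smul]
        abel
    refine ⟨hdsum.summable, ?_⟩
    rw [hdsum.tsum_eq]
    have hcp : (x : ℂ) ^ s ≠ 0 := by simp [Complex.cpow_eq_zero_iff, hx0]
    have hcp1 : (x : ℂ) ^ (s - 1) = (x : ℂ) ^ s * (x : ℂ)⁻¹ := by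
      rw [Complex.cpow_sub _ _ hx0, Complex.cpow_one, div_eq_mul_inv]
    have hrw : (x : ℂ) ^ s • g' + (s * (x : ℂ) ^ (s - 1)) • g -
        ((x : ℂ)⁻¹ • A + (1 - (x : ℂ))⁻¹ • B).mulVec (frobeniusSum s p x) =
        ((x : ℂ) ^ s * (x : ℂ)⁻¹ * (1 - (x : ℂ))⁻¹) •
        ((1 - (x : ℂ)) • (s • g + (x : ℂ) • g' - A.mulVec g) - (x : ℂ) • B.mulVec g) := by
      rw [frobeniusSum, ← hg, Matrix.mulVec_smul, Matrix.add_mulVec, Matrix.smul_mulVec,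
        Matrix.smul_mulVec, hcp1]
      ext i
      simp only [Pi.add_apply, Pi.sub_apply, Pi.smul_apply, smul_eq_mul]
      field_simp
      ring
    constructor
    · intro h1
      have h2 := hw.unique h1
      rw [← sub_eq_zero, hrw, smul_eq_zero] at h2
      refine h2.resolve_left ?_
      simp [hx0, hx1, hcp]
    · intro h1
      rw [h1, smul_zero, sub_eq_zero] at hrw
      rw [← hrw]; exact hw
  rw [hd]
  constructor
  · intro hsol m
    exact coeff_eq_zero_of_powerSeries_eq_zero (fun x hx => (hkey x hx).1)
      (fun x hx => (hkey x hx).2.1 (hsol x hx)) m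
  · intro hm x hx
    exact (hkey x hx).2.2 (by simp [hm])


/-! ### Meromorphic matrices and series of meromorphic functions. -/

section Meromorphic

theorem eventually_punctured_of_codiscrete {P : ℂ → Prop} (h : ∀ᶠ z in codiscrete ℂ, P z) (w : ℂ) :
    ∀ᶠ z in 𝓝[≠] w, P z := by
  have := mem_codiscrete.1 h w
  rwa [disjoint_principal_right, compl_compl] at this

theorem meromorphicAt_det {n : ℕ} {A : ℂ → Matrix (Fin n) (Fin n) ℂ} {w : ℂ}
    (h : ∀ i j, MeromorphicAt (fun z => A z i j) w) : MeromorphicAt (fun z => (A z).det) w := by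
  simp only [Matrix.det_apply']
  exact MeromorphicAt.fun_sum fun σ _ =>
    (MeromorphicAt.const _ w).mul (MeromorphicAt.fun_prod fun i _ => h _ _)

theorem differentiableAt_det {n : ℕ} {A : ℂ → Matrix (Fin n) (Fin n) ℂ} {w : ℂ}
    (h : ∀ i j, DifferentiableAt ℂ (fun z => A z i j) w) :
    DifferentiableAt ℂ (fun z => (A z).det) w := by
  simp only [Matrix.det_apply']
  fun_prop

theorem meromorphicAt_inv {n : ℕ} {A : ℂ → Matrix (Fin n) (Fin n) ℂ} {w : ℂ}
    (h : ∀ i j, MeromorphicAt (fun z => A z i j) w) (i j : Fin n) :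
    MeromorphicAt (fun z => (A z)⁻¹ i j) w := by
  simp only [Matrix.inv_def, Matrix.smul_apply, Ring.inverse_eq_inv', smul_eq_mul,
    Matrix.adjugate_apply]
  refine (meromorphicAt_det h).inv.mul (meromorphicAt_det fun i' j' => ?_)
  simp only [Matrix.updateRow_apply]
  split_ifs
  · exact MeromorphicAt.const _ _
  · exact h _ _

theorem differentiableAt_inv {n : ℕ} {A : ℂ → Matrix (Fin n) (Fin n) ℂ} {w : ℂ}
    (h : ∀ i j, DifferentiableAt ℂ (fun z => A z i j) w) (hA : (A w).det ≠ 0) (i j : Fin n) :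
    DifferentiableAt ℂ (fun z => (A z)⁻¹ i j) w := by
  simp only [Matrix.inv_def, Matrix.smul_apply, Ring.inverse_eq_inv', smul_eq_mul,
    Matrix.adjugate_apply]
  refine ((differentiableAt_det h).inv hA).mul (differentiableAt_det fun i' j' => ?_)
  simp only [Matrix.updateRow_apply]
  split_ifs
  · exact differentiableAt_const _
  · exact h _ _

theorem meromorphicAt_mulVec {n : ℕ} {A : ℂ → Matrix (Fin n) (Fin n) ℂ} {v : ℂ → Fin n → ℂ} {w : ℂ}
    (h : ∀ i j, MeromorphicAt (fun z => A z i j) w) (hv : ∀ i, MeromorphicAt (fun z => v z i) w)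
    (i : Fin n) : MeromorphicAt (fun z => (A z).mulVec (v z) i) w := by
  simp only [Matrix.mulVec, dotProduct]
  exact MeromorphicAt.fun_sum fun j _ => (h i j).mul (hv j)

theorem differentiableAt_mulVec {n : ℕ} {A : ℂ → Matrix (Fin n) (Fin n) ℂ} {v : ℂ → Fin n → ℂ}
    {w : ℂ} (h : ∀ i j, DifferentiableAt ℂ (fun z => A z i j) w)
    (hv : ∀ i, DifferentiableAt ℂ (fun z => v z i) w) (i : Fin n) :
    DifferentiableAt ℂ (fun z => (A z).mulVec (v z) i) w := by
  simp only [Matrix.mulVec, dotProduct]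
  fun_prop

theorem meromorphicAt_mul {n : ℕ} {A B : ℂ → Matrix (Fin n) (Fin n) ℂ} {w : ℂ}
    (h : ∀ i j, MeromorphicAt (fun z => A z i j) w) (hB : ∀ i j, MeromorphicAt (fun z => B z i j) w)
    (i j : Fin n) : MeromorphicAt (fun z => (A z * B z) i j) w := by
  simp only [Matrix.mul_apply]
  exact MeromorphicAt.fun_sum fun k _ => (h i k).mul (hB k j)

theorem MeromorphicAt.exists_pow_mul_norm_le {f : ℂ → ℂ} {w : ℂ} (h : MeromorphicAt f w) :
    ∃ (r : ℕ) (C : ℝ), ∀ᶠ z in 𝓝[≠] w, ‖z - w‖ ^ r * ‖f z‖ ≤ C := by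
  obtain ⟨r, hr⟩ := h
  have h1 := hr.continuousAt.norm
  refine ⟨r, ‖(w - w) ^ r • f w‖ + 1, ?_⟩
  have h2 := (h1.eventually_lt continuousAt_const (lt_add_one _)).filter_mono
    (nhdsWithin_le_nhds (s := {w}ᶜ))
  filter_upwards [h2] with z hz
  rw [← norm_pow, ← norm_mul]; exact hz.le

theorem exists_pow_mul_sum_norm_le {ι : Type*} (s : Finset ι) {f : ι → ℂ → ℂ} {w : ℂ}
    (h : ∀ i ∈ s, MeromorphicAt (f i) w) :
    ∃ (r : ℕ) (C : ℝ), ∀ᶠ z in 𝓝[≠] w, ‖z - w‖ ^ r * ∑ i ∈ s, ‖f i z‖ ≤ C := by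
  classical
  induction s using Finset.induction_on with
  | empty => exact ⟨0, 0, by simp⟩
  | insert i s hi ih =>
    obtain ⟨r, C, h1⟩ := ih fun j hj => h j (Finset.mem_insert_of_mem hj)
    obtain ⟨r', C', h2⟩ := MeromorphicAt.exists_pow_mul_norm_le (h i (Finset.mem_insert_self _ _))
    refine ⟨r + r', C + C', ?_⟩
    have h3 : ∀ᶠ z in 𝓝[≠] w, ‖z - w‖ < 1 := by
      refine Filter.Eventually.filter_mono nhdsWithin_le_nhds ?_
      filter_upwards [Metric.ball_mem_nhds w one_pos] with z hz using by simpa [dist_eq_norm] using hz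
    filter_upwards [h1, h2, h3] with z hz1 hz2 hz3
    rw [Finset.sum_insert hi, mul_add, add_comm]
    have ha : ‖z - w‖ ^ (r + r') ≤ ‖z - w‖ ^ r :=
      pow_le_pow_of_le_one (norm_nonneg _) hz3.le (Nat.le_add_right _ _)
    have hb : ‖z - w‖ ^ (r + r') ≤ ‖z - w‖ ^ r' :=
      pow_le_pow_of_le_one (norm_nonneg _) hz3.le (Nat.le_add_left _ _)
    refine add_le_add (le_trans ?_ hz1) (le_trans ?_ hz2)
    · exact mul_le_mul_of_nonneg_right ha (Finset.sum_nonneg fun _ _ => norm_nonneg _)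
    · exact mul_le_mul_of_nonneg_right hb (norm_nonneg _)

/-- A pole order `r` common to all terms makes `(z - w) ^ r` times the sum a bounded holomorphic
function on a punctured disc, whose singularity is removable. -/
theorem meromorphicAt_tsum {f : ℕ → ℂ → ℂ} {w : ℂ} {u : ℕ → ℝ} (hu : Summable u) (r : ℕ)
    (h : ∀ᶠ z in 𝓝[≠] w, ∀ m, DifferentiableAt ℂ (f m) z ∧ ‖z - w‖ ^ r * ‖f m z‖ ≤ u m) :
    MeromorphicAt (fun z => ∑' m, f m z) w := by
  obtain ⟨ε, hε, hball⟩ := Metric.mem_nhdsWithin_iff.1 h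
  set V := Metric.ball w ε \ {w} with hV
  have hVo : IsOpen V := Metric.isOpen_ball.sdiff isClosed_singleton
  have hf : ∀ z ∈ V, ∀ m, DifferentiableAt ℂ (f m) z ∧ ‖z - w‖ ^ r * ‖f m z‖ ≤ u m :=
    fun z hz => hball ⟨hz.1, hz.2⟩
  let g : ℕ → ℂ → ℂ := fun m z => (z - w) ^ r * f m z
  have hg : ∀ m z, z ∈ V → ‖g m z‖ ≤ u m := fun m z hz => by
    simpa [g] using (hf z hz m).2
  have hd : DifferentiableOn ℂ (fun z => ∑' m, g m z) V := by
    refine Complex.differentiableOn_tsum_of_summable_norm hu (fun m z hz => ?_) hVo hg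
    have := (hf z hz m).1
    exact DifferentiableAt.differentiableWithinAt (by fun_prop)
  have hb : BddAbove (norm ∘ (fun z => ∑' m, g m z) '' V) := by
    refine ⟨∑' m, u m, ?_⟩
    rintro _ ⟨z, hz, rfl⟩
    have hs : Summable fun m => ‖g m z‖ :=
      Summable.of_nonneg_of_le (fun _ => norm_nonneg _) (fun m => hg m z hz) hu
    exact (norm_tsum_le_tsum_norm hs).trans (hs.tsum_le_tsum (fun m => hg m z hz) hu)
  have hrem := Complex.differentiableOn_update_limUnder_of_bddAbove (Metric.ball_mem_nhds w hε) hd hb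
  have han := (hrem.analyticAt (Metric.ball_mem_nhds w hε)).meromorphicAt
  have h1 : MeromorphicAt (fun z => ((z - w) ^ r)⁻¹ * ∑' m, g m z) w := by
    refine MeromorphicAt.mul ?_ ?_
    · exact ((MeromorphicAt.id w).sub (MeromorphicAt.const w w)).pow r |>.inv
    · refine han.congr ?_
      filter_upwards [self_mem_nhdsWithin] with z hz
      rw [Function.update_of_ne hz]
  refine h1.congr ?_
  filter_upwards [self_mem_nhdsWithin] with z hz
  have : (z - w) ^ r ≠ 0 := pow_ne_zero _ (sub_ne_zero.2 hz)
  simp only [g]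
  rw [tsum_mul_left, inv_mul_cancel_left₀ this]

end Meromorphic

/-! ### Growth of the Frobenius coefficients. -/

section Coefficients

variable {N : ℕ}

/-- The sum of the norms of the entries of a matrix. -/
noncomputable def entrySum {n : ℕ} (A : Matrix (Fin n) (Fin n) ℂ) : ℝ := ∑ i, ∑ j, ‖A i j‖

theorem entrySum_nonneg {n : ℕ} (A : Matrix (Fin n) (Fin n) ℂ) : 0 ≤ entrySum A :=
  Finset.sum_nonneg fun _ _ => Finset.sum_nonneg fun _ _ => norm_nonneg _

theorem norm_mulVec_le {n : ℕ} (A : Matrix (Fin n) (Fin n) ℂ) (v : Fin n → ℂ) :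
    ‖A.mulVec v‖ ≤ entrySum A * ‖v‖ := by
  refine (pi_norm_le_iff_of_nonneg (mul_nonneg (entrySum_nonneg A) (norm_nonneg _))).2 fun i => ?_
  rw [Matrix.mulVec, dotProduct]
  calc ‖∑ j, A i j * v j‖ ≤ ∑ j, ‖A i j‖ * ‖v‖ := by
        refine (norm_sum_le _ _).trans (Finset.sum_le_sum fun j _ => ?_)
        rw [norm_mul]
        gcongr
        exact norm_le_pi_norm v j
    _ = (∑ j, ‖A i j‖) * ‖v‖ := by rw [Finset.sum_mul]
    _ ≤ entrySum A * ‖v‖ := by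
        gcongr
        exact Finset.single_le_sum (f := fun i => ∑ j, ‖A i j‖)
          (fun _ _ => Finset.sum_nonneg fun _ _ => norm_nonneg _) (Finset.mem_univ i)

/-- The solution of the Frobenius recursion with leading coefficient `v`. -/
noncomputable def recCoeff (A B : Matrix (Fin (N + 1)) (Fin (N + 1)) ℂ) (s : ℂ) (v : Fin (N + 1) → ℂ) :
    ℕ → Fin (N + 1) → ℂ
  | 0 => v
  | m + 1 => ((s + (m + 1 : ℕ)) • (1 : Matrix (Fin (N + 1)) (Fin (N + 1)) ℂ) - A)⁻¹.mulVec
      ((s + m) • recCoeff A B s v m - A.mulVec (recCoeff A B s v m) +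
        B.mulVec (recCoeff A B s v m))

variable {A B : Matrix (Fin (N + 1)) (Fin (N + 1)) ℂ} {s : ℂ}

theorem smul_one_sub_mulVec (c : ℂ) (v : Fin (N + 1) → ℂ) :
    (c • (1 : Matrix (Fin (N + 1)) (Fin (N + 1)) ℂ) - A).mulVec v = c • v - A.mulVec v := by
  rw [Matrix.sub_mulVec, Matrix.smul_mulVec, Matrix.one_mulVec]

theorem recCoeff_recursion {v : Fin (N + 1) → ℂ} (hv : s • v - A.mulVec v = 0)
    (hdet : ∀ m : ℕ, ((s + (m + 1 : ℕ)) • (1 : Matrix (Fin (N + 1)) (Fin (N + 1)) ℂ) - A).det ≠ 0) :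
    FrobeniusRecursion A B s (recCoeff A B s v) := by
  refine ⟨hv, fun m => ?_⟩
  rw [← smul_one_sub_mulVec, recCoeff, Matrix.mulVec_mulVec,
    Matrix.mul_nonsing_inv _ (isUnit_iff_ne_zero.2 (hdet m)), Matrix.one_mulVec]

theorem FrobeniusRecursion.unique {p p' : ℕ → Fin (N + 1) → ℂ}
    (hdet : ∀ m : ℕ, ((s + (m + 1 : ℕ)) • (1 : Matrix (Fin (N + 1)) (Fin (N + 1)) ℂ) - A).det ≠ 0)
    (h : FrobeniusRecursion A B s p) (h' : FrobeniusRecursion A B s p') (h0 : p' 0 = p 0) :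
    p' = p := by
  funext m
  induction m with
  | zero => exact h0
  | succ m ih =>
    have h1 := h.succ m
    have h2 := h'.succ m
    rw [ih, ← h1, ← smul_one_sub_mulVec, ← smul_one_sub_mulVec] at h2
    exact Matrix.mulVec_injective_of_isUnit
      ((Matrix.isUnit_iff_isUnit_det _).2 (isUnit_iff_ne_zero.2 (hdet m))) h2

/-- The recursion telescopes: expanding `1 / (1 - x)` makes partial sums of the coefficients appear.
-/
theorem FrobeniusRecursion.eq_sum {p : ℕ → Fin (N + 1) → ℂ} (h : FrobeniusRecursion A B s p)
    (m : ℕ) : (s + m) • p m - A.mulVec (p m) = B.mulVec (∑ j ∈ Finset.range m, p j) := by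
  induction m with
  | zero => simpa using h.zero
  | succ m ih => rw [h.succ m, ih, Finset.sum_range_succ, Matrix.mulVec_add]

/-- Let `T m` be the sum of the norms of the first `m` coefficients. For `m ≥ M` the telescoped
relation gives `(M - K) ‖p m‖ ≤ K T m`, hence `‖p m‖ ≤ δ T m`, and `T` grows at most by the factor
`1 + δ` per step. Only `K` and the first `M` coefficients enter, so the bound is locally uniform in
the parameters. -/
theorem FrobeniusRecursion.norm_le {p : ℕ → Fin (N + 1) → ℂ} (h : FrobeniusRecursion A B s p)
    {K δ : ℝ} (hδ : 0 < δ) (hK : ‖s‖ + entrySum A + entrySum B ≤ K) {M : ℕ} (hKM : K < M)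
    (hM : K ≤ δ * (M - K)) (m : ℕ) :
    ‖p m‖ ≤ (∑ j ∈ Finset.range M, ‖p j‖) * (1 + δ) ^ m := by
  have hA := entrySum_nonneg A
  have hB := entrySum_nonneg B
  have hs := norm_nonneg s
  set T : ℕ → ℝ := fun m => ∑ j ∈ Finset.range m, ‖p j‖ with hT
  have hT0 : ∀ m, 0 ≤ T m := fun m => Finset.sum_nonneg fun _ _ => norm_nonneg _
  have hstep : ∀ m, M ≤ m → ‖p m‖ ≤ δ * T m := by
    intro m hm
    have hmM : (M : ℝ) ≤ m := by exact_mod_cast hm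
    have h1 := h.eq_sum m
    have h2 : (m : ℂ) • p m = B.mulVec (∑ j ∈ Finset.range m, p j) + A.mulVec (p m) - s • p m := by
      rw [← h1, add_smul]; abel
    have h3 : (m : ℝ) * ‖p m‖ ≤ entrySum B * T m + entrySum A * ‖p m‖ + ‖s‖ * ‖p m‖ := by
      have : (m : ℝ) * ‖p m‖ = ‖(m : ℂ) • p m‖ := by rw [norm_smul, Complex.norm_natCast]
      rw [this, h2]
      refine (norm_sub_le _ _).trans (add_le_add ((norm_add_le _ _).trans (add_le_add ?_ ?_)) ?_)
      · exact (norm_mulVec_le _ _).trans (mul_le_mul_of_nonneg_left (norm_sum_le _ _) hB)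
      · exact norm_mulVec_le _ _
      · rw [norm_smul]
    have h4 : (M - K) * ‖p m‖ ≤ (M - K) * (δ * T m) := by
      have h5 : entrySum B * T m ≤ K * T m := mul_le_mul_of_nonneg_right (by linarith) (hT0 m)
      have h6 : (entrySum A + ‖s‖) * ‖p m‖ ≤ K * ‖p m‖ :=
        mul_le_mul_of_nonneg_right (by linarith) (norm_nonneg _)
      have h7 : K * T m ≤ δ * (M - K) * T m := mul_le_mul_of_nonneg_right hM (hT0 m)
      have h8 : (M : ℝ) * ‖p m‖ ≤ m * ‖p m‖ := mul_le_mul_of_nonneg_right hmM (norm_nonneg _)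
      nlinarith
    exact le_of_mul_le_mul_left h4 (by linarith)
  have hTm : ∀ m, T (M + m) ≤ T M * (1 + δ) ^ m := by
    intro m
    induction m with
    | zero => simp
    | succ m ih =>
      have h1 : T (M + (m + 1)) = T (M + m) + ‖p (M + m)‖ := by
        simp only [hT]; rw [← add_assoc, Finset.sum_range_succ]
      rw [h1]
      calc T (M + m) + ‖p (M + m)‖ ≤ T (M + m) * (1 + δ) := by
            linarith [hstep (M + m) (Nat.le_add_right _ _)]
        _ ≤ T M * (1 + δ) ^ m * (1 + δ) := by gcongr
        _ = _ := by rw [pow_succ]; ring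
  have h1δ : 1 ≤ (1 + δ) := by linarith
  have hpow : ∀ m : ℕ, 1 ≤ (1 + δ) ^ m := fun m => one_le_pow₀ h1δ
  -- By truncated subtraction the index is `M` if `m < M` and `m + 1` otherwise.
  have hmono : ‖p m‖ ≤ T (M + (m + 1 - M)) := by
    refine Finset.single_le_sum (f := fun j => ‖p j‖) (fun _ _ => norm_nonneg _) ?_
    simp; omega
  rcases lt_or_ge m M with hm | hm
  · have : m + 1 - M = 0 := by omega
    rw [this, add_zero] at hmono
    exact hmono.trans (le_mul_of_one_le_right (hT0 M) (hpow m))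
  · have hMpos : 0 < M := by
      have : (0 : ℝ) < M := by linarith
      exact_mod_cast this
    exact hmono.trans ((hTm _).trans (mul_le_mul_of_nonneg_left
      (pow_le_pow_right₀ h1δ (by omega)) (hT0 M)))

theorem exists_threshold (K : ℝ) {δ : ℝ} (hδ : 0 < δ) : ∃ M : ℕ, K < M ∧ K ≤ δ * (M - K) := by
  obtain ⟨M, hM⟩ := exists_nat_gt (max K (K / δ + K))
  refine ⟨M, (le_max_left _ _).trans_lt hM, ?_⟩
  have h1 : K / δ ≤ M - K := by linarith [le_max_right K (K / δ + K)]
  rwa [div_le_iff₀' hδ] at h1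

theorem FrobeniusRecursion.summable {p : ℕ → Fin (N + 1) → ℂ} (h : FrobeniusRecursion A B s p)
    {x : ℝ} (hx : x ∈ Ioo (0 : ℝ) 1) : Summable fun m : ℕ => (x : ℂ) ^ m • p m := by
  obtain ⟨y, h1, h2⟩ := exists_between hx.2
  -- With `δ = y / x - 1` the growth bound gives terms of size `((1 + δ) x) ^ m = y ^ m`, where `y <
  -- 1`.
  have hδ : 0 < y / x - 1 := by rw [sub_pos, one_lt_div hx.1]; exact h1
  obtain ⟨M, hM1, hM2⟩ := exists_threshold (‖s‖ + entrySum A + entrySum B) hδ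
  refine Summable.of_norm_bounded
    ((summable_geometric_of_lt_one (hx.1.trans h1).le h2).mul_left
      (∑ j ∈ Finset.range M, ‖p j‖)) fun m => ?_
  have := h.norm_le hδ le_rfl hM1 hM2 m
  rw [norm_smul, norm_pow, Complex.norm_real, Real.norm_eq_abs, abs_of_pos hx.1]
  calc x ^ m * ‖p m‖ ≤ x ^ m * ((∑ j ∈ Finset.range M, ‖p j‖) * (1 + (y / x - 1)) ^ m) := by
        exact mul_le_mul_of_nonneg_left this (pow_nonneg hx.1.le _)
    _ = _ := by
        have : x ≠ 0 := hx.1.ne'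
        rw [add_sub_cancel, div_pow]; field_simp

end Coefficients


/-! ### Eigenvectors of `Y⁺`; existence and uniqueness of the Frobenius solutions. -/

section Frobenius

variable {N : ℕ} {l₂ l a l₁ : ℂ}

theorem Yplus_mulVec_of_lt (v : Fin (N + 1) → ℂ) {p : ℕ} (hp : p + 1 < N + 1) :
    (Yplus N l₂ l a l₁).mulVec v ⟨p, by omega⟩ =
      sigma l a l₁ (N - p) * v ⟨p, by omega⟩ + aCoeff N l₂ l a l₁ (N - p) * v ⟨p + 1, hp⟩ := by
  have hne : (⟨p, by omega⟩ : Fin (N + 1)) ≠ ⟨p + 1, hp⟩ := by simp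
  rw [Matrix.mulVec, dotProduct, Fintype.sum_eq_add _ _ hne]
  · simp [Yplus]
  · rintro r ⟨h1, h2⟩
    have h3 : r.val ≠ p := fun h => h1 (Fin.ext h)
    have h4 : r.val ≠ p + 1 := fun h => h2 (Fin.ext h)
    simp [Yplus, h3, h4]

theorem Yplus_mulVec_last (v : Fin (N + 1) → ℂ) :
    (Yplus N l₂ l a l₁).mulVec v ⟨N, by omega⟩ = sigma l a l₁ 0 * v ⟨N, by omega⟩ := by
  rw [Matrix.mulVec, dotProduct, Fintype.sum_eq_single (⟨N, by omega⟩ : Fin (N + 1))]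
  · simp [Yplus]
  · intro r h1
    have h3 : r.val ≠ N := fun h => h1 (Fin.ext h)
    have h4 : r.val ≠ N + 1 := by omega
    simp [Yplus, h3, h4]

theorem det_smul_one_sub_Yplus (c : ℂ) :
    (c • (1 : Matrix (Fin (N + 1)) (Fin (N + 1)) ℂ) - Yplus N l₂ l a l₁).det =
      ∏ p : Fin (N + 1), (c - sigma l a l₁ (N - p.val)) := by
  rw [Matrix.det_of_isUpperTriangular]
  · refine Finset.prod_congr rfl fun p _ => ?_
    simp [Yplus]
  · intro i j hij
    have hij' : j.val < i.val := hij
    have h1 : j.val ≠ i.val := by omega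
    have h2 : j.val ≠ i.val + 1 := by omega
    have h3 : i ≠ j := fun h => h1 (by rw [h])
    simp [Yplus, h1, h2, h3]

/-- This is nonresonance: an eigenvalue `σ_k + m + 1` of `Y⁺` would be an exponent differing from
`σ_k` by a nonzero integer. -/
theorem Generic.det_ne_zero (h : Generic N l₂ l a l₁) (k : Fin (N + 1)) (m : ℕ) :
    ((sigma l a l₁ k + (m + 1 : ℕ)) • (1 : Matrix (Fin (N + 1)) (Fin (N + 1)) ℂ) -
      Yplus N l₂ l a l₁).det ≠ 0 := by
  rw [det_smul_one_sub_Yplus, Finset.prod_ne_zero_iff]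
  intro p _ h0
  set j : Fin (N + 1) := ⟨N - p.val, by omega⟩
  by_cases hjk : j = k
  · have h1 : sigma l a l₁ (N - p.val) = sigma l a l₁ k := by rw [← hjk]
    rw [h1] at h0
    have : ((m + 1 : ℕ) : ℂ) = 0 := by linear_combination h0
    exact Nat.cast_ne_zero.2 (Nat.succ_ne_zero m) this
  · refine h.1 j k hjk (-((m + 1 : ℕ) : ℤ)) ?_
    push_cast at h0 ⊢
    linear_combination h0

theorem Generic.aCoeff_ne_zero (h : Generic N l₂ l a l₁) {p : ℕ} (hp : p < N) :
    aCoeff N l₂ l a l₁ (N - p) ≠ 0 :=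
  h.2 _ (Finset.mem_Icc.2 ⟨by omega, by omega⟩)

/-- The eigenvector of `Y⁺` with eigenvalue `σ_k` and first component `1`. -/
noncomputable def eigvec (N : ℕ) (l₂ l a l₁ : ℂ) (k : ℕ) : Fin (N + 1) → ℂ := fun p =>
  ∏ j ∈ Finset.range p, (sigma l a l₁ k - sigma l a l₁ (N - j)) / aCoeff N l₂ l a l₁ (N - j)

theorem eigvec_zero (k : ℕ) : eigvec N l₂ l a l₁ k 0 = 1 := by simp [eigvec]

theorem Generic.mulVec_eigvec (h : Generic N l₂ l a l₁) (k : Fin (N + 1)) :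
    (Yplus N l₂ l a l₁).mulVec (eigvec N l₂ l a l₁ k) = sigma l a l₁ k • eigvec N l₂ l a l₁ k := by
  ext ⟨p, hp⟩
  rcases lt_or_ge p N with hpN | hpN
  · rw [Yplus_mulVec_of_lt _ (by omega)]
    have ha := h.aCoeff_ne_zero hpN
    simp only [eigvec, Finset.prod_range_succ, Pi.smul_apply, smul_eq_mul]
    field_simp
    ring
  · obtain rfl : p = N := by omega
    rw [Yplus_mulVec_last, Pi.smul_apply, smul_eq_mul]
    by_cases hk : k.val = 0
    · rw [hk]
    -- The factor with `N - j = k` vanishes: the eigenvector for `σ_k` has no entries beyond the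
    -- index `N - k`.
    · have : eigvec p l₂ l a l₁ k ⟨p, hp⟩ = 0 := by
        refine Finset.prod_eq_zero (i := p - k.val) (Finset.mem_range.2 ?_) ?_
        · show p - k.val < p
          omega
        · have : p - (p - k.val) = k.val := by omega
          rw [this, sub_self, zero_div]
      rw [this, mul_zero, mul_zero]

/-- Vectors annihilated by all `(Y⁺ - s)` rows but the last are determined by their first entry. -/
theorem Generic.eq_of_first_eq (h : Generic N l₂ l a l₁) {s : ℂ} {v w : Fin (N + 1) → ℂ}
    (hv : s • v - (Yplus N l₂ l a l₁).mulVec v = 0) (hw : s • w - (Yplus N l₂ l a l₁).mulVec w = 0)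
    (h0 : v 0 = w 0) : v = w := by
  have key : ∀ p (hp : p < N + 1), v ⟨p, hp⟩ = w ⟨p, hp⟩ := by
    intro p
    induction p with
    | zero => intro hp; exact h0
    | succ p ih =>
      intro hp
      have h1 := congrFun hv ⟨p, by omega⟩
      have h2 := congrFun hw ⟨p, by omega⟩
      simp only [Pi.sub_apply, Pi.smul_apply, smul_eq_mul, Yplus_mulVec_of_lt _ hp,
        Pi.zero_apply] at h1 h2
      rw [ih (by omega)] at h1
      refine mul_left_cancel₀ (h.aCoeff_ne_zero (p := p) (by omega)) ?_
      linear_combination h2 - h1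
  ext ⟨p, hp⟩
  exact key p hp

/-- The coefficients of the Frobenius series with exponent `σ_k` whose leading coefficient has first
component `c`. -/
noncomputable def frobCoeff (N : ℕ) (l₂ l a l₁ : ℂ) (k : ℕ) (c : ℂ) : ℕ → Fin (N + 1) → ℂ :=
  recCoeff (Yplus N l₂ l a l₁) (Yminus N l₂ l a) (sigma l a l₁ k) (c • eigvec N l₂ l a l₁ k)

theorem Generic.frobCoeff_recursion (h : Generic N l₂ l a l₁) (k : Fin (N + 1)) (c : ℂ) :
    FrobeniusRecursion (Yplus N l₂ l a l₁) (Yminus N l₂ l a) (sigma l a l₁ k)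
      (frobCoeff N l₂ l a l₁ k c) :=
  recCoeff_recursion (by rw [Matrix.mulVec_smul, h.mulVec_eigvec, smul_comm, sub_self])
    (h.det_ne_zero k)

theorem frobCoeff_zero_zero (k : ℕ) (c : ℂ) : frobCoeff N l₂ l a l₁ k c 0 0 = c := by
  simp [frobCoeff, recCoeff, eigvec_zero]

theorem Generic.isFrobeniusSolution (h : Generic N l₂ l a l₁) (k : Fin (N + 1)) {c : ℂ}
    (hc : c ≠ 0) : IsFrobeniusSolution N l₂ l a l₁ k (frobCoeff N l₂ l a l₁ k c) := by
  have hr := h.frobCoeff_recursion k c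
  refine ⟨fun h0 => hc ?_, fun x hx => hr.summable hx,
    (isSolution_frobeniusSum_iff fun x hx => hr.summable hx).2 hr⟩
  rw [← frobCoeff_zero_zero (N := N) (l₂ := l₂) (l := l) (a := a) (l₁ := l₁) (k := k) c, h0]
  rfl

theorem Generic.frobenius_unique (h : Generic N l₂ l a l₁) (k : Fin (N + 1)) {c : ℂ}
    {p' : ℕ → Fin (N + 1) → ℂ} (hp : IsFrobeniusSolution N l₂ l a l₁ k p') (h0 : p' 0 0 = c) :
    p' = frobCoeff N l₂ l a l₁ k c := by
  have h1 := (isSolution_frobeniusSum_iff hp.summable).1 hp.isSolution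
  have h2 := h.frobCoeff_recursion k c
  exact h2.unique (h.det_ne_zero k) h1 (h.eq_of_first_eq h1.zero h2.zero
    (by rw [h0, frobCoeff_zero_zero]))

end Frobenius

/-! ### Genericity outside a closed discrete set. -/

section Genericity

variable (N : ℕ) (l₂ l a : ℂ)

/-- At integer values of `c z + d` the entire function `sin (π (c z + d))` vanishes, and it is not
identically zero: it is `1` where `c z + d = 1 / 2`. -/
theorem eventually_forall_ne_int {c d : ℂ} (hc : c ≠ 0) :
    ∀ᶠ z in codiscrete ℂ, ∀ m : ℤ, c * z + d ≠ m := by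
  have han : AnalyticOnNhd ℂ (fun z : ℂ => Complex.sin (Real.pi * (c * z + d))) univ := by
    refine DifferentiableOn.analyticOnNhd (fun z _ => ?_) isOpen_univ
    exact DifferentiableAt.differentiableWithinAt (by fun_prop)
  have hx : Complex.sin (Real.pi * (c * ((1 / 2 - d) / c) + d)) ≠ 0 := by
    have : (Real.pi : ℂ) * (c * ((1 / 2 - d) / c) + d) = Real.pi / 2 := by field_simp; ring
    rw [this, Complex.sin_pi_div_two]; exact one_ne_zero
  filter_upwards [han.preimage_zero_mem_codiscrete hx] with z hz m hm
  refine hz ?_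
  simp only [mem_singleton_iff, hm]
  rw [mul_comm]; exact Complex.sin_int_mul_pi m

theorem eventually_generic : ∀ᶠ l₁ in codiscrete ℂ, Generic N l₂ l a l₁ := by
  have h1 : ∀ᶠ l₁ in codiscrete ℂ, ∀ j k : Fin (N + 1), j ≠ k → ∀ m : ℤ,
      sigma l a l₁ k - sigma l a l₁ j ≠ m := by
    simp only [eventually_all]
    intro j k hjk
    have hc : ((k : ℕ) : ℂ) - ((j : ℕ) : ℂ) ≠ 0 := by
      rw [sub_ne_zero]
      exact fun h => hjk (Fin.ext (Nat.cast_injective h).symm)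
    filter_upwards [eventually_forall_ne_int (d := (k : ℕ) * (l * ((k : ℕ) - 1) + a) -
      (j : ℕ) * (l * ((j : ℕ) - 1) + a)) hc] with z hz m hm
    refine hz m ?_
    rw [← hm]; simp only [sigma]; ring
  have h2 : ∀ᶠ l₁ in codiscrete ℂ, ∀ i ∈ Finset.Icc 1 N, aCoeff N l₂ l a l₁ i ≠ 0 := by
    rw [Filter.eventually_all_finset]
    intro i hi
    have hc : (i : ℂ) ≠ 0 := by
      have := (Finset.mem_Icc.1 hi).1
      exact Nat.cast_ne_zero.2 (by omega)
    filter_upwards [eventually_forall_ne_int (d := i * (l₂ + l * (N + i - 2) + a + 1)) hc] with z hz h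
    refine hz 0 ?_
    rw [Int.cast_zero, ← h]; simp only [aCoeff]; ring
  filter_upwards [h1, h2] with z hz1 hz2 using ⟨hz1, hz2⟩

end Genericity

/-! ### Meromorphic dependence of the Frobenius solutions on `λ₁`. -/

section FrobeniusMeromorphic

variable {N : ℕ} {l₂ l a : ℂ}

theorem differentiable_sigma (k : ℕ) : Differentiable ℂ fun l₁ => sigma l a l₁ k := by
  unfold sigma; fun_prop

theorem differentiable_aCoeff (k : ℕ) : Differentiable ℂ fun l₁ => aCoeff N l₂ l a l₁ k := by
  unfold aCoeff; fun_prop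

theorem differentiable_Yplus (i j : Fin (N + 1)) :
    Differentiable ℂ fun l₁ => Yplus N l₂ l a l₁ i j := by
  simp only [Yplus, Matrix.of_apply]
  split_ifs
  · exact differentiable_sigma _
  · exact differentiable_aCoeff _
  · exact differentiable_const _

theorem Differentiable.meromorphic {f : ℂ → ℂ} (hf : Differentiable ℂ f) : Meromorphic f :=
  fun z => (hf.analyticAt z).meromorphicAt

theorem frobCoeff_succ (l₁ : ℂ) (k : ℕ) (c : ℂ) (m : ℕ) : frobCoeff N l₂ l a l₁ k c (m + 1) =
    ((sigma l a l₁ k + (m + 1 : ℕ)) • (1 : Matrix (Fin (N + 1)) (Fin (N + 1)) ℂ) -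
      Yplus N l₂ l a l₁)⁻¹.mulVec ((sigma l a l₁ k + m) • frobCoeff N l₂ l a l₁ k c m -
        (Yplus N l₂ l a l₁).mulVec (frobCoeff N l₂ l a l₁ k c m) +
        (Yminus N l₂ l a).mulVec (frobCoeff N l₂ l a l₁ k c m)) := rfl

theorem meromorphicAt_frobCoeff {c : ℂ → ℂ} {w : ℂ} (hc : MeromorphicAt c w) (k m : ℕ)
    (i : Fin (N + 1)) : MeromorphicAt (fun l₁ => frobCoeff N l₂ l a l₁ k (c l₁) m i) w := by
  have hσ : ∀ k, MeromorphicAt (fun l₁ => sigma l a l₁ k) w := fun k =>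
    Differentiable.meromorphic (differentiable_sigma k) w
  have ha : ∀ k, MeromorphicAt (fun l₁ => aCoeff N l₂ l a l₁ k) w := fun k =>
    Differentiable.meromorphic (differentiable_aCoeff k) w
  have hY : ∀ i j, MeromorphicAt (fun l₁ => Yplus N l₂ l a l₁ i j) w := fun i j =>
    Differentiable.meromorphic (differentiable_Yplus i j) w
  induction m generalizing i with
  | zero =>
    simp only [frobCoeff, recCoeff, Pi.smul_apply, smul_eq_mul, eigvec]
    exact hc.mul (MeromorphicAt.fun_prod fun j _ => ((hσ _).sub (hσ _)).div (ha _))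
  | succ m ih =>
    simp only [frobCoeff_succ]
    have h1 := meromorphicAt_mulVec hY ih
    have h2 := meromorphicAt_mulVec (A := fun _ => Yminus N l₂ l a)
      (fun _ _ => MeromorphicAt.const _ _) ih
    refine meromorphicAt_mulVec (meromorphicAt_inv fun i j => ?_) (fun i => ?_) i
    · simp only [Matrix.sub_apply, Matrix.smul_apply, smul_eq_mul]
      exact (((hσ k).add (MeromorphicAt.const _ _)).mul (MeromorphicAt.const _ _)).sub (hY i j)
    · simp only [Pi.add_apply, Pi.sub_apply, Pi.smul_apply, smul_eq_mul]
      exact ((((hσ k).add (MeromorphicAt.const _ _)).mul (ih i)).sub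
        (h1 i)).add
        (h2 i)

/-- Meromorphy of each coefficient alone would allow punctured neighbourhoods that shrink with `m`.
At generic points no denominator of the recursion vanishes, so all coefficients are holomorphic on a
common punctured neighbourhood, as `meromorphicAt_tsum` requires. -/
theorem differentiableAt_frobCoeff {c : ℂ → ℂ} {w : ℂ} (hc : DifferentiableAt ℂ c w)
    (hw : Generic N l₂ l a w) (k : Fin (N + 1)) (m : ℕ) (i : Fin (N + 1)) :
    DifferentiableAt ℂ (fun l₁ => frobCoeff N l₂ l a l₁ k (c l₁) m i) w := by
  have hσ : ∀ k, DifferentiableAt ℂ (fun l₁ => sigma l a l₁ k) w := fun k =>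
    differentiable_sigma k w
  have hY : ∀ i j, DifferentiableAt ℂ (fun l₁ => Yplus N l₂ l a l₁ i j) w := fun i j =>
    differentiable_Yplus i j w
  induction m generalizing i with
  | zero =>
    simp only [frobCoeff, recCoeff, Pi.smul_apply, smul_eq_mul, eigvec]
    refine hc.mul (DifferentiableAt.fun_finsetProd fun j hj => ((hσ _).sub (hσ _)).div
      (differentiable_aCoeff _ w) (hw.aCoeff_ne_zero ?_))
    have := Finset.mem_range.1 hj
    omega
  | succ m ih =>
    simp only [frobCoeff_succ]
    have h1 := differentiableAt_mulVec hY ih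
    have h2 := differentiableAt_mulVec (A := fun _ => Yminus N l₂ l a)
      (fun _ _ => differentiableAt_const _) ih
    refine differentiableAt_mulVec (differentiableAt_inv (fun i j => ?_) (hw.det_ne_zero k m))
      (fun i => ?_) i
    · simp only [Matrix.sub_apply, Matrix.smul_apply, smul_eq_mul]
      exact (((hσ k).add (differentiableAt_const _)).mul (differentiableAt_const _)).sub (hY i j)
    · simp only [Pi.add_apply, Pi.sub_apply, Pi.smul_apply, smul_eq_mul]
      exact ((((hσ k).add (differentiableAt_const _)).mul (ih i)).sub
        (h1 i)).add
        (h2 i)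

/-- Near `w` one threshold `M` works for all parameters, so the poles of the first `M` coefficients
bound the pole order of all of them. -/
theorem meromorphic_frobeniusSum {c : ℂ → ℂ} (hc : Meromorphic c) (k i : Fin (N + 1)) {x : ℝ}
    (hx : x ∈ Ioo (0 : ℝ) 1) : Meromorphic fun l₁ =>
      frobeniusSum (sigma l a l₁ k) (frobCoeff N l₂ l a l₁ k (c l₁)) x i := by
  intro w
  obtain ⟨y, h1, h2⟩ := exists_between hx.2
  have hδ : 0 < y / x - 1 := by rw [sub_pos, one_lt_div hx.1]; exact h1
  have hx0 : (x : ℂ) ≠ 0 := by exact_mod_cast hx.1.ne'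
  -- a uniform bound for the matrices near `w`
  let κ : ℂ → ℝ := fun l₁ =>
    ‖sigma l a l₁ k‖ + entrySum (Yplus N l₂ l a l₁) + entrySum (Yminus N l₂ l a)
  have hκ : Continuous κ := by
    have h3 : Continuous fun l₁ => sigma l a l₁ k := (differentiable_sigma _).continuous
    have h4 : ∀ i j, Continuous fun l₁ => Yplus N l₂ l a l₁ i j := fun i j =>
      (differentiable_Yplus i j).continuous
    unfold κ entrySum
    fun_prop
  have hK : ∀ᶠ z in 𝓝[≠] w, κ z ≤ κ w + 1 := by
    refine Eventually.filter_mono nhdsWithin_le_nhds ?_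
    exact (hκ.continuousAt.eventually_lt continuousAt_const (lt_add_one _)).mono fun _ h => h.le
  obtain ⟨M, hM1, hM2⟩ := exists_threshold (κ w + 1) hδ
  obtain ⟨r, C, hC⟩ := exists_pow_mul_sum_norm_le (Finset.range M ×ˢ Finset.univ)
    (f := fun (q : ℕ × Fin (N + 1)) l₁ => frobCoeff N l₂ l a l₁ k (c l₁) q.1 q.2) (w := w)
    fun q _ => meromorphicAt_frobCoeff (hc w) k q.1 q.2
  have hgen := eventually_punctured_of_codiscrete (eventually_generic N l₂ l a) w
  have hcd : ∀ᶠ z in 𝓝[≠] w, DifferentiableAt ℂ c z :=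
    (hc w).eventually_analyticAt.mono fun _ h => h.differentiableAt
  have hu : Summable fun m : ℕ => C * y ^ m :=
    (summable_geometric_of_lt_one (hx.1.trans h1).le h2).mul_left C
  have hmain : MeromorphicAt (fun l₁ => ∑' m : ℕ, (x : ℂ) ^ m * frobCoeff N l₂ l a l₁ k (c l₁) m i)
      w := by
    refine meromorphicAt_tsum hu r ?_
    filter_upwards [hK, hC, hgen, hcd] with z hz1 hz2 hz3 hz4 m
    refine ⟨(differentiableAt_frobCoeff hz4 hz3 k m i).const_mul _, ?_⟩
    have hb := (hz3.frobCoeff_recursion k (c z)).norm_le hδ hz1 hM1 hM2 m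
    set p := frobCoeff N l₂ l a z k (c z)
    have h3 : ∑ j ∈ Finset.range M, ‖p j‖ ≤
        ∑ q ∈ Finset.range M ×ˢ (Finset.univ : Finset (Fin (N + 1))), ‖p q.1 q.2‖ := by
      rw [Finset.sum_product]
      refine Finset.sum_le_sum fun j _ => ?_
      refine (pi_norm_le_iff_of_nonneg (Finset.sum_nonneg fun _ _ => norm_nonneg _)).2 fun i => ?_
      exact Finset.single_le_sum (f := fun i => ‖p j i‖) (fun _ _ => norm_nonneg _)
        (Finset.mem_univ i)
    rw [norm_mul, norm_pow, Complex.norm_real, Real.norm_eq_abs, abs_of_pos hx.1]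
    have h4 : 0 ≤ ‖z - w‖ ^ r := by positivity
    have h5 : 0 ≤ x ^ m := pow_nonneg hx.1.le _
    have h6 : 0 ≤ 1 + (y / x - 1) := by linarith
    calc ‖z - w‖ ^ r * (x ^ m * ‖p m i‖)
        ≤ ‖z - w‖ ^ r * (x ^ m * ((∑ j ∈ Finset.range M, ‖p j‖) * (1 + (y / x - 1)) ^ m)) := by
          gcongr
          exact (norm_le_pi_norm _ _).trans hb
      _ = (‖z - w‖ ^ r * ∑ j ∈ Finset.range M, ‖p j‖) * y ^ m := by
          have : x ≠ 0 := hx.1.ne'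
          rw [add_sub_cancel, div_pow]; field_simp
      _ ≤ C * y ^ m := by
          have := hx.1.trans h1
          gcongr
          exact le_trans (by gcongr) hz2
  have hpow : MeromorphicAt (fun l₁ => (x : ℂ) ^ sigma l a l₁ k) w := by
    refine Differentiable.meromorphic (fun z => ?_) w
    exact (differentiable_sigma _ z).const_cpow (Or.inl hx0)
  refine (hpow.mul hmain).congr ?_
  filter_upwards [hgen] with z hz
  have hs := (hz.frobCoeff_recursion k (c z)).summable hx
  simp only [frobeniusSum, Pi.smul_apply, smul_eq_mul, Pi.mul_apply]
  rw [tsum_apply hs]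
  rfl

end FrobeniusMeromorphic


/-! ### Uniqueness for the linear system and invertibility of the Frobenius matrix. -/

section LinearODE

variable {N : ℕ} {l₂ l a l₁ : ℂ}

theorem IsSolution.sub {w w' : ℝ → Fin (N + 1) → ℂ} (h : IsSolution N l₂ l a l₁ w)
    (h' : IsSolution N l₂ l a l₁ w') : IsSolution N l₂ l a l₁ (w - w') := fun x hx => by
  rw [Pi.sub_apply, Matrix.mulVec_sub]
  exact (h x hx).sub (h' x hx)

theorem IsSolution.mulVec {W : ℝ → Matrix (Fin (N + 1)) (Fin (N + 1)) ℂ}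
    (h : ∀ k, IsSolution N l₂ l a l₁ fun x => (W x).col k) (d : Fin (N + 1) → ℂ) :
    IsSolution N l₂ l a l₁ fun x => (W x).mulVec d := fun x hx => by
  have h1 : (fun x => (W x).mulVec d) = fun x => ∑ k, d k • (W x).col k := by
    funext x; ext i
    simp [Matrix.mulVec, dotProduct, Finset.sum_apply, mul_comm]
  rw [h1]
  simp only [Matrix.mulVec_sum, Matrix.mulVec_smul]
  exact HasDerivAt.fun_sum fun k _ => (h k x hx).const_smul (d k)

theorem IsSolution.eq_zero {w : ℝ → Fin (N + 1) → ℂ} (h : IsSolution N l₂ l a l₁ w) {x₀ x : ℝ}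
    (hx₀ : x₀ ∈ Ioo (0 : ℝ) 1) (hx : x ∈ Ioo (0 : ℝ) 1) (h0 : w x₀ = 0) : w x = 0 := by
  -- Both points lie in a compact subinterval `[b, c]` of `(0, 1)`; the coefficient matrix is
  -- bounded there, which makes the system Lipschitz.
  obtain ⟨b, hb0, hb⟩ := exists_between (lt_min hx₀.1 hx.1)
  obtain ⟨c, hc, hc1⟩ := exists_between (max_lt hx₀.2 hx.2)
  let A : ℝ → Matrix (Fin (N + 1)) (Fin (N + 1)) ℂ := fun t =>
    (t : ℂ)⁻¹ • Yplus N l₂ l a l₁ + (1 - (t : ℂ))⁻¹ • Yminus N l₂ l a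
  have hcont : ContinuousOn (fun t => entrySum (A t)) (Icc b c) := by
    have h1 : ContinuousOn (fun t : ℝ => (t : ℂ)⁻¹) (Icc b c) :=
      Complex.continuous_ofReal.continuousOn.inv₀ fun t ht => by
        exact_mod_cast (hb0.trans_le ht.1).ne'
    have h2 : ContinuousOn (fun t : ℝ => (1 - (t : ℂ))⁻¹) (Icc b c) :=
      (continuous_const.sub Complex.continuous_ofReal).continuousOn.inv₀ fun t ht => by
        have : (1 : ℂ) ≠ t := by exact_mod_cast (ht.2.trans_lt hc1).ne'
        exact sub_ne_zero.2 this
    simp only [entrySum, A, Matrix.add_apply, Matrix.smul_apply, smul_eq_mul]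
    fun_prop
  obtain ⟨K, hK⟩ := isCompact_Icc.exists_bound_of_continuousOn hcont
  have hsub : ∀ t ∈ Ioo b c, t ∈ Ioo (0 : ℝ) 1 := fun t ht => ⟨hb0.trans ht.1, ht.2.trans hc1⟩
  have hlip : ∀ t ∈ Ioo b c, LipschitzOnWith K.toNNReal (fun v => (A t).mulVec v) univ := by
    intro t ht
    refine LipschitzOnWith.of_dist_le_mul fun v _ v' _ => ?_
    rw [dist_eq_norm, dist_eq_norm, ← Matrix.mulVec_sub]
    refine (norm_mulVec_le _ _).trans (mul_le_mul_of_nonneg_right ?_ (norm_nonneg _))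
    exact ((le_abs_self _).trans (hK t (Ioo_subset_Icc_self ht))).trans (Real.le_coe_toNNReal K)
  have hun := ODE_solution_unique_of_mem_Ioo (v := fun t v => (A t).mulVec v) (s := fun _ => univ)
    (f := w) (g := fun _ => 0) hlip (t₀ := x₀)
    ⟨hb.trans_le (min_le_left _ _), (le_max_left _ _).trans_lt hc⟩
    (fun t ht => ⟨h t (hsub t ht), mem_univ _⟩)
    (fun t ht => ⟨by simpa using hasDerivAt_const t (0 : Fin (N + 1) → ℂ), mem_univ _⟩) h0
  exact hun ⟨hb.trans_le (min_le_right _ _), (le_max_right _ _).trans_lt hc⟩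

theorem IsSolution.eq_of_eq {w w' : ℝ → Fin (N + 1) → ℂ} (h : IsSolution N l₂ l a l₁ w)
    (h' : IsSolution N l₂ l a l₁ w') {x₀ x : ℝ}
    (hx₀ : x₀ ∈ Ioo (0 : ℝ) 1) (hx : x ∈ Ioo (0 : ℝ) 1) (h0 : w x₀ = w' x₀) : w x = w' x :=
  sub_eq_zero.1 ((h.sub h').eq_zero hx₀ hx (sub_eq_zero.2 h0))

/-- A solution whose first component vanishes is zero. -/
theorem IsSolution.eq_zero_of_first_eq_zero {w : ℝ → Fin (N + 1) → ℂ}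
    (h : IsSolution N l₂ l a l₁ w) (hg : Generic N l₂ l a l₁)
    (h0 : ∀ x ∈ Ioo (0 : ℝ) 1, w x 0 = 0) {x : ℝ} (hx : x ∈ Ioo (0 : ℝ) 1) : w x = 0 := by
  -- Row `p` of the system involves only the components `p - 1`, `p`, `p + 1`. Once the components
  -- up to `p` vanish identically, it reduces to `a_{N-p} w_{p+1} = 0`.
  have key : ∀ p (q : ℕ) (hq : q < N + 1), q ≤ p → ∀ x ∈ Ioo (0 : ℝ) 1, w x ⟨q, hq⟩ = 0 := by
    intro p
    induction p with
    | zero =>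
      intro q hq hqp x hx
      obtain rfl : q = 0 := by omega
      exact h0 x hx
    | succ p ih =>
      intro q hq hqp x hx
      rcases hqp.lt_or_eq with hlt | rfl
      · exact ih q hq (by omega) x hx
      have h1 := hasDerivAt_pi.1 (h x hx) ⟨p, by omega⟩
      have h2 : HasDerivAt (fun x => w x ⟨p, by omega⟩) 0 x := by
        refine (hasDerivAt_const x (0 : ℂ)).congr_of_eventuallyEq ?_
        filter_upwards [isOpen_Ioo.mem_nhds hx] with y hy using ih p _ le_rfl y hy
      have h3 := h1.unique h2
      have h4 : (Yminus N l₂ l a).mulVec (w x) ⟨p, by omega⟩ = 0 := by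
        rw [Matrix.mulVec, dotProduct]
        refine Finset.sum_eq_zero fun r _ => ?_
        by_cases hr : r.val ≤ p
        · rw [show r = ⟨r.val, r.2⟩ from rfl, ih r.val r.2 hr x hx, mul_zero]
        · have h5 : r.val ≠ p := by omega
          have h6 : r.val + 1 ≠ p := by omega
          simp [Yminus, h5, h6]
      have hx0 : (x : ℂ)⁻¹ ≠ 0 := inv_ne_zero (by exact_mod_cast hx.1.ne')
      rw [Matrix.add_mulVec, Matrix.smul_mulVec, Matrix.smul_mulVec, Pi.add_apply, Pi.smul_apply,
        Pi.smul_apply, h4, smul_zero, add_zero, Yplus_mulVec_of_lt _ hq, ih p _ le_rfl x hx,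
        mul_zero, zero_add, smul_eq_mul] at h3
      exact ((mul_eq_zero.1 h3).resolve_left hx0 |> mul_eq_zero.1).resolve_left
        (hg.aCoeff_ne_zero (by omega))
  ext ⟨p, hp⟩
  exact key p p hp le_rfl x hx

/-- The matrix of Frobenius series solutions with normalizations `c`. -/
noncomputable def frobMatrix (N : ℕ) (l₂ l a l₁ : ℂ) (c : Fin (N + 1) → ℂ) (x : ℝ) :
    Matrix (Fin (N + 1)) (Fin (N + 1)) ℂ :=
  Matrix.of fun i k => frobeniusSum (sigma l a l₁ k) (frobCoeff N l₂ l a l₁ k (c k)) x i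

theorem Generic.frobMatrix_solution (hg : Generic N l₂ l a l₁) {c : Fin (N + 1) → ℂ}
    (hc : ∀ k, c k ≠ 0) (k : Fin (N + 1)) :
    IsSolution N l₂ l a l₁ fun x => (frobMatrix N l₂ l a l₁ c x).col k :=
  (hg.isFrobeniusSolution k (hc k)).isSolution

theorem Generic.det_leading_ne_zero (hg : Generic N l₂ l a l₁) {c : Fin (N + 1) → ℂ}
    (hc : ∀ k, c k ≠ 0) :
    (Matrix.of fun i k : Fin (N + 1) => c k * eigvec N l₂ l a l₁ k i).det ≠ 0 := by
  have hinj : Function.Injective fun k : Fin (N + 1) => sigma l a l₁ k := by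
    intro j k hjk
    by_contra hne
    refine hg.1 j k hne 0 ?_
    simp only at hjk
    rw [hjk, sub_self, Int.cast_zero]
  have hli := Module.End.eigenvectors_linearIndependent' (Yplus N l₂ l a l₁).mulVecLin _ hinj
    (fun k => c k • eigvec N l₂ l a l₁ k) fun k => by
      refine ⟨Module.End.mem_eigenspace_iff.2 ?_, fun h0 => hc k ?_⟩
      · rw [Matrix.mulVecLin_apply, Matrix.mulVec_smul, hg.mulVec_eigvec, smul_comm]
      · simpa [eigvec_zero] using congrFun h0 0
  have := (Matrix.linearIndependent_cols_iff_isUnit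
    (A := Matrix.of fun i k : Fin (N + 1) => c k * eigvec N l₂ l a l₁ k i)).1 hli
  exact ((Matrix.isUnit_iff_isUnit_det _).1 this).ne_zero

/-- `W(x)` is `P(x)` times the diagonal matrix of the powers `x ^ σ_k`, with `P` continuous at `0`
and `P(0)` formed by eigenvectors for distinct eigenvalues. So small `x > 0` will do. -/
theorem Generic.exists_det_frobMatrix_ne_zero (hg : Generic N l₂ l a l₁) {c : Fin (N + 1) → ℂ}
    (hc : ∀ k, c k ≠ 0) : ∃ x ∈ Ioo (0 : ℝ) 1, (frobMatrix N l₂ l a l₁ c x).det ≠ 0 := by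
  let P : ℂ → Matrix (Fin (N + 1)) (Fin (N + 1)) ℂ := fun z => Matrix.of fun i k =>
    (∑' m : ℕ, z ^ m • frobCoeff N l₂ l a l₁ k (c k) m) i
  have hs : ∀ k : Fin (N + 1), ∀ x ∈ Ioo (0 : ℝ) 1,
      Summable fun m : ℕ => (x : ℂ) ^ m • frobCoeff N l₂ l a l₁ k (c k) m :=
    fun k x hx => (hg.frobCoeff_recursion k (c k)).summable hx
  have hP : ContinuousAt (fun z => (P z).det) 0 := by
    refine (differentiableAt_det fun i k => ?_).continuousAt
    exact differentiableAt_pi.1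
      (hasDerivAt_powerSeries (hs k) (z := 0) (by simp)).2.differentiableAt i
  have hP0 : (P 0).det ≠ 0 := by
    convert hg.det_leading_ne_zero hc using 2
    ext i k
    simp only [P, Matrix.of_apply]
    rw [tsum_eq_single 0 (by intro b hb; simp [hb])]
    simp [frobCoeff, recCoeff]
  have h1 : Tendsto (fun x : ℝ => (x : ℂ)) (𝓝[>] 0) (𝓝 0) :=
    (Complex.continuous_ofReal.tendsto' 0 0 (by simp)).mono_left nhdsWithin_le_nhds
  obtain ⟨x, hx1, hx⟩ := ((h1.eventually (hP.eventually_ne hP0)).and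
    (Ioo_mem_nhdsGT (zero_lt_one (α := ℝ)))).exists
  refine ⟨x, hx, ?_⟩
  have h2 : frobMatrix N l₂ l a l₁ c x =
      P x * Matrix.diagonal fun k : Fin (N + 1) => (x : ℂ) ^ sigma l a l₁ k := by
    ext i k
    rw [Matrix.mul_diagonal]
    simp only [frobMatrix, frobeniusSum, P, Matrix.of_apply, Pi.smul_apply, smul_eq_mul]
    rw [mul_comm]
  rw [h2, Matrix.det_mul, Matrix.det_diagonal]
  refine mul_ne_zero hx1 (Finset.prod_ne_zero_iff.2 fun k _ => ?_)
  have hx0 : (x : ℂ) ≠ 0 := by exact_mod_cast hx.1.ne'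
  simp [Complex.cpow_eq_zero_iff, hx0]

/-- A linear relation between the columns at one point persists on `(0, 1)` by uniqueness,
contradicting invertibility at some other point. -/
theorem Generic.det_frobMatrix_ne_zero (hg : Generic N l₂ l a l₁) {c : Fin (N + 1) → ℂ}
    (hc : ∀ k, c k ≠ 0) {x : ℝ} (hx : x ∈ Ioo (0 : ℝ) 1) :
    (frobMatrix N l₂ l a l₁ c x).det ≠ 0 := by
  intro hdet
  obtain ⟨d, hd, hd0⟩ := Matrix.exists_mulVec_eq_zero_iff.2 hdet
  obtain ⟨y, hy, hy0⟩ := hg.exists_det_frobMatrix_ne_zero hc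
  have := (IsSolution.mulVec (hg.frobMatrix_solution hc) d).eq_zero hx hy hd0
  exact hd (Matrix.eq_zero_of_mulVec_eq_zero hy0 this)

/-- Matrices of solutions agreeing with `W D` at a point agree with it on `(0, 1)`. -/
theorem Generic.eq_frobMatrix_mul (hg : Generic N l₂ l a l₁) {c : Fin (N + 1) → ℂ}
    (hc : ∀ k, c k ≠ 0) {H : ℝ → Matrix (Fin (N + 1)) (Fin (N + 1)) ℂ}
    (hH : ∀ q, IsSolution N l₂ l a l₁ fun x => (H x).col q) {x₀ x : ℝ}
    (hx₀ : x₀ ∈ Ioo (0 : ℝ) 1) (hx : x ∈ Ioo (0 : ℝ) 1) :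
    H x = frobMatrix N l₂ l a l₁ c x * ((frobMatrix N l₂ l a l₁ c x₀)⁻¹ * H x₀) := by
  set D := (frobMatrix N l₂ l a l₁ c x₀)⁻¹ * H x₀
  have hD : frobMatrix N l₂ l a l₁ c x₀ * D = H x₀ := by
    rw [← mul_assoc, Matrix.mul_nonsing_inv _
      (isUnit_iff_ne_zero.2 (hg.det_frobMatrix_ne_zero hc hx₀)), one_mul]
  have hcol : ∀ (y : ℝ) (q : Fin (N + 1)), (frobMatrix N l₂ l a l₁ c y * D).col q =
      (frobMatrix N l₂ l a l₁ c y).mulVec (D.col q) := fun y q => by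
    ext i; simp [Matrix.mul_apply, Matrix.mulVec, dotProduct]
  have key : ∀ q, (H x).col q = (frobMatrix N l₂ l a l₁ c x * D).col q := by
    intro q
    rw [hcol]
    refine (hH q).eq_of_eq (IsSolution.mulVec (hg.frobMatrix_solution hc) (D.col q)) hx₀ hx ?_
    rw [← hcol, hD]
  ext i q
  exact congrFun (key q) i

/-- The first row of `W D` determines `D`. -/
theorem Generic.eq_of_first_row_eq (hg : Generic N l₂ l a l₁) {c : Fin (N + 1) → ℂ}
    (hc : ∀ k, c k ≠ 0) {D D' : Matrix (Fin (N + 1)) (Fin (N + 1)) ℂ}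
    (h : ∀ x ∈ Ioo (0 : ℝ) 1, ∀ q, (frobMatrix N l₂ l a l₁ c x * D) 0 q =
      (frobMatrix N l₂ l a l₁ c x * D') 0 q) : D = D' := by
  rw [← sub_eq_zero]
  ext i q
  have hx : (1 / 2 : ℝ) ∈ Ioo (0 : ℝ) 1 := by constructor <;> norm_num
  have hsol := IsSolution.mulVec (hg.frobMatrix_solution hc) ((D - D').col q)
  have h1 := hsol.eq_zero_of_first_eq_zero hg (fun x hx => by
    have h2 := sub_eq_zero.2 (h x hx q)
    rw [← Matrix.sub_apply, ← mul_sub] at h2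
    exact h2) hx
  exact congrFun (Matrix.eq_zero_of_mulVec_eq_zero (hg.det_frobMatrix_ne_zero hc hx) h1) i

end LinearODE


/-! ### Identities for elementary symmetric polynomials. -/

section ElementarySymmetric

open Polynomial

/-- The sequence `f` shifted by one place to the right. -/
def prev (f : ℕ → ℂ) : ℕ → ℂ
  | 0 => 0
  | p + 1 => f p

variable {ι : Type*}

/-- The elementary symmetric polynomials in the `s i`, `i ∈ S`. -/
noncomputable def esym (S : Finset ι) (s : ι → ℂ) (p : ℕ) : ℂ :=
  (∏ i ∈ S, (1 + C (s i) * X : ℂ[X])).coeff p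

theorem esym_eq_sum (S : Finset ι) (s : ι → ℂ) (p : ℕ) :
    esym S s p = ∑ T ∈ S.powersetCard p, ∏ i ∈ T, s i := by
  rw [esym, Finset.prod_one_add, Polynomial.finsetSum_coeff, Finset.powersetCard_eq_filter,
    Finset.sum_filter]
  refine Finset.sum_congr rfl fun T _ => ?_
  rw [Finset.prod_mul_distrib, Finset.prod_const, ← map_prod, coeff_C_mul, coeff_X_pow]
  simp [eq_comm]

theorem eval_esymm {N : ℕ} (s : Fin N → ℂ) (p : ℕ) :
    MvPolynomial.eval s (MvPolynomial.esymm (Fin N) ℂ p) = esym Finset.univ s p := by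
  simp [esym_eq_sum, MvPolynomial.esymm]

theorem esym_zero (S : Finset ι) (s : ι → ℂ) : esym S s 0 = 1 := by simp [esym_eq_sum]

variable [DecidableEq ι]

theorem esym_erase {S : Finset ι} (s : ι → ℂ) {i : ι} (hi : i ∈ S) (p : ℕ) :
    esym S s p = esym (S.erase i) s p + s i * prev (esym (S.erase i) s) p := by
  rw [esym, ← Finset.mul_prod_erase S _ hi, add_mul, one_mul, mul_assoc, coeff_add, coeff_C_mul]
  congr 2
  rcases p with _ | p
  · simp [prev]
  · rw [coeff_X_mul]; rfl

theorem prev_esym_erase {S : Finset ι} (s : ι → ℂ) {i : ι} (hi : i ∈ S) (p : ℕ) :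
    prev (esym S s) p = prev (esym (S.erase i) s) p + s i * prev (prev (esym (S.erase i) s)) p := by
  rcases p with _ | p
  · simp [prev]
  · exact esym_erase s hi p

/-- Compare coefficients in the Leibniz rule for the generating product `∏ (1 + s_i X)`. The other
sums over omitted variables follow from this one and `esym_erase`. -/
theorem sum_mul_esym_erase (S : Finset ι) (s : ι → ℂ) (p : ℕ) :
    ∑ i ∈ S, s i * esym (S.erase i) s p = (p + 1) * esym S s (p + 1) := by
  have h := congrArg (fun f => coeff f p)
    (Polynomial.derivative_prod_finset (s := S) (f := fun i => (1 + C (s i) * X : ℂ[X])))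
  simp only [coeff_derivative, finsetSum_coeff] at h
  rw [esym, mul_comm, h]
  refine Finset.sum_congr rfl fun i _ => ?_
  have hd : derivative (1 + C (s i) * X : ℂ[X]) = C (s i) := by simp
  rw [hd, coeff_mul_C, esym, mul_comm]

theorem sum_mul_prev_esym_erase (S : Finset ι) (s : ι → ℂ) (p : ℕ) :
    ∑ i ∈ S, s i * prev (esym (S.erase i) s) p = p * esym S s p := by
  rcases p with _ | p
  · simp [prev]
  · simpa [prev] using sum_mul_esym_erase S s p

theorem sum_esym_erase (S : Finset ι) (s : ι → ℂ) (p : ℕ) :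
    ∑ i ∈ S, esym (S.erase i) s p = (S.card - p) * esym S s p := by
  have h : ∀ i ∈ S, esym (S.erase i) s p = esym S s p - s i * prev (esym (S.erase i) s) p :=
    fun i hi => by rw [esym_erase s hi]; ring
  rw [Finset.sum_congr rfl h, Finset.sum_sub_distrib, sum_mul_prev_esym_erase, Finset.sum_const,
    nsmul_eq_mul]
  ring

theorem sum_prev_esym_erase (S : Finset ι) (s : ι → ℂ) (p : ℕ) :
    ∑ i ∈ S, prev (esym (S.erase i) s) p = (S.card - p + 1) * prev (esym S s) p := by
  rcases p with _ | p
  · simp [prev]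
  · simp only [prev]
    rw [sum_esym_erase]; push_cast; ring

theorem card_erase_cast {S : Finset ι} {i : ι} (hi : i ∈ S) :
    ((S.erase i).card : ℂ) = S.card - 1 := by
  rw [← Finset.card_erase_add_one hi]; push_cast; ring

/-- Sums over ordered pairs of distinct indices. -/
theorem sum_sum_esym_erase_erase (S : Finset ι) (s : ι → ℂ) (p : ℕ) :
    ∑ i ∈ S, ∑ j ∈ S.erase i, esym ((S.erase i).erase j) s p =
      (S.card - p) * (S.card - p - 1) * esym S s p := by
  have h : ∀ i ∈ S, ∑ j ∈ S.erase i, esym ((S.erase i).erase j) s p =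
      (S.card - p - 1) * esym (S.erase i) s p := fun i hi => by
    rw [sum_esym_erase, card_erase_cast hi]; ring
  rw [Finset.sum_congr rfl h, ← Finset.mul_sum, sum_esym_erase]; ring

theorem sum_sum_prev_esym_erase_erase (S : Finset ι) (s : ι → ℂ) (p : ℕ) :
    ∑ i ∈ S, ∑ j ∈ S.erase i, prev (esym ((S.erase i).erase j) s) p =
      (S.card - p + 1) * (S.card - p) * prev (esym S s) p := by
  have h : ∀ i ∈ S, ∑ j ∈ S.erase i, prev (esym ((S.erase i).erase j) s) p =
      (S.card - p) * prev (esym (S.erase i) s) p := fun i hi => by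
    rw [sum_prev_esym_erase, card_erase_cast hi]; ring
  rw [Finset.sum_congr rfl h, ← Finset.mul_sum, sum_prev_esym_erase]; ring

theorem sum_sum_left_mul_esym_erase_erase (S : Finset ι) (s : ι → ℂ) (p : ℕ) :
    ∑ i ∈ S, s i * ∑ j ∈ S.erase i, esym ((S.erase i).erase j) s p =
      (S.card - p - 1) * (p + 1) * esym S s (p + 1) := by
  have h : ∀ i ∈ S, s i * ∑ j ∈ S.erase i, esym ((S.erase i).erase j) s p =
      (S.card - p - 1) * (s i * esym (S.erase i) s p) := fun i hi => by
    rw [sum_esym_erase, card_erase_cast hi]; ring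
  rw [Finset.sum_congr rfl h, ← Finset.mul_sum, sum_mul_esym_erase]; ring

theorem sum_sum_right_mul_esym_erase_erase (S : Finset ι) (s : ι → ℂ) (p : ℕ) :
    ∑ i ∈ S, ∑ j ∈ S.erase i, s j * esym ((S.erase i).erase j) s p =
      (S.card - p - 1) * (p + 1) * esym S s (p + 1) := by
  have h : ∀ i ∈ S, ∑ j ∈ S.erase i, s j * esym ((S.erase i).erase j) s p =
      (p + 1) * esym (S.erase i) s (p + 1) := fun i _ => sum_mul_esym_erase _ s p
  rw [Finset.sum_congr rfl h, ← Finset.mul_sum, sum_esym_erase]; push_cast; ring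

theorem sum_sum_mul_prev_esym_erase_erase (S : Finset ι) (s : ι → ℂ) (p : ℕ) :
    ∑ i ∈ S, ∑ j ∈ S.erase i, s i * s j * prev (esym ((S.erase i).erase j) s) p =
      p * (p + 1) * esym S s (p + 1) := by
  have h : ∀ i ∈ S, ∑ j ∈ S.erase i, s i * s j * prev (esym ((S.erase i).erase j) s) p =
      p * (s i * esym (S.erase i) s p) := fun i _ => by
    simp_rw [mul_assoc]
    rw [← Finset.mul_sum, sum_mul_prev_esym_erase]; ring
  rw [Finset.sum_congr rfl h, ← Finset.mul_sum, sum_mul_esym_erase]; ring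

theorem sum_sum_erase_eq_two_mul {N : ℕ} (f : Fin N → Fin N → ℂ) (hf : ∀ i j, f i j = f j i) :
    ∑ i, ∑ j ∈ Finset.univ.erase i, f i j = 2 * ∑ i, ∑ j ∈ Finset.Ioi i, f i j := by
  have h1 : ∀ i : Fin N, ∑ j ∈ Finset.univ.erase i, f i j =
      ∑ j ∈ Finset.Ioi i, f i j + ∑ j ∈ Finset.Iio i, f i j := by
    intro i
    rw [← Finset.sum_union]
    · congr 1
      ext j
      simp only [Finset.mem_erase, Finset.mem_univ, and_true, Finset.mem_union, Finset.mem_Ioi,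
        Finset.mem_Iio]
      exact ne_comm.trans lt_or_lt_iff_ne.symm
    · rw [Finset.disjoint_left]
      intro j h1 h2
      exact lt_asymm (Finset.mem_Ioi.1 h1) (Finset.mem_Iio.1 h2)
  have h2 : ∑ i, ∑ j ∈ Finset.Iio i, f i j = ∑ i, ∑ j ∈ Finset.Ioi i, f i j := by
    rw [Finset.sum_comm' (t' := Finset.univ) (s' := fun j => Finset.Ioi j) (by simp)]
    exact Finset.sum_congr rfl fun i _ => Finset.sum_congr rfl fun j _ => hf _ _
  rw [Finset.sum_congr rfl fun i _ => h1 i, Finset.sum_add_distrib, h2, two_mul]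

/-- The algebraic identity behind the differential equations: `t ↦ t (1 - t)` is the vector field
used for the integration by parts, and the sum over pairs comes from the logarithmic derivative of
`∏ |t_k - t_j| ^ (2 λ)`. -/
theorem ode_identity {N : ℕ} (l₁ l₂ l a x : ℂ) (t : Fin N → ℂ) (h0 : ∀ i, t i ≠ 0)
    (h1 : ∀ i, 1 - t i ≠ 0) (hx : ∀ i, t i - x ≠ 0) (hne : ∀ i j, i ≠ j → t i - t j ≠ 0) (p : ℕ) :
    let s : Fin N → ℂ := fun i => t i - x
    let e : Fin N → ℂ := fun i => esym (Finset.univ.erase i) s p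
    x * (1 - x) * ((∑ i, (a - 1) / (x - t i)) * esym Finset.univ s p +
        -((N - p + 1) * prev (esym Finset.univ s) p)) +
      (∑ i, ((1 - 2 * t i) * e i + t i * (1 - t i) * e i *
        (l₁ / t i - l₂ / (1 - t i) - (a - 1) / (x - t i))) +
      ∑ i, ∑ j ∈ Finset.Ioi i,
        2 * l * (t j * (1 - t j) * e j - t i * (1 - t i) * e i) / (t j - t i)) =
    (N - p) * ((1 - x) * (l₁ + a + l * (N - p - 1)) - x * (l₂ + a + l * (N - p - 1))) *
        esym Finset.univ s p -
      (p + 1) * (l₁ + l₂ + a + 1 + l * (2 * N - 2 - p)) * esym Finset.univ s (p + 1) -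
      x * (1 - x) * (N - p + 1) * (a + l * (N - p)) * prev (esym Finset.univ s) p := by
  intro s e
  -- Let `E` and `E'` be `e_p` and `e_{p-1}` of the variables other than `i`, `j`. Then `e i = E +
  -- s_j E'` and `e j = E + s_i E'`, so the numerator is divisible by `t_j - t_i`, with a quotient
  -- symmetric in `i` and `j`.
  have hpair : ∀ i j : Fin N, j ∈ Finset.Ioi i →
      2 * l * (t j * (1 - t j) * e j - t i * (1 - t i) * e i) / (t j - t i) =
      2 * l * ((1 - 2 * x) * esym ((Finset.univ.erase i).erase j) s p
        - s i * esym ((Finset.univ.erase i).erase j) s p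
        - s j * esym ((Finset.univ.erase i).erase j) s p
        - x * (1 - x) * prev (esym ((Finset.univ.erase i).erase j) s) p
        - s i * s j * prev (esym ((Finset.univ.erase i).erase j) s) p) := by
    intro i j hij
    have hij' : i ≠ j := (Finset.mem_Ioi.1 hij).ne
    have e1 : e i = esym ((Finset.univ.erase i).erase j) s p +
        s j * prev (esym ((Finset.univ.erase i).erase j) s) p :=
      esym_erase s (Finset.mem_erase.2 ⟨hij'.symm, Finset.mem_univ _⟩) p
    have e2 : e j = esym ((Finset.univ.erase i).erase j) s p +
        s i * prev (esym ((Finset.univ.erase i).erase j) s) p := by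
      rw [Finset.erase_right_comm]
      exact esym_erase s (Finset.mem_erase.2 ⟨hij', Finset.mem_univ _⟩) p
    rw [e1, e2, div_eq_iff (hne j i hij'.symm)]
    simp only [s]
    ring
  have hpairs : ∑ i, ∑ j ∈ Finset.Ioi i,
        2 * l * (t j * (1 - t j) * e j - t i * (1 - t i) * e i) / (t j - t i) =
      l * ((1 - 2 * x) * ((N - p) * (N - p - 1) * esym Finset.univ s p)
        - (N - p - 1) * (p + 1) * esym Finset.univ s (p + 1)
        - (N - p - 1) * (p + 1) * esym Finset.univ s (p + 1)
        - x * (1 - x) * ((N - p + 1) * (N - p) * prev (esym Finset.univ s) p)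
        - p * (p + 1) * esym Finset.univ s (p + 1)) := by
    rw [Finset.sum_congr rfl fun i _ => Finset.sum_congr rfl fun j hj => hpair i j hj]
    simp only [← Finset.mul_sum]
    rw [mul_comm 2 l, mul_assoc l 2, ← sum_sum_erase_eq_two_mul]
    · congr 1
      simp only [Finset.sum_sub_distrib]
      simp only [← Finset.mul_sum]
      have hc : ((Finset.univ : Finset (Fin N)).card : ℂ) = N := by simp
      rw [sum_sum_esym_erase_erase, sum_sum_left_mul_esym_erase_erase,
        sum_sum_right_mul_esym_erase_erase, sum_sum_prev_esym_erase_erase,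
        sum_sum_mul_prev_esym_erase_erase, hc]
    · intro i j
      rw [Finset.erase_right_comm]; ring
  -- Expanding `t_i (1 - t_i)` around `x`, the pole at `t_i = x` leaves `-x (1 - x) (a - 1) / (x -
  -- t_i)` times `e_p`; this cancels the term that comes from differentiating `|x - t_i| ^ (a - 1)`
  -- in `x`.
  have hsingle : ∀ i, (1 - 2 * t i) * e i + t i * (1 - t i) * e i *
        (l₁ / t i - l₂ / (1 - t i) - (a - 1) / (x - t i)) =
      ((l₁ + 1) * (1 - x) - (l₂ + 1) * x + (a - 1) * (1 - 2 * x)) * e i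
        - (l₁ + l₂ + 2 + (a - 1)) * (s i * e i)
        - x * (1 - x) * ((a - 1) / (x - t i) * esym Finset.univ s p)
        - x * (1 - x) * (a - 1) * prev (esym (Finset.univ.erase i) s) p := by
    intro i
    have e1 := esym_erase s (Finset.mem_univ i) p
    have hx' : x - t i ≠ 0 := by rw [← neg_sub]; exact neg_ne_zero.2 (hx i)
    have hi0 := h0 i
    have hi1 := h1 i
    rw [e1]
    simp only [s, e]
    field_simp
    ring
  rw [Finset.sum_congr rfl fun i _ => hsingle i, hpairs]
  simp only [Finset.sum_sub_distrib, ← Finset.mul_sum, ← Finset.sum_mul]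
  have h2 : ∑ i, e i = (N - p) * esym Finset.univ s p := by
    simpa using sum_esym_erase Finset.univ s p
  have h3 : ∑ i, s i * e i = (p + 1) * esym Finset.univ s (p + 1) :=
    sum_mul_esym_erase Finset.univ s p
  have h4 : ∑ i, prev (esym (Finset.univ.erase i) s) p =
      (N - p + 1) * prev (esym Finset.univ s) p := by
    simpa using sum_prev_esym_erase Finset.univ s p
  rw [h2, h3, h4]
  ring

end ElementarySymmetric


/-! ### Complex powers of real variables and logarithmic derivatives. -/

section PowerFunctions

/-- The complex power of the positive part. -/
noncomputable def psi (s : ℂ) (u : ℝ) : ℂ := ((max u 0 : ℝ) : ℂ) ^ s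

theorem psi_of_nonpos {s : ℂ} (hs : s ≠ 0) {u : ℝ} (hu : u ≤ 0) : psi s u = 0 := by
  rw [psi, max_eq_right hu, Complex.ofReal_zero, Complex.zero_cpow hs]

theorem psi_of_nonneg (s : ℂ) {u : ℝ} (hu : 0 ≤ u) : psi s u = (u : ℂ) ^ s := by
  rw [psi, max_eq_left hu]

theorem continuous_psi {s : ℂ} (hs : 0 < s.re) : Continuous (psi s) :=
  (Complex.continuous_ofReal_cpow_const hs).comp (continuous_id.max continuous_const)

theorem norm_psi_le {s : ℂ} (hs : 0 < s.re) (u : ℝ) : ‖psi s u‖ ≤ |u| ^ s.re := by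
  rcases le_or_gt u 0 with h | h
  · have hs0 : s ≠ 0 := fun h => by simp [h] at hs
    rw [psi_of_nonpos hs0 h, norm_zero]; positivity
  · rw [psi_of_nonneg s h.le, Complex.norm_cpow_eq_rpow_re_of_pos h, abs_of_pos h]

theorem psi_mul_div {s : ℂ} (hs : 1 < s.re) (u : ℝ) :
    psi s u * (s / u) = s * psi (s - 1) u := by
  have hs0 : s ≠ 0 := fun h => by simp [h] at hs; linarith
  have hs1 : s - 1 ≠ 0 := fun h => by
    rw [sub_eq_zero] at h; simp [h] at hs
  rcases le_or_gt u 0 with h | h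
  · rw [psi_of_nonpos hs0 h, psi_of_nonpos hs1 h]; simp
  · have : (u : ℂ) ≠ 0 := by exact_mod_cast h.ne'
    rw [psi_of_nonneg _ h.le, psi_of_nonneg _ h.le, Complex.cpow_sub _ _ this, Complex.cpow_one]
    ring

/-- For `u ≤ 0` the factor `psi s u` is zero whatever the value of `s / u`; at `u = 0`
differentiability follows from `‖psi s v‖ ≤ |v| ^ s.re = o(v)`. -/
theorem hasDerivAt_psi {s : ℂ} (hs : 1 < s.re) (u : ℝ) :
    HasDerivAt (psi s) (psi s u * (s / u)) u := by
  have hs0 : s ≠ 0 := fun h => by simp [h] at hs; linarith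
  rcases lt_trichotomy u 0 with h | rfl | h
  · rw [psi_of_nonpos hs0 h.le, zero_mul]
    refine (hasDerivAt_const u (0 : ℂ)).congr_of_eventuallyEq ?_
    filter_upwards [Iio_mem_nhds h] with v hv using psi_of_nonpos hs0 (le_of_lt hv)
  · rw [psi_of_nonpos hs0 le_rfl, zero_mul, hasDerivAt_iff_isLittleO]
    simp only [sub_zero, smul_zero, psi_of_nonpos hs0 le_rfl]
    have h1 : (fun v : ℝ => |v| ^ s.re) =o[𝓝 0] fun v => v := by
      have h2 : Tendsto (fun v : ℝ => |v| ^ (s.re - 1)) (𝓝 0) (𝓝 0) := by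
        have : Continuous fun v : ℝ => |v| ^ (s.re - 1) :=
          continuous_abs.rpow_const fun _ => Or.inr (by linarith)
        refine this.tendsto' 0 0 ?_
        rw [abs_zero, Real.zero_rpow (by linarith)]
      have h3 : (fun v : ℝ => |v| ^ s.re) = fun v => |v| ^ (s.re - 1) * |v| := by
        funext v
        rw [← Real.rpow_add_one' (abs_nonneg v) (by linarith)]
        congr 1; ring
      rw [h3]
      have h4 := ((Asymptotics.isLittleO_one_iff ℝ).2 h2).mul_isBigO
        (Asymptotics.isBigO_refl (fun v : ℝ => |v|) (𝓝 0))
      simp only [one_mul] at h4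
      exact h4.trans_isBigO (Asymptotics.isBigO_abs_left.2 (Asymptotics.isBigO_refl _ _))
    refine Asymptotics.IsBigO.trans_isLittleO ?_ h1
    refine Asymptotics.IsBigO.of_bound 1 (Eventually.of_forall fun v => ?_)
    rw [one_mul, Real.norm_of_nonneg (by positivity)]
    exact norm_psi_le (by linarith) v
  · have h0 : (u : ℂ) ≠ 0 := by exact_mod_cast h.ne'
    have h1 : HasDerivAt (fun v : ℝ => (v : ℂ) ^ s) (s * (u : ℂ) ^ (s - 1)) u := by
      have := (hasDerivAt_id (u : ℂ)).cpow_const (c := s) (Or.inl (by simpa using h))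
      simpa using this.comp_ofReal
    rw [psi_mul_div hs, psi_of_nonneg _ h.le]
    refine h1.congr_of_eventuallyEq ?_
    filter_upwards [Ioi_mem_nhds h] with v hv using psi_of_nonneg _ (le_of_lt hv)

theorem contDiff_psi {s : ℂ} (hs : 1 < s.re) : ContDiff ℝ 1 (psi s) := by
  rw [contDiff_one_iff_deriv]
  refine ⟨fun u => (hasDerivAt_psi hs u).differentiableAt, ?_⟩
  have : deriv (psi s) = fun u => s * psi (s - 1) u := by
    funext u; rw [(hasDerivAt_psi hs u).deriv, psi_mul_div hs]
  rw [this]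
  exact continuous_const.mul (continuous_psi (by simp; linarith))

theorem abs_cpow_eq {s : ℂ} (hs : s ≠ 0) (u : ℝ) :
    ((|u| : ℝ) : ℂ) ^ s = psi s u + psi s (-u) := by
  rcases le_total u 0 with h | h
  · rw [abs_of_nonpos h, psi_of_nonpos hs h, psi_of_nonneg s (neg_nonneg.2 h), zero_add]
  · rw [abs_of_nonneg h, psi_of_nonneg s h, psi_of_nonpos hs (neg_nonpos.2 h), add_zero]

theorem hasDerivAt_abs_cpow {s : ℂ} (hs : 1 < s.re) (u : ℝ) :
    HasDerivAt (fun u : ℝ => ((|u| : ℝ) : ℂ) ^ s) (((|u| : ℝ) : ℂ) ^ s * (s / u)) u := by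
  have hs0 : s ≠ 0 := fun h => by simp [h] at hs; linarith
  have h2 := (hasDerivAt_psi hs (-u)).scomp u (hasDerivAt_neg u)
  have h1 := (hasDerivAt_psi hs u).add h2
  simp only [funext (abs_cpow_eq hs0)]
  refine h1.congr_deriv ?_
  push_cast
  rw [abs_cpow_eq hs0 u, add_mul, neg_smul, one_smul, div_neg]
  ring

theorem contDiff_abs_cpow {s : ℂ} (hs : 1 < s.re) :
    ContDiff ℝ 1 (fun u : ℝ => ((|u| : ℝ) : ℂ) ^ s) := by
  have hs0 : s ≠ 0 := fun h => by simp [h] at hs; linarith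
  simp only [funext (abs_cpow_eq hs0)]
  exact (contDiff_psi hs).add ((contDiff_psi hs).comp contDiff_neg)

/-- `ℓ` is a logarithmic derivative of `f` at `u`; any `ℓ` will do where `f` and its derivative
vanish. -/
def HasLogDeriv (f : ℝ → ℂ) (ℓ : ℂ) (u : ℝ) : Prop := HasDerivAt f (f u * ℓ) u

theorem HasLogDeriv.mul {f g : ℝ → ℂ} {ℓ ℓ' : ℂ} {u : ℝ} (hf : HasLogDeriv f ℓ u)
    (hg : HasLogDeriv g ℓ' u) : HasLogDeriv (fun v => f v * g v) (ℓ + ℓ') u :=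
  (HasDerivAt.mul hf hg).congr_deriv (by ring)

theorem HasLogDeriv.prod {ι : Type*} (S : Finset ι) {f : ι → ℝ → ℂ} {ℓ : ι → ℂ} {u : ℝ}
    (h : ∀ i ∈ S, HasLogDeriv (f i) (ℓ i) u) :
    HasLogDeriv (fun v => ∏ i ∈ S, f i v) (∑ i ∈ S, ℓ i) u := by
  classical
  induction S using Finset.induction_on with
  | empty => simpa [HasLogDeriv] using hasDerivAt_const u (1 : ℂ)
  | insert i S hi ih =>
    simp only [Finset.prod_insert hi, Finset.sum_insert hi]
    exact (h i (Finset.mem_insert_self _ _)).mul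
      (ih fun j hj => h j (Finset.mem_insert_of_mem hj))

theorem HasLogDeriv.comp {f : ℝ → ℂ} {g : ℝ → ℝ} {ℓ : ℂ} {c u : ℝ} (hf : HasLogDeriv f ℓ (g u))
    (hg : HasDerivAt g c u) : HasLogDeriv (fun v => f (g v)) (ℓ * c) u := by
  have := HasDerivAt.scomp u hf hg
  refine this.congr_deriv ?_
  simp only [Complex.real_smul]
  ring

end PowerFunctions

/-! ### The integrand as a function on the whole space. -/

section Kernel

variable (N q : ℕ) (l₂ l a l₁ : ℂ)

/-- The integrand `F`, extended by zero outside the domain of integration. -/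
noncomputable def kernelG (y : ℝ × (Fin N → ℝ)) : ℂ :=
  (∏ j, (psi l₁ (y.2 j) * psi l₂ (1 - y.2 j) *
      psi (a - 1) (if j.val < q then y.1 - y.2 j else y.2 j - y.1))) *
    ∏ j, ∏ k ∈ Finset.Ioi j, ((|y.2 k - y.2 j| : ℝ) : ℂ) ^ (2 * l)

variable {N q l₂ l a l₁}

/-- The exponents are large enough for every power, extended by zero, to be `C¹`; the factors `|x -
t_j|` carry the exponent `a - 1`, whence `2 < a.re`. -/
theorem contDiff_kernelG (h₁ : 1 < l₁.re) (h₂ : 1 < l₂.re) (ha : 2 < a.re) (hl : 1 < (2 * l).re) :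
    ContDiff ℝ 1 (kernelG N q l₂ l a l₁) := by
  have ha' : 1 < (a - 1).re := by simp; linarith
  have hc : ∀ j, ContDiff ℝ 1 fun y : ℝ × (Fin N → ℝ) => y.2 j := fun j => by fun_prop
  have hx : ContDiff ℝ 1 fun y : ℝ × (Fin N → ℝ) => y.1 := contDiff_fst
  refine ContDiff.mul (contDiff_prod fun j _ => ?_)
    (contDiff_prod fun j _ => contDiff_prod fun k _ => ?_)
  · refine (((contDiff_psi h₁).comp (hc j)).mul
      ((contDiff_psi h₂).comp (contDiff_const.sub (hc j)))).mul ((contDiff_psi ha').comp ?_)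
    split_ifs
    · exact hx.sub (hc j)
    · exact (hc j).sub hx
  · exact (contDiff_abs_cpow hl).comp ((hc k).sub (hc j))

/-- A general direction `(d, c)` covers both the derivative in `x` (`d = 1`, `c = 0`) and the one in
`t_i` (`d = 0`, `c` the unit vector). -/
theorem hasLogDeriv_kernelG (h₁ : 1 < l₁.re) (h₂ : 1 < l₂.re) (ha : 2 < a.re)
    (hl : 1 < (2 * l).re) (x d : ℝ) (t c : Fin N → ℝ) :
    HasLogDeriv (fun τ : ℝ => kernelG N q l₂ l a l₁ (x + τ * d, fun j => t j + τ * c j))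
      ((∑ j, (l₁ / t j * c j - l₂ / (1 - t j) * c j + (a - 1) / (x - t j) * (d - c j))) +
        ∑ j, ∑ k ∈ Finset.Ioi j, 2 * l / (t k - t j) * (c k - c j)) 0 := by
  have ha' : 1 < (a - 1).re := by simp; linarith
  have hlin : ∀ u v : ℝ, HasDerivAt (fun τ : ℝ => u + τ * v) v 0 := fun u v => by
    simpa using ((hasDerivAt_id (0 : ℝ)).mul_const v).const_add u
  refine HasLogDeriv.mul (HasLogDeriv.prod _ fun j _ => ?_)
    (HasLogDeriv.prod _ fun j _ => HasLogDeriv.prod _ fun k _ => ?_)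
  · have e1 : HasLogDeriv (fun τ : ℝ => psi l₁ (t j + τ * c j)) (l₁ / t j * c j) 0 := by
      have := HasLogDeriv.comp (g := fun τ : ℝ => t j + τ * c j) (hasDerivAt_psi h₁ _)
        (hlin (t j) (c j))
      simpa using this
    have e2 : HasLogDeriv (fun τ : ℝ => psi l₂ (1 - (t j + τ * c j)))
        (-(l₂ / (1 - t j) * c j)) 0 := by
      have := HasLogDeriv.comp (g := fun τ : ℝ => 1 - (t j + τ * c j)) (hasDerivAt_psi h₂ _)
        ((hlin (t j) (c j)).const_sub 1)
      simpa using this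
    have e3 : HasLogDeriv (fun τ : ℝ => psi (a - 1) (if j.val < q then
        x + τ * d - (t j + τ * c j) else (t j + τ * c j) - (x + τ * d)))
        ((a - 1) / (x - t j) * (d - c j)) 0 := by
      split_ifs
      · have := HasLogDeriv.comp (g := fun τ : ℝ => x + τ * d - (t j + τ * c j))
          (hasDerivAt_psi ha' _) ((hlin x d).sub (hlin (t j) (c j)))
        simpa using this
      · have := HasLogDeriv.comp (g := fun τ : ℝ => t j + τ * c j - (x + τ * d))
          (hasDerivAt_psi ha' _) ((hlin (t j) (c j)).sub (hlin x d))
        have e : (a - 1) / (x - t j) * (d - c j) = (a - 1) / (t j - x) * (c j - d) := by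
          rw [← neg_sub (t j : ℂ) x, div_neg]; ring
        rw [e]
        simpa using this
    rw [sub_eq_add_neg]
    exact (e1.mul e2).mul e3
  · have := HasLogDeriv.comp (g := fun τ : ℝ => t k + τ * c k - (t j + τ * c j))
      (hasDerivAt_abs_cpow hl _) ((hlin (t k) (c k)).sub (hlin (t j) (c j)))
    simpa using this

theorem kernelG_eq_zero (h₁ : l₁ ≠ 0) (h₂ : l₂ ≠ 0) {y : ℝ × (Fin N → ℝ)} {j : Fin N}
    (hj : y.2 j ∉ Ioo (0 : ℝ) 1) : kernelG N q l₂ l a l₁ y = 0 := by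
  rw [kernelG, Finset.prod_eq_zero (Finset.mem_univ j), zero_mul]
  rw [mem_Ioo, not_and_or, not_lt, not_lt] at hj
  rcases hj with h | h
  · rw [psi_of_nonpos h₁ h]; simp
  · rw [psi_of_nonpos h₂ (sub_nonpos.2 h)]; simp

theorem kernelG_eq_zero_of_eq (ha : a - 1 ≠ 0) {y : ℝ × (Fin N → ℝ)} {j : Fin N}
    (hj : y.2 j = y.1) : kernelG N q l₂ l a l₁ y = 0 := by
  rw [kernelG, Finset.prod_eq_zero (Finset.mem_univ j), zero_mul]
  rw [psi_of_nonpos ha (by split_ifs <;> simp [hj])]; simp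

theorem kernelG_eq_zero_of_eq_eq (hl : 2 * l ≠ 0) {y : ℝ × (Fin N → ℝ)} {i j : Fin N}
    (hij : i < j) (hj : y.2 i = y.2 j) : kernelG N q l₂ l a l₁ y = 0 := by
  rw [kernelG, mul_eq_zero]; right
  refine Finset.prod_eq_zero (Finset.mem_univ i) (Finset.prod_eq_zero (Finset.mem_Ioi.2 hij) ?_)
  rw [hj, sub_self, abs_zero, Complex.ofReal_zero, Complex.zero_cpow hl]

/-- Outside the domain some `psi` has a nonpositive argument. The moving domain is thus absorbed
into the integrand, and differentiation in `x` produces no boundary terms. -/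
theorem indicator_integrandF (h₁ : l₁ ≠ 0) (h₂ : l₂ ≠ 0) (ha : a - 1 ≠ 0) {x : ℝ}
    (hx : x ∈ Ioo (0 : ℝ) 1) (t : Fin N → ℝ) :
    (domain N q x).indicator (integrandF N l₂ l a l₁ x) t = kernelG N q l₂ l a l₁ (x, t) := by
  by_cases ht : t ∈ domain N q x
  · rw [indicator_of_mem ht, integrandF, kernelG]
    congr 1
    refine Finset.prod_congr rfl fun j _ => ?_
    have hj := ht j (mem_univ j)
    simp only at hj ⊢
    split_ifs at hj ⊢ with hq
    · rw [psi_of_nonneg _ hj.1.le, psi_of_nonneg _ (by linarith [hj.2, hx.2]),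
        psi_of_nonneg _ (by linarith [hj.2]), abs_of_pos (by linarith [hj.2])]
      push_cast; rfl
    · rw [psi_of_nonneg _ (hx.1.trans hj.1).le, psi_of_nonneg _ (by linarith [hj.2]),
        psi_of_nonneg _ (by linarith [hj.1]), abs_of_neg (by linarith [hj.1]), neg_sub]
      push_cast; rfl
  · rw [indicator_of_notMem ht]
    simp only [domain, mem_univ_pi, not_forall] at ht
    obtain ⟨j, hj⟩ := ht
    by_cases h01 : t j ∈ Ioo (0 : ℝ) 1
    · rw [kernelG, Finset.prod_eq_zero (Finset.mem_univ j), zero_mul]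
      have : psi (a - 1) (if j.val < q then x - t j else t j - x) = 0 := by
        refine psi_of_nonpos ha ?_
        split_ifs at hj ⊢ with hq
        · by_contra hcon
          exact hj ⟨h01.1, by linarith⟩
        · by_contra hcon
          exact hj ⟨by linarith, h01.2⟩
      simp [this]
    · rw [kernelG_eq_zero h₁ h₂ (y := (x, t)) h01]

end Kernel


/-! ### Integration by parts and differentiation under the integral sign. -/

section Integration

variable {N : ℕ} {K : Set (Fin N → ℝ)}

/-- Integration by parts against the constant `1`; compact support leaves no boundary term. -/
theorem integral_lineDeriv_eq_zero {f f' : (Fin N → ℝ) → ℂ} (hf : ContDiff ℝ 1 f)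
    (hK : IsCompact K) (hsupp : ∀ t, t ∉ K → f t = 0) (v : Fin N → ℝ)
    (hd : ∀ t, HasDerivAt (fun τ : ℝ => f (t + τ • v)) (f' t) 0) :
    Integrable f' ∧ ∫ t, f' t = 0 := by
  have hcs : HasCompactSupport f := HasCompactSupport.intro hK hsupp
  have hld : ∀ t, HasLineDerivAt ℝ f (f' t) t v := hd
  have hf' : f' = fun t => fderiv ℝ f t v := by
    funext t
    rw [← (hld t).lineDeriv]
    exact ((hf.differentiable one_ne_zero) t).lineDeriv_eq_fderiv
  have hint : Integrable f' := by
    rw [hf']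
    refine Continuous.integrable_of_hasCompactSupport
      ((hf.continuous_fderiv one_ne_zero).clm_apply continuous_const) ?_
    exact (hcs.fderiv ℝ).comp_left (g := fun L : (Fin N → ℝ) →L[ℝ] ℂ => L v) rfl
  refine ⟨hint, ?_⟩
  have := integral_bilinear_hasLineDerivAt_right_eq_neg_left_of_integrable
    (μ := (volume : Measure (Fin N → ℝ))) (f := fun _ => (1 : ℂ)) (f' := fun _ => 0) (g := f)
    (g' := f') (v := v) (B := ContinuousLinearMap.mul ℝ ℂ) (by simp)
    (by simpa using hint)
    (by simpa using hf.continuous.integrable_of_hasCompactSupport hcs)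
    (fun t _ => hasDerivAt_const _ _) (fun t _ => hld t)
  simpa using this

theorem hasDerivAt_integral_of_contDiff {F : ℝ × (Fin N → ℝ) → ℂ} {F' : (Fin N → ℝ) → ℂ}
    (hF : ContDiff ℝ 1 F) (hK : IsCompact K) (hsupp : ∀ x t, t ∉ K → F (x, t) = 0) (x : ℝ)
    (hd : ∀ t, HasDerivAt (fun y => F (y, t)) (F' t) x) :
    Integrable F' ∧ HasDerivAt (fun y => ∫ t, F (y, t)) (∫ t, F' t) x := by
  let D : ℝ → (Fin N → ℝ) → ℂ := fun y t => fderiv ℝ F (y, t) (1, 0)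
  have hDF : ∀ y t, HasDerivAt (fun y => F (y, t)) (D y t) y := fun y t => by
    have h1 : HasDerivAt (fun y : ℝ => (y, t)) ((1 : ℝ), (0 : Fin N → ℝ)) y :=
      (hasDerivAt_id y).prodMk (hasDerivAt_const y t)
    exact ((hF.differentiable one_ne_zero) (y, t)).hasFDerivAt.comp_hasDerivAt y h1
  have hD0 : ∀ y t, t ∉ K → D y t = 0 := fun y t ht => by
    have h1 : (fun y => F (y, t)) = fun _ => 0 := funext fun y => hsupp y t ht
    have h2 := hDF y t
    rw [h1] at h2
    exact h2.unique (hasDerivAt_const _ _)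
  have hDc : Continuous fun z : ℝ × (Fin N → ℝ) => D z.1 z.2 :=
    (hF.continuous_fderiv one_ne_zero).clm_apply continuous_const
  have hF'D : F' = D x := funext fun t => (hd t).unique (hDF x t)
  obtain ⟨C, hC⟩ := (isCompact_Icc (a := x - 1) (b := x + 1)).prod hK |>.exists_bound_of_continuousOn
    hDc.continuousOn
  have hint : ∀ y, Integrable fun t => F (y, t) := fun y =>
    (hF.continuous.comp (by fun_prop : Continuous fun t => (y, t))).integrable_of_hasCompactSupport
      (HasCompactSupport.intro hK (hsupp y))
  have hbd : ∀ᵐ t : Fin N → ℝ, ∀ y ∈ Icc (x - 1) (x + 1), ‖D y t‖ ≤ K.indicator (fun _ => C) t := by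
    refine Eventually.of_forall fun t y hy => ?_
    by_cases ht : t ∈ K
    · rw [indicator_of_mem ht]; exact hC (y, t) ⟨hy, ht⟩
    · rw [indicator_of_notMem ht, hD0 y t ht, norm_zero]
  have hbi : Integrable (K.indicator fun _ => C) :=
    (integrable_indicator_iff hK.measurableSet).2
      (integrableOn_const hK.measure_lt_top.ne)
  rw [hF'D]
  exact hasDerivAt_integral_of_dominated_loc_of_deriv_le (F := fun y t => F (y, t)) (F' := D)
    (Icc_mem_nhds (by linarith) (by linarith))
    (Eventually.of_forall fun y => (hint y).aestronglyMeasurable) (hint x)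
    (hDc.comp (by fun_prop : Continuous fun t => (x, t))).aestronglyMeasurable hbd hbi
    (Eventually.of_forall fun t y _ => hDF y t)

end Integration

/-! ### Derivatives of elementary symmetric polynomials. -/

section EsymDeriv

theorem contDiff_esym {E ι : Type*} [NormedAddCommGroup E] [NormedSpace ℝ E] (S : Finset ι)
    {f : ι → E → ℂ} (hf : ∀ i, ContDiff ℝ 1 (f i)) (p : ℕ) :
    ContDiff ℝ 1 fun y => esym S (fun i => f i y) p := by
  simp only [esym_eq_sum]
  exact ContDiff.sum fun T _ => contDiff_prod fun i _ => hf i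

theorem hasDerivAt_esym {ι : Type*} [DecidableEq ι] (S : Finset ι) {f : ι → ℝ → ℂ} {f' : ι → ℂ}
    {u : ℝ} (hf : ∀ i, HasDerivAt (f i) (f' i) u) (p : ℕ) :
    HasDerivAt (fun v => esym S (fun i => f i v) p)
      (∑ i ∈ S, f' i * prev (esym (S.erase i) fun i => f i u) p) u := by
  induction S using Finset.induction_on generalizing p with
  | empty => simpa [esym] using hasDerivAt_const u _
  | insert i S hi ih =>
    have hprev : HasDerivAt (fun v => prev (esym S fun i => f i v) p)
        (∑ i ∈ S, f' i * prev (prev (esym (S.erase i) fun i => f i u)) p) u := by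
      rcases p with _ | p
      · simpa [prev] using hasDerivAt_const u (0 : ℂ)
      · exact ih p
    have h1 : ∀ v, esym (insert i S) (fun i => f i v) p =
        esym S (fun i => f i v) p + f i v * prev (esym S fun i => f i v) p := fun v => by
      rw [esym_erase _ (Finset.mem_insert_self i S), Finset.erase_insert hi]
    simp only [h1]
    refine ((ih p).add ((hf i).mul hprev)).congr_deriv ?_
    rw [Finset.sum_insert hi, Finset.erase_insert hi, Finset.mul_sum, add_left_comm,
      ← Finset.sum_add_distrib]
    congr 1
    refine Finset.sum_congr rfl fun j hj => ?_
    have hij : i ≠ j := fun h => hi (h ▸ hj)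
    have h2 := prev_esym_erase (fun i => f i u) (S := (insert i S).erase j)
      (Finset.mem_erase.2 ⟨hij, Finset.mem_insert_self i S⟩) p
    rw [Finset.erase_right_comm, Finset.erase_insert hi] at h2
    rw [h2]; ring

theorem esym_congr {ι : Type*} {S : Finset ι} {s s' : ι → ℂ} (h : ∀ i ∈ S, s i = s' i) (p : ℕ) :
    esym S s p = esym S s' p := by
  rw [esym, Finset.prod_congr rfl fun i hi => by rw [h i hi], esym]

end EsymDeriv

theorem integral_mul_sub_mul_sub_mul {α : Type*} [MeasurableSpace α] {μ : Measure α}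
    {f g h : α → ℂ} (hf : Integrable f μ) (hg : Integrable g μ) (hh : Integrable h μ) (b c d : ℂ) :
    ∫ t, (b * f t - c * g t - d * h t) ∂μ =
      b * ∫ t, f t ∂μ - c * ∫ t, g t ∂μ - d * ∫ t, h t ∂μ := by
  have h1 : Integrable (fun t => b * f t - c * g t) μ := (hf.const_mul b).sub (hg.const_mul c)
  rw [integral_sub h1 (hh.const_mul d), integral_sub (hf.const_mul b) (hg.const_mul c),
    integral_const_mul, integral_const_mul, integral_const_mul]

/-! ### The differential equations for the integrals when all exponents are large. -/

section LargeParameters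

variable {N q : ℕ} {l₂ l a l₁ : ℂ}

theorem integralJ_eq_integral (h₁ : l₁ ≠ 0) (h₂ : l₂ ≠ 0) (ha : a - 1 ≠ 0) {x : ℝ}
    (hx : x ∈ Ioo (0 : ℝ) 1) (p : ℕ) : integralJ N p q l₂ l a l₁ x =
      ∫ t, kernelG N q l₂ l a l₁ (x, t) * esym Finset.univ (fun j => (t j : ℂ) - x) p := by
  have hm : MeasurableSet (domain N q x) := MeasurableSet.univ_pi fun j => by
    split_ifs <;> exact measurableSet_Ioo
  rw [integralJ, ← integral_indicator hm]
  congr 1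
  funext t
  rw [← indicator_integrandF h₁ h₂ ha hx]
  by_cases ht : t ∈ domain N q x
  · rw [indicator_of_mem ht, indicator_of_mem ht, integrandJ, eval_esymm]
  · rw [indicator_of_notMem ht, indicator_of_notMem ht, zero_mul]

/-- The right-hand side of the differential equation for the integrals `J_p`. -/
def odeRHS (N : ℕ) (l₂ l a l₁ : ℂ) (x : ℂ) (J : ℕ → ℂ) (p : ℕ) : ℂ :=
  (N - p) * ((1 - x) * (l₁ + a + l * (N - p - 1)) - x * (l₂ + a + l * (N - p - 1))) * J p -
    (p + 1) * (l₁ + l₂ + a + 1 + l * (2 * N - 2 - p)) * J (p + 1) -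
    x * (1 - x) * (N - p + 1) * (a + l * (N - p)) * prev J p

/-- Differentiate under the integral sign, add the vanishing integrals of the `t_i`-derivatives, and
compare integrands by `ode_identity`. -/
theorem hasDerivAt_integralJ_of_large (h₁ : 1 < l₁.re) (h₂ : 1 < l₂.re) (ha : 2 < a.re)
    (hl : 1 < (2 * l).re) {x : ℝ} (hx : x ∈ Ioo (0 : ℝ) 1) (p : ℕ) :
    HasDerivAt (integralJ N p q l₂ l a l₁)
      (((x : ℂ) * (1 - x))⁻¹ * odeRHS N l₂ l a l₁ x (fun p => integralJ N p q l₂ l a l₁ x) p) x := by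
  have h₁0 : l₁ ≠ 0 := fun h => by simp [h] at h₁; linarith
  have h₂0 : l₂ ≠ 0 := fun h => by simp [h] at h₂; linarith
  have ha0 : a - 1 ≠ 0 := fun h => by rw [sub_eq_zero] at h; simp [h] at ha
  have hl0 : 2 * l ≠ 0 := fun h => by rw [h] at hl; simp at hl; linarith
  set G := kernelG N q l₂ l a l₁
  have hG : ContDiff ℝ 1 G := contDiff_kernelG h₁ h₂ ha hl
  let K : Set (Fin N → ℝ) := Icc 0 1
  have hK : IsCompact K := isCompact_Icc
  have hGK : ∀ x t, t ∉ K → G (x, t) = 0 := fun x t ht => by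
    have : ∃ j, t j ∉ Ioo (0 : ℝ) 1 := by
      by_contra hcon
      push Not at hcon
      exact ht ⟨fun j => (hcon j).1.le, fun j => (hcon j).2.le⟩
    obtain ⟨j, hj⟩ := this
    exact kernelG_eq_zero h₁0 h₂0 (y := (x, t)) hj
  let e : (Fin N → ℝ) → ℕ → ℂ := fun t => esym Finset.univ fun j => (t j : ℂ) - x
  let e' : Fin N → (Fin N → ℝ) → ℂ := fun i t =>
    esym (Finset.univ.erase i) (fun j => (t j : ℂ) - x) p
  have hof : ContDiff ℝ 1 (fun u : ℝ => (u : ℂ)) := Complex.ofRealCLM.contDiff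
  have htc : ∀ j : Fin N, ContDiff ℝ 1 fun t : Fin N → ℝ => (t j : ℂ) := fun j =>
    hof.comp (by fun_prop)
  -- differentiation with respect to `x`
  let Dx : (Fin N → ℝ) → ℂ := fun t => G (x, t) * ((∑ i, (a - 1) / (x - t i)) * e t p +
    -((N - p + 1) * prev (e t) p))
  have hDx : Integrable Dx ∧ HasDerivAt (fun y : ℝ => ∫ t, G (y, t) *
      esym Finset.univ (fun j => (t j : ℂ) - y) p) (∫ t, Dx t) x := by
    refine hasDerivAt_integral_of_contDiff (K := K) (F := fun z : ℝ × (Fin N → ℝ) =>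
      G z * esym Finset.univ (fun j => (z.2 j : ℂ) - z.1) p) ?_ hK
      (fun y t ht => by simp only [hGK y t ht, zero_mul]) x fun t => ?_
    · refine hG.mul (contDiff_esym _ (fun j => ?_) p)
      exact (hof.comp (by fun_prop)).sub (hof.comp contDiff_fst)
    · have h3 := hasLogDeriv_kernelG (q := q) h₁ h₂ ha hl x 1 t 0
      have h4 : HasDerivAt (fun y : ℝ => G (y, t)) (G (x, t) * ∑ i, (a - 1) / (x - t i)) x := by
        have h5 : HasDerivAt (fun y : ℝ => y - x) 1 x := by
          simpa using (hasDerivAt_id x).sub_const x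
        have h6 : HasLogDeriv (fun τ : ℝ => G (x + τ, t)) (∑ i, (a - 1) / (x - t i))
            ((fun y : ℝ => y - x) x) := by
          simp only [sub_self]
          simpa using h3
        have h7 := HasLogDeriv.comp (g := fun y : ℝ => y - x) h6 h5
        simpa [HasLogDeriv] using h7
      have h8 : HasDerivAt (fun y : ℝ => esym Finset.univ (fun j => (t j : ℂ) - y) p)
          (-((N - p + 1) * prev (e t) p)) x := by
        have h9 := hasDerivAt_esym Finset.univ (f := fun j (y : ℝ) => (t j : ℂ) - y)
          (f' := fun _ => -1) (u := x)
          (fun j => ((hasDerivAt_id x).ofReal_comp.const_sub (t j : ℂ)).congr_deriv (by simp)) p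
        refine h9.congr_deriv ?_
        rw [← Finset.mul_sum, sum_prev_esym_erase]
        simp [e]
      refine (h4.mul h8).congr_deriv ?_
      simp only [Dx, e]; ring
  -- integration by parts
  let L : Fin N → (Fin N → ℝ) → ℂ := fun i t =>
    l₁ / t i - l₂ / (1 - t i) - (a - 1) / (x - t i) +
      ∑ j, ∑ k ∈ Finset.Ioi j, 2 * l / (t k - t j) *
        ((Pi.single i (1 : ℂ) : Fin N → ℂ) k - (Pi.single i (1 : ℂ) : Fin N → ℂ) j)
  -- The derivative of `t_i (1 - t_i) e' i G` in `t_i`: `e' i` omits `t_i` and is constant in this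
  -- direction, and `L i` is the logarithmic derivative of `G`.
  let Di : Fin N → (Fin N → ℝ) → ℂ := fun i t =>
    G (x, t) * ((1 - 2 * t i) * e' i t + t i * (1 - t i) * e' i t * L i t)
  have hDi : ∀ i, Integrable (Di i) ∧ ∫ t, Di i t = 0 := by
    intro i
    refine integral_lineDeriv_eq_zero (K := K)
      (f := fun t => (t i : ℂ) * (1 - t i) * e' i t * G (x, t)) ?_ hK
      (fun t ht => by simp only [hGK x t ht, mul_zero]) (Pi.single i 1) fun t => ?_
    · refine (((htc i).mul (contDiff_const.sub (htc i))).mul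
        (contDiff_esym _ (fun j => (htc j).sub contDiff_const) p)).mul (hG.comp ?_)
      exact contDiff_const.prodMk contDiff_id
    · have h3 := hasLogDeriv_kernelG (q := q) h₁ h₂ ha hl x 0 t (Pi.single i 1)
      have hcast : ∀ j, (((Pi.single i (1 : ℝ) : Fin N → ℝ) j : ℝ) : ℂ) =
          (Pi.single i (1 : ℂ) : Fin N → ℂ) j := fun j => by
        by_cases h : j = i
        · subst h; simp
        · simp [h]
      have h4 : HasDerivAt (fun τ : ℝ => G (x, t + τ • Pi.single i 1)) (G (x, t) * L i t) 0 := by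
        have h5 : (fun τ : ℝ => G (x, t + τ • Pi.single i 1)) = fun τ : ℝ =>
            kernelG N q l₂ l a l₁ (x + τ * 0, fun j => t j + τ * (Pi.single i 1 : Fin N → ℝ) j) := by
          funext τ
          rw [mul_zero, add_zero]; rfl
        rw [h5]
        refine HasDerivAt.congr_deriv h3 ?_
        simp only [zero_mul, add_zero, hcast]
        congr 1
        simp only [L]
        congr 1
        rw [Finset.sum_eq_single i]
        · simp; ring
        · intro j _ hj; simp [hj]
        · simp
      have h6 : HasDerivAt (fun τ : ℝ => ((t + τ • (Pi.single i 1 : Fin N → ℝ)) i : ℂ)) 1 0 := by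
        simpa using ((hasDerivAt_id (0 : ℝ)).ofReal_comp.const_add (t i : ℂ))
      have h7 : ∀ τ : ℝ, e' i (t + τ • Pi.single i 1) = e' i t := fun τ => by
        refine esym_congr (fun j hj => ?_) p
        simp [(Finset.mem_erase.1 hj).1]
      simp only [h7]
      refine (((h6.mul (h6.const_sub 1)).mul_const (e' i t)).mul h4).congr_deriv ?_
      simp [Di]
      ring
  -- the pointwise identity
  have hpt : ∀ t, (x : ℂ) * (1 - x) * Dx t + ∑ i, Di i t =
      G (x, t) * odeRHS N l₂ l a l₁ x (e t) p := by
    intro t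
    -- Where `G` vanishes both sides do. Elsewhere the `t_i` lie in `(0, 1)`, are distinct and
    -- differ from `x`, so no denominator of `ode_identity` is zero.
    by_cases hG0 : G (x, t) = 0
    · simp [Dx, Di, hG0]
    have a0 : ∀ i, (t i : ℂ) ≠ 0 ∧ 1 - (t i : ℂ) ≠ 0 ∧ (t i : ℂ) - x ≠ 0 := by
      intro i
      have h01 : t i ∈ Ioo (0 : ℝ) 1 := by
        by_contra hcon
        exact hG0 (kernelG_eq_zero h₁0 h₂0 (y := (x, t)) hcon)
      refine ⟨by exact_mod_cast h01.1.ne', sub_ne_zero.2 (by exact_mod_cast h01.2.ne'),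
        sub_ne_zero.2 fun h => hG0 (kernelG_eq_zero_of_eq ha0 (y := (x, t)) (j := i) ?_)⟩
      exact_mod_cast h
    have hne : ∀ i j, i ≠ j → (t i : ℂ) - t j ≠ 0 := by
      intro i j hij h
      have h' : t i = t j := by exact_mod_cast sub_eq_zero.1 h
      rcases lt_or_gt_of_ne hij with hlt | hlt
      · exact hG0 (kernelG_eq_zero_of_eq_eq hl0 (y := (x, t)) hlt h')
      · exact hG0 (kernelG_eq_zero_of_eq_eq hl0 (y := (x, t)) hlt h'.symm)
    have hid := ode_identity l₁ l₂ l a (x : ℂ) (fun i => (t i : ℂ)) (fun i => (a0 i).1)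
      (fun i => (a0 i).2.1) (fun i => (a0 i).2.2) hne p
    simp only at hid
    rw [odeRHS, ← hid]
    simp only [Dx, Di, ← Finset.mul_sum]
    rw [mul_left_comm, ← mul_add]
    congr 2
    have hL : ∀ i, (1 - 2 * (t i : ℂ)) * e' i t + t i * (1 - t i) * e' i t * L i t =
        ((1 - 2 * (t i : ℂ)) * e' i t + t i * (1 - t i) * e' i t *
          (l₁ / t i - l₂ / (1 - t i) - (a - 1) / (x - t i))) +
        ∑ j, ∑ k ∈ Finset.Ioi j, 2 * l / (t k - t j) *
          (t i * (1 - t i) * e' i t * ((Pi.single i (1 : ℂ) : Fin N → ℂ) k -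
            (Pi.single i (1 : ℂ) : Fin N → ℂ) j)) := by
      intro i
      simp only [L, mul_add, Finset.mul_sum, add_assoc]
      congr 2
      refine Finset.sum_congr rfl fun j _ => Finset.sum_congr rfl fun k _ => ?_
      ring
    rw [Finset.sum_congr rfl fun i _ => hL i, Finset.sum_add_distrib]
    congr 1
    -- With the sum over `i` innermost, `Pi.single` selects `i = k` and `i = j`, which gives the
    -- difference quotients of `ode_identity`.
    rw [Finset.sum_comm]
    refine Finset.sum_congr rfl fun j _ => ?_
    rw [Finset.sum_comm]
    refine Finset.sum_congr rfl fun k _ => ?_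
    rw [← Finset.mul_sum]
    have hs : ∀ m, ∑ i, (t i * (1 - t i) * e' i t) * (Pi.single i (1 : ℂ) : Fin N → ℂ) m =
        t m * (1 - t m) * e' m t := fun m => by
      rw [Finset.sum_eq_single m]
      · simp
      · intro i _ hi; simp [Pi.single_eq_of_ne' hi]
      · simp
    simp only [mul_sub, Finset.sum_sub_distrib]
    simp only [mul_sub] at hs
    rw [hs, hs]
    simp only [e']
    ring
  -- conclusion
  have hJ : ∀ p, integralJ N p q l₂ l a l₁ x = ∫ t, G (x, t) * e t p := fun p =>
    integralJ_eq_integral h₁0 h₂0 ha0 hx p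
  have hcx : Continuous fun t : Fin N → ℝ => G (x, t) := hG.continuous.comp (by fun_prop)
  have hint : ∀ p, Integrable fun t => G (x, t) * e t p := fun p => by
    refine Continuous.integrable_of_hasCompactSupport (hcx.mul ?_)
      (HasCompactSupport.intro hK fun t ht => by rw [hGK x t ht, zero_mul])
    exact (contDiff_esym _ (fun j => (htc j).sub contDiff_const) p).continuous
  have hprev : Integrable (fun t => G (x, t) * prev (e t) p) ∧
      ∫ t, G (x, t) * prev (e t) p = prev (fun p => integralJ N p q l₂ l a l₁ x) p := by
    rcases p with _ | p
    · simp [prev]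
    · exact ⟨hint p, (hJ p).symm⟩
  have hI : ∫ t, G (x, t) * odeRHS N l₂ l a l₁ x (e t) p =
      odeRHS N l₂ l a l₁ x (fun p => integralJ N p q l₂ l a l₁ x) p := by
    have hexp : ∀ t, G (x, t) * odeRHS N l₂ l a l₁ x (e t) p =
        (N - p) * ((1 - x) * (l₁ + a + l * (N - p - 1)) - x * (l₂ + a + l * (N - p - 1))) *
          (G (x, t) * e t p) -
        (p + 1) * (l₁ + l₂ + a + 1 + l * (2 * N - 2 - p)) * (G (x, t) * e t (p + 1)) -
        x * (1 - x) * (N - p + 1) * (a + l * (N - p)) * (G (x, t) * prev (e t) p) := fun t => by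
      rw [odeRHS]; ring
    simp only [hexp]
    rw [integral_mul_sub_mul_sub_mul (hint p) (hint (p + 1)) hprev.1, hprev.2, ← hJ, ← hJ, odeRHS]
  have hx0 : (x : ℂ) * (1 - x) ≠ 0 := by
    refine mul_ne_zero (by exact_mod_cast hx.1.ne') (sub_ne_zero.2 (by exact_mod_cast hx.2.ne'))
  have hDxv : ∫ t, Dx t = ((x : ℂ) * (1 - x))⁻¹ *
      odeRHS N l₂ l a l₁ x (fun p => integralJ N p q l₂ l a l₁ x) p := by
    rw [eq_inv_mul_iff_mul_eq₀ hx0, ← hI, ← integral_const_mul]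
    have h3 : ∫ t, ((x : ℂ) * (1 - x) * Dx t + ∑ i, Di i t) = ∫ t, (x : ℂ) * (1 - x) * Dx t := by
      rw [integral_add (hDx.1.const_mul _) (integrable_finsetSum _ fun i _ => (hDi i).1),
        integral_finsetSum _ fun i _ => (hDi i).1, Finset.sum_eq_zero fun i _ => (hDi i).2,
        add_zero]
    rw [← h3]
    exact integral_congr_ae (Eventually.of_forall hpt)
  rw [← hDxv]
  refine hDx.2.congr_of_eventuallyEq ?_
  filter_upwards [isOpen_Ioo.mem_nhds hx] with y hy using integralJ_eq_integral h₁0 h₂0 ha0 hy p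

end LargeParameters


/-! ### Holomorphic dependence of integrals on a parameter. -/

section ParametricIntegral

/-- Cauchy's estimate on circles of radius `ε / 2` turns the bound of the integrand into one of its
derivative, and difference quotients show that the derivative is measurable. -/
theorem differentiableAt_integral_of_bound {α : Type*} [MeasurableSpace α] {μ : Measure α}
    {F : ℂ → α → ℂ} {s₀ : ℂ} {ε : ℝ} (hε : 0 < ε) {bound : α → ℝ} (hb : Integrable bound μ)
    (hm : ∀ s ∈ Metric.ball s₀ ε, AEStronglyMeasurable (F s) μ)
    (h : ∀ᵐ t ∂μ, ∀ s ∈ Metric.ball s₀ ε, ‖F s t‖ ≤ bound t ∧ DifferentiableAt ℂ (fun s => F s t) s) :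
    DifferentiableAt ℂ (fun s => ∫ t, F s t ∂μ) s₀ := by
  have hε2 : 0 < ε / 2 := half_pos hε
  have hsub : Metric.ball s₀ (ε / 2) ⊆ Metric.ball s₀ ε := Metric.ball_subset_ball (by linarith)
  have hs₀ : s₀ ∈ Metric.ball s₀ ε := Metric.mem_ball_self hε
  have hmeas : AEStronglyMeasurable (fun t => deriv (fun s => F s t) s₀) μ := by
    let u : ℕ → ℂ := fun n => ((ε / 2) / (n + 1) : ℝ)
    have hu : Tendsto (fun n => s₀ + u n) atTop (𝓝[≠] s₀) := by
      refine tendsto_nhdsWithin_iff.2 ⟨?_, Eventually.of_forall fun n => ?_⟩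
      · have h1 : Tendsto (fun n : ℕ => (ε / 2) / ((n : ℝ) + 1)) atTop (𝓝 0) :=
          tendsto_const_nhds.div_atTop
            (tendsto_atTop_add_const_right _ _ tendsto_natCast_atTop_atTop)
        have h2 := (Complex.continuous_ofReal.tendsto 0).comp h1
        simpa [u] using h2.const_add s₀
      · have : u n ≠ 0 := by
          simp only [u, ne_eq, Complex.ofReal_eq_zero]
          positivity
        simpa using this
    refine aestronglyMeasurable_of_tendsto_ae atTop
      (f := fun n t => (u n)⁻¹ • (F (s₀ + u n) t - F s₀ t)) (fun n => ?_) ?_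
    · have hun : s₀ + u n ∈ Metric.ball s₀ ε → AEStronglyMeasurable
          (fun t => (u n)⁻¹ • (F (s₀ + u n) t - F s₀ t)) μ := fun hu =>
        ((hm _ hu).sub (hm _ hs₀)).const_smul (u n)⁻¹
      refine hun ?_
      simp only [Metric.mem_ball, dist_self_add_left, u, Complex.norm_real, Real.norm_eq_abs]
      rw [abs_of_pos (by positivity), div_lt_iff₀ (by positivity)]
      nlinarith [(Nat.cast_nonneg n : (0 : ℝ) ≤ n)]
    · filter_upwards [h] with t ht
      have h1 := (hasDerivAt_iff_tendsto_slope.1 (ht s₀ hs₀).2.hasDerivAt).comp hu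
      refine h1.congr fun n => ?_
      simp [slope, vsub_eq_sub]
  refine (hasDerivAt_integral_of_dominated_loc_of_deriv_le (F := F)
    (F' := fun s t => deriv (fun s => F s t) s) (bound := fun t => bound t / (ε / 2))
    (Metric.ball_mem_nhds s₀ hε2) ?_ ?_ hmeas ?_ (hb.div_const _) ?_).2.differentiableAt
  · filter_upwards [Metric.ball_mem_nhds s₀ hε] with s hs using hm s hs
  · exact hb.mono' (hm s₀ hs₀) (h.mono fun t ht => (ht s₀ hs₀).1)
  · filter_upwards [h] with t ht s hs
    refine Complex.norm_deriv_le_of_forall_mem_sphere_norm_le hε2 ?_ fun z hz => ?_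
    · have hcb : ∀ z ∈ Metric.closedBall s (ε / 2), z ∈ Metric.ball s₀ ε := fun z hz => by
        rw [Metric.mem_closedBall] at hz
        rw [Metric.mem_ball] at hs ⊢
        linarith [dist_triangle z s s₀]
      refine DifferentiableOn.diffContOnCl fun z hz => ?_
      exact (ht z (hcb z (Metric.closure_ball_subset_closedBall hz))).2.differentiableWithinAt
    · refine (ht z ?_).1
      rw [Metric.mem_sphere] at hz
      rw [Metric.mem_ball] at hs ⊢
      linarith [dist_triangle z s s₀]
  · filter_upwards [h] with t ht s hs using (ht s (hsub hs)).2.hasDerivAt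

end ParametricIntegral

/-! ### An integrable majorant in one variable. -/

section Majorant

/-- The function `v ^ c` on `(0, 1)`, extended by zero. -/
noncomputable def powInd (c : ℝ) (v : ℝ) : ℝ := (Ioo (0 : ℝ) 1).indicator (fun v => v ^ c) v

theorem powInd_nonneg (c v : ℝ) : 0 ≤ powInd c v :=
  indicator_nonneg (fun _ hv => Real.rpow_nonneg hv.1.le _) v

theorem powInd_of_mem {c v : ℝ} (hv : v ∈ Ioo (0 : ℝ) 1) : powInd c v = v ^ c :=
  indicator_of_mem hv _

theorem integrable_powInd {c : ℝ} (hc : -1 < c) : Integrable (powInd c) := by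
  refine (integrable_indicator_iff measurableSet_Ioo).2 ?_
  have := (intervalIntegral.intervalIntegrable_rpow' hc (a := 0) (b := 1)).1
  exact this.mono_set Ioo_subset_Ioc_self

/-- A majorant of `v ^ m₁ (1 - v) ^ m₂ |x - v| ^ (m₃ - 1)` whose integral does not depend on `x`. -/
noncomputable def majorant (m₁ m₂ m₃ x v : ℝ) : ℝ :=
  powInd m₁ v + powInd m₂ (1 - v) + (powInd (m₃ - 1) (x - v) + powInd (m₃ - 1) (v - x))

theorem majorant_nonneg (m₁ m₂ m₃ x v : ℝ) : 0 ≤ majorant m₁ m₂ m₃ x v :=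
  add_nonneg (add_nonneg (powInd_nonneg _ _) (powInd_nonneg _ _))
    (add_nonneg (powInd_nonneg _ _) (powInd_nonneg _ _))

theorem integrable_majorant {m₁ m₂ m₃ : ℝ} (h₁ : -1 < m₁) (h₂ : -1 < m₂) (h₃ : 0 < m₃) (x : ℝ) :
    Integrable (majorant m₁ m₂ m₃ x) :=
  ((integrable_powInd h₁).add ((integrable_powInd h₂).comp_sub_left 1)).add
    (((integrable_powInd (by linarith)).comp_sub_left x).add
      ((integrable_powInd (by linarith)).comp_sub_right x))

theorem integral_majorant {m₁ m₂ m₃ : ℝ} (h₁ : -1 < m₁) (h₂ : -1 < m₂) (h₃ : 0 < m₃) (x : ℝ) :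
    ∫ v, majorant m₁ m₂ m₃ x v = (∫ v, powInd m₁ v) + (∫ v, powInd m₂ v) +
      ((∫ v, powInd (m₃ - 1) v) + ∫ v, powInd (m₃ - 1) v) := by
  have e1 := integrable_powInd h₁
  have e2 := (integrable_powInd h₂).comp_sub_left 1
  have h₃' : -1 < m₃ - 1 := by linarith
  have e3 := (integrable_powInd h₃').comp_sub_left x
  have e4 := (integrable_powInd h₃').comp_sub_right x
  have e12 : Integrable (fun v => powInd m₁ v + powInd m₂ (1 - v)) := e1.add e2
  have e34 : Integrable (fun v => powInd (m₃ - 1) (x - v) + powInd (m₃ - 1) (v - x)) := e3.add e4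
  unfold majorant
  rw [integral_add e12 e34, integral_add e1 e2, integral_add e3 e4,
    integral_sub_left_eq_self (powInd m₂), integral_sub_left_eq_self (powInd (m₃ - 1)),
    integral_sub_right_eq_self (powInd (m₃ - 1))]

/-- The points `0`, `x`, `1` are at mutual distance at least `2 δ`, so `v` is within `δ` of at most
one of them, and the factors belonging to the others are bounded by powers of `δ`. -/
theorem rpow_mul_rpow_mul_rpow_le {m₁ m₂ m₃ δ x v : ℝ} (h₁ : m₁ ≤ 0) (h₂ : m₂ ≤ 0) (h₃ : m₃ ≤ 1)
    (hδ : 0 < δ) (hx : 2 * δ ≤ x) (hx' : x ≤ 1 - 2 * δ) (hv : v ∈ Ioo (0 : ℝ) 1) (hne : v ≠ x) :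
    v ^ m₁ * (1 - v) ^ m₂ * |x - v| ^ (m₃ - 1) ≤
      δ ^ m₁ * δ ^ m₂ * δ ^ (m₃ - 1) * majorant m₁ m₂ m₃ x v := by
  have hδ1 : δ ≤ 1 := by linarith
  have hbig : ∀ {u m : ℝ}, m ≤ 0 → δ ≤ u → u ^ m ≤ δ ^ m := fun hm hu =>
    Real.rpow_le_rpow_of_nonpos hδ hu hm
  have hone : ∀ {m : ℝ}, m ≤ 0 → 1 ≤ δ ^ m := fun hm => by
    simpa using Real.rpow_le_rpow_of_nonpos hδ hδ1 hm
  have h₃' : m₃ - 1 ≤ 0 := by linarith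
  have hv1 : 1 - v ∈ Ioo (0 : ℝ) 1 := ⟨by linarith [hv.2], by linarith [hv.1]⟩
  have habs : |x - v| ^ (m₃ - 1) ≤ powInd (m₃ - 1) (x - v) + powInd (m₃ - 1) (v - x) := by
    rcases lt_or_gt_of_ne hne with h | h
    · rw [abs_of_pos (by linarith), powInd_of_mem (v := x - v) ⟨by linarith, by linarith [hv.1]⟩]
      linarith [powInd_nonneg (m₃ - 1) (v - x)]
    · rw [abs_of_neg (by linarith), neg_sub,
        powInd_of_mem (v := v - x) ⟨by linarith, by linarith [hv.2]⟩]
      linarith [powInd_nonneg (m₃ - 1) (x - v)]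
  have n1 := powInd_nonneg m₁ v
  have n2 := powInd_nonneg m₂ (1 - v)
  have n3 := powInd_nonneg (m₃ - 1) (x - v)
  have n4 := powInd_nonneg (m₃ - 1) (v - x)
  have p1 : 0 ≤ v ^ m₁ := Real.rpow_nonneg hv.1.le _
  have p2 : 0 ≤ (1 - v) ^ m₂ := Real.rpow_nonneg hv1.1.le _
  have p3 : 0 ≤ |x - v| ^ (m₃ - 1) := Real.rpow_nonneg (abs_nonneg _) _
  have q1 := hone h₁
  have q2 := hone h₂
  have q3 := hone h₃'
  set A := δ ^ m₁
  set B := δ ^ m₂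
  set D := δ ^ (m₃ - 1)
  have r1 : 0 ≤ A := by linarith
  have r2 : 0 ≤ B := by linarith
  have r3 : 0 ≤ D := by linarith
  have hAB : 0 ≤ A * B * D := by positivity
  rcases lt_or_ge v δ with h | h
  · have c2 : (1 - v) ^ m₂ ≤ B := hbig h₂ (by linarith)
    have c3 : |x - v| ^ (m₃ - 1) ≤ D := hbig h₃' (by rw [abs_of_pos] <;> linarith)
    calc v ^ m₁ * (1 - v) ^ m₂ * |x - v| ^ (m₃ - 1) ≤ v ^ m₁ * B * D := by gcongr
      _ = 1 * B * D * v ^ m₁ := by ring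
      _ ≤ A * B * D * v ^ m₁ := by gcongr
      _ ≤ A * B * D * majorant m₁ m₂ m₃ x v := by
          gcongr
          rw [majorant, powInd_of_mem (c := m₁) hv]; linarith
  · have c1 : v ^ m₁ ≤ A := hbig h₁ h
    rcases lt_or_ge (1 - v) δ with h' | h'
    · have c3 : |x - v| ^ (m₃ - 1) ≤ D := hbig h₃' (by rw [abs_of_neg] <;> linarith)
      calc v ^ m₁ * (1 - v) ^ m₂ * |x - v| ^ (m₃ - 1) ≤ A * (1 - v) ^ m₂ * D := by gcongr
        _ = A * 1 * D * (1 - v) ^ m₂ := by ring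
        _ ≤ A * B * D * (1 - v) ^ m₂ := by gcongr
        _ ≤ A * B * D * majorant m₁ m₂ m₃ x v := by
            gcongr
            rw [majorant, powInd_of_mem (c := m₂) hv1]; linarith
    · have c2 : (1 - v) ^ m₂ ≤ B := hbig h₂ h'
      calc v ^ m₁ * (1 - v) ^ m₂ * |x - v| ^ (m₃ - 1) ≤ A * B * |x - v| ^ (m₃ - 1) := by gcongr
        _ = A * B * 1 * |x - v| ^ (m₃ - 1) := by ring
        _ ≤ A * B * D * |x - v| ^ (m₃ - 1) := by gcongr
        _ ≤ A * B * D * majorant m₁ m₂ m₃ x v := by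
            gcongr
            rw [majorant]; linarith

end Majorant

/-! ### Bounds, measurability and absolute convergence of the integrals. -/

section Bounds

variable {N q : ℕ}

theorem domain_subset {x : ℝ} (hx : x ∈ Ioo (0 : ℝ) 1) {t : Fin N → ℝ} (ht : t ∈ domain N q x)
    (j : Fin N) : t j ∈ Ioo (0 : ℝ) 1 ∧ t j ≠ x := by
  have hj := ht j (mem_univ j)
  simp only at hj
  split_ifs at hj
  · exact ⟨⟨hj.1, hj.2.trans hx.2⟩, hj.2.ne⟩
  · exact ⟨⟨hx.1.trans hj.1, hj.2⟩, hj.1.ne'⟩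

theorem norm_esym_le (S : Finset (Fin N)) {s : Fin N → ℂ} (hs : ∀ j, ‖s j‖ ≤ 1) (p : ℕ) :
    ‖esym S s p‖ ≤ (S.powersetCard p).card := by
  rw [esym_eq_sum]
  refine (norm_sum_le _ _).trans ?_
  rw [Finset.card_eq_sum_ones, Nat.cast_sum]
  refine Finset.sum_le_sum fun T _ => ?_
  rw [norm_prod, Nat.cast_one]
  exact Finset.prod_le_one (fun _ _ => norm_nonneg _) fun i _ => hs i

/-- The constant in the bound of the integrands. -/
noncomputable def boundConst (N p : ℕ) (m₁ m₂ m₃ δ : ℝ) : ℝ :=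
  (δ ^ m₁ * δ ^ m₂ * δ ^ (m₃ - 1)) ^ N *
    ((Finset.univ : Finset (Fin N)).powersetCard p).card

/-- All bases lie in `[0, 1]`, so lowering exponents to the `m_i` only enlarges the factors, and the
pair factors are at most `1` because `0 < l.re`. What remains is a product over the separate
variables. -/
theorem norm_integrandJ_le {l₂ l a l₁ : ℂ} {m₁ m₂ m₃ δ x : ℝ} (h₁ : m₁ ≤ 0) (h₂ : m₂ ≤ 0)
    (h₃ : m₃ ≤ 1) (hl₁ : m₁ ≤ l₁.re) (hl₂ : m₂ ≤ l₂.re) (ha : m₃ ≤ a.re) (hl : 0 < l.re)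
    (hδ : 0 < δ) (hx : 2 * δ ≤ x) (hx' : x ≤ 1 - 2 * δ) (p : ℕ) {t : Fin N → ℝ}
    (ht : t ∈ domain N q x) :
    ‖integrandJ N p l₂ l a l₁ x t‖ ≤
      boundConst N p m₁ m₂ m₃ δ * ∏ j, majorant m₁ m₂ m₃ x (t j) := by
  have hx01 : x ∈ Ioo (0 : ℝ) 1 := ⟨by linarith, by linarith⟩
  have ht' := domain_subset hx01 ht
  have hpow : ∀ {u m : ℝ} {s : ℂ}, u ∈ Ioc (0 : ℝ) 1 → m ≤ s.re → ‖(u : ℂ) ^ s‖ ≤ u ^ m :=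
    fun hu hm => by
      rw [Complex.norm_cpow_eq_rpow_re_of_pos hu.1]
      exact Real.rpow_le_rpow_of_exponent_ge hu.1 hu.2 hm
  have hD : 0 ≤ δ ^ m₁ * δ ^ m₂ * δ ^ (m₃ - 1) := by positivity
  have hF1 : ‖∏ j, ((t j : ℂ) ^ l₁ * (1 - (t j : ℂ)) ^ l₂ * ((|x - t j| : ℝ) : ℂ) ^ (a - 1))‖ ≤
      (δ ^ m₁ * δ ^ m₂ * δ ^ (m₃ - 1)) ^ N * ∏ j, majorant m₁ m₂ m₃ x (t j) := by
    have : (δ ^ m₁ * δ ^ m₂ * δ ^ (m₃ - 1)) ^ N * ∏ j, majorant m₁ m₂ m₃ x (t j) =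
        ∏ j : Fin N, (δ ^ m₁ * δ ^ m₂ * δ ^ (m₃ - 1) * majorant m₁ m₂ m₃ x (t j)) := by
      rw [Finset.prod_mul_distrib, Finset.prod_const, Finset.card_univ, Fintype.card_fin]
    rw [this, norm_prod]
    refine Finset.prod_le_prod (fun _ _ => norm_nonneg _) fun j _ => ?_
    obtain ⟨h01, hne⟩ := ht' j
    refine le_trans ?_ (rpow_mul_rpow_mul_rpow_le h₁ h₂ h₃ hδ hx hx' h01 hne)
    rw [norm_mul, norm_mul]
    have c1 : ‖(t j : ℂ) ^ l₁‖ ≤ (t j) ^ m₁ := hpow ⟨h01.1, h01.2.le⟩ hl₁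
    have c2 : ‖(1 - (t j : ℂ)) ^ l₂‖ ≤ (1 - t j) ^ m₂ := by
      have := hpow (u := 1 - t j) ⟨by linarith [h01.2], by linarith [h01.1]⟩ hl₂
      simpa using this
    have c3 : ‖((|x - t j| : ℝ) : ℂ) ^ (a - 1)‖ ≤ |x - t j| ^ (m₃ - 1) := by
      refine hpow ⟨abs_pos.2 (sub_ne_zero.2 hne.symm), ?_⟩ (by simpa using ha)
      rw [abs_le]
      constructor <;> linarith [h01.1, h01.2, hx01.1, hx01.2]
    have c4 : 0 ≤ (t j) ^ m₁ := Real.rpow_nonneg h01.1.le _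
    have c5 : 0 ≤ (1 - t j) ^ m₂ := Real.rpow_nonneg (by linarith [h01.2]) _
    gcongr
  have hF2 : ‖∏ j, ∏ k ∈ Finset.Ioi j, ((|t k - t j| : ℝ) : ℂ) ^ (2 * l)‖ ≤ 1 := by
    rw [norm_prod]
    refine Finset.prod_le_one (fun _ _ => norm_nonneg _) fun j _ => ?_
    rw [norm_prod]
    refine Finset.prod_le_one (fun _ _ => norm_nonneg _) fun k _ => ?_
    rcases eq_or_ne (t k) (t j) with h | h
    · have : 2 * l ≠ 0 := fun h => by
        have : l = 0 := by simpa using h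
        simp [this] at hl
      rw [h, sub_self, abs_zero, Complex.ofReal_zero, Complex.zero_cpow this, norm_zero]
      exact zero_le_one
    · rw [Complex.norm_cpow_eq_rpow_re_of_pos (abs_pos.2 (sub_ne_zero.2 h))]
      refine Real.rpow_le_one (abs_nonneg _) ?_ (by simpa using hl.le)
      rw [abs_le]
      constructor <;> linarith [(ht' j).1.1, (ht' j).1.2, (ht' k).1.1, (ht' k).1.2]
  have hE : ‖esym Finset.univ (fun j => (t j : ℂ) - x) p‖ ≤
      ((Finset.univ : Finset (Fin N)).powersetCard p).card := by
    refine norm_esym_le _ (fun j => ?_) p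
    rw [← Complex.ofReal_sub, Complex.norm_real, Real.norm_eq_abs, abs_le]
    constructor <;> linarith [(ht' j).1.1, (ht' j).1.2, hx01.1, hx01.2]
  have hmaj : 0 ≤ ∏ j, majorant m₁ m₂ m₃ x (t j) :=
    Finset.prod_nonneg fun j _ => majorant_nonneg _ _ _ _ _
  rw [integrandJ, integrandF, eval_esymm, norm_mul, norm_mul, boundConst]
  calc _ ≤ ((δ ^ m₁ * δ ^ m₂ * δ ^ (m₃ - 1)) ^ N * ∏ j, majorant m₁ m₂ m₃ x (t j)) * 1 *
        ((Finset.univ : Finset (Fin N)).powersetCard p).card := by gcongr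
    _ = _ := by ring

theorem measurableSet_domain (x : ℝ) : MeasurableSet (domain N q x) :=
  MeasurableSet.univ_pi fun j => by split_ifs <;> exact measurableSet_Ioo

theorem measurable_integrandJ (p : ℕ) (l₂ l a l₁ : ℂ) :
    Measurable fun y : ℝ × (Fin N → ℝ) => integrandJ N p l₂ l a l₁ y.1 y.2 := by
  simp only [integrandJ, integrandF, eval_esymm, esym_eq_sum]
  have h1 : Measurable fun y : ℝ × (Fin N → ℝ) => y.1 := measurable_fst
  have h2 : ∀ j, Measurable fun y : ℝ × (Fin N → ℝ) => y.2 j := fun j =>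
    (measurable_pi_apply j).comp measurable_snd
  have h3 : ∀ j, Measurable fun y : ℝ × (Fin N → ℝ) => (y.2 j : ℂ) := fun j =>
    Complex.measurable_ofReal.comp (h2 j)
  refine Measurable.mul (Measurable.mul (Finset.measurable_fun_prod _ fun j _ => ?_)
    (Finset.measurable_fun_prod _ fun j _ => Finset.measurable_fun_prod _ fun k _ => ?_))
    (Finset.measurable_fun_sum _ fun T _ => Finset.measurable_fun_prod _ fun j _ => ?_)
  · refine (((h3 j).pow_const _).mul ((measurable_const.sub (h3 j)).pow_const _)).mul ?_
    exact (Complex.measurable_ofReal.comp (h1.sub (h2 j)).abs).pow_const _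
  · exact (Complex.measurable_ofReal.comp ((h2 k).sub (h2 j)).abs).pow_const _
  · exact (h3 j).sub (Complex.measurable_ofReal.comp h1)

/-- The integrated differential equation uses measurability in `x` before continuity of the
integrals is available. -/
theorem stronglyMeasurable_integralJ (p : ℕ) (l₂ l a l₁ : ℂ) :
    StronglyMeasurable (integralJ N p q l₂ l a l₁) := by
  have hset : MeasurableSet {y : ℝ × (Fin N → ℝ) | y.2 ∈ domain N q y.1} := by
    have h1 : Measurable fun y : ℝ × (Fin N → ℝ) => y.1 := measurable_fst
    have h2 : ∀ j, Measurable fun y : ℝ × (Fin N → ℝ) => y.2 j := fun j =>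
      (measurable_pi_apply j).comp measurable_snd
    have : {y : ℝ × (Fin N → ℝ) | y.2 ∈ domain N q y.1} =
        ⋂ j : Fin N, {y | y.2 j ∈ if j.val < q then Ioo 0 y.1 else Ioo y.1 1} := by
      ext y; simp [domain, Set.mem_pi]
    rw [this]
    refine MeasurableSet.iInter fun j => ?_
    split_ifs
    · exact (measurableSet_lt measurable_const (h2 j)).inter (measurableSet_lt (h2 j) h1)
    · exact (measurableSet_lt h1 (h2 j)).inter (measurableSet_lt (h2 j) measurable_const)
  have hF : StronglyMeasurable ({y : ℝ × (Fin N → ℝ) | y.2 ∈ domain N q y.1}.indicator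
      fun y => integrandJ N p l₂ l a l₁ y.1 y.2) :=
    ((measurable_integrandJ p l₂ l a l₁).indicator hset).stronglyMeasurable
  have := hF.integral_prod_right' (ν := (volume : Measure (Fin N → ℝ)))
  convert this using 1
  funext x
  rw [integralJ, ← integral_indicator (measurableSet_domain x)]
  rfl

theorem integrable_prod_majorant {m₁ m₂ m₃ : ℝ} (h₁ : -1 < m₁) (h₂ : -1 < m₂) (h₃ : 0 < m₃) (x : ℝ) :
    Integrable fun t : Fin N → ℝ => ∏ j, majorant m₁ m₂ m₃ x (t j) :=
  Integrable.fintype_prod (f := fun _ => majorant m₁ m₂ m₃ x)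
    fun _ => integrable_majorant h₁ h₂ h₃ x

theorem exists_exponents {l₂ a l₁ : ℂ} (h₁ : -1 < l₁.re) (h₂ : -1 < l₂.re) (ha : 0 < a.re) :
    ∃ m₁ m₂ m₃ : ℝ, (-1 < m₁ ∧ m₁ ≤ 0 ∧ m₁ < l₁.re) ∧ (-1 < m₂ ∧ m₂ ≤ 0 ∧ m₂ < l₂.re) ∧
      (0 < m₃ ∧ m₃ ≤ 1 ∧ m₃ < a.re) := by
  obtain ⟨m₁, e1, e2⟩ := exists_between (lt_min h₁ (by norm_num : (-1 : ℝ) < 0))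
  obtain ⟨m₂, e3, e4⟩ := exists_between (lt_min h₂ (by norm_num : (-1 : ℝ) < 0))
  obtain ⟨m₃, e5, e6⟩ := exists_between (lt_min ha one_pos)
  exact ⟨m₁, m₂, m₃, ⟨e1, (lt_min_iff.1 e2).2.le, (lt_min_iff.1 e2).1⟩,
    ⟨e3, (lt_min_iff.1 e4).2.le, (lt_min_iff.1 e4).1⟩, e5, (lt_min_iff.1 e6).2.le,
    (lt_min_iff.1 e6).1⟩

theorem exists_margin {y z : ℝ} (hy : 0 < y) (hz : z < 1) :
    ∃ δ, 0 < δ ∧ ∀ x ∈ Icc y z, 2 * δ ≤ x ∧ x ≤ 1 - 2 * δ := by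
  refine ⟨min y (1 - z) / 2, half_pos (lt_min hy (by linarith)), fun x hx => ?_⟩
  have h1 := min_le_left y (1 - z)
  have h2 := min_le_right y (1 - z)
  constructor <;> linarith [hx.1, hx.2]

theorem integrableOn_integrandJ {l₂ l a l₁ : ℂ} (h₁ : -1 < l₁.re) (h₂ : -1 < l₂.re) (ha : 0 < a.re)
    (hl : 0 < l.re) {x : ℝ} (hx : x ∈ Ioo (0 : ℝ) 1) (p : ℕ) :
    IntegrableOn (integrandJ N p l₂ l a l₁ x) (domain N q x) := by
  obtain ⟨m₁, m₂, m₃, ⟨e1, e2, e3⟩, ⟨e4, e5, e6⟩, e7, e8, e9⟩ := exists_exponents h₁ h₂ ha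
  obtain ⟨δ, hδ, hδx⟩ := exists_margin hx.1 hx.2
  obtain ⟨d1, d2⟩ := hδx x ⟨le_rfl, le_rfl⟩
  refine Integrable.mono' ((integrable_prod_majorant e1 e4 e7 x).const_mul
    (boundConst N p m₁ m₂ m₃ δ)).integrableOn
    ((measurable_integrandJ p l₂ l a l₁).comp measurable_prodMk_left).aestronglyMeasurable ?_
  filter_upwards [ae_restrict_mem (measurableSet_domain x)] with t ht
  exact norm_integrandJ_le e2 e5 e8 e3.le e6.le e9.le hl hδ d1 d2 p ht

end Bounds


/-! ### Holomorphy of the integrals in the parameters. -/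

section ParameterDependence

variable {N q : ℕ}

theorem norm_integralJ_le {l₂ l a l₁ : ℂ} {m₁ m₂ m₃ δ x : ℝ} (e₁ : -1 < m₁) (e₂ : -1 < m₂)
    (e₃ : 0 < m₃) (h₁ : m₁ ≤ 0) (h₂ : m₂ ≤ 0)
    (h₃ : m₃ ≤ 1) (hl₁ : m₁ ≤ l₁.re) (hl₂ : m₂ ≤ l₂.re) (ha : m₃ ≤ a.re) (hl : 0 < l.re)
    (hδ : 0 < δ) (hx : 2 * δ ≤ x) (hx' : x ≤ 1 - 2 * δ) (p : ℕ) :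
    ‖integralJ N p q l₂ l a l₁ x‖ ≤ boundConst N p m₁ m₂ m₃ δ *
      ((∫ v, powInd m₁ v) + (∫ v, powInd m₂ v) +
      ((∫ v, powInd (m₃ - 1) v) + ∫ v, powInd (m₃ - 1) v)) ^ N := by
  have hC : 0 ≤ boundConst N p m₁ m₂ m₃ δ := by unfold boundConst; positivity
  have hi := (integrable_prod_majorant (N := N) e₁ e₂ e₃ x).const_mul (boundConst N p m₁ m₂ m₃ δ)
  have hprod : ∫ t : Fin N → ℝ, ∏ j, majorant m₁ m₂ m₃ x (t j) =
      ((∫ v, powInd m₁ v) + (∫ v, powInd m₂ v) +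
      ((∫ v, powInd (m₃ - 1) v) + ∫ v, powInd (m₃ - 1) v)) ^ N := by
    rw [integral_fintype_prod_volume_eq_prod (fun _ => majorant m₁ m₂ m₃ x), Finset.prod_const,
      integral_majorant e₁ e₂ e₃, Finset.card_univ, Fintype.card_fin]
  rw [← hprod, ← integral_const_mul]
  refine (norm_integral_le_of_norm_le hi.integrableOn ?_).trans
    (setIntegral_le_integral hi (Eventually.of_forall fun t => mul_nonneg hC
      (Finset.prod_nonneg fun j _ => majorant_nonneg _ _ _ _ _)))
  filter_upwards [ae_restrict_mem (measurableSet_domain x)] with t ht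
  exact norm_integrandJ_le h₁ h₂ h₃ hl₁ hl₂ ha hl hδ hx hx' p ht

/-- The range of parameters for which the integrals converge. -/
def Converges (l₂ l a l₁ : ℂ) : Prop := -1 < l₁.re ∧ -1 < l₂.re ∧ 0 < a.re ∧ 0 < l.re

variable {f₁ f₂ f₃ f₄ : ℂ → ℂ}

theorem exists_uniform_exponents (h₁ : Continuous f₁) (h₂ : Continuous f₂) (h₃ : Continuous f₃)
    (h₄ : Continuous f₄) {s₀ : ℂ} (hc : Converges (f₂ s₀) (f₄ s₀) (f₃ s₀) (f₁ s₀)) :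
    ∃ m₁ m₂ m₃ ε : ℝ, (-1 < m₁ ∧ m₁ ≤ 0) ∧ (-1 < m₂ ∧ m₂ ≤ 0) ∧ (0 < m₃ ∧ m₃ ≤ 1) ∧ 0 < ε ∧
      ∀ s ∈ Metric.ball s₀ ε, m₁ ≤ (f₁ s).re ∧ m₂ ≤ (f₂ s).re ∧ m₃ ≤ (f₃ s).re ∧ 0 < (f₄ s).re := by
  obtain ⟨c1, c2, c3, c4⟩ := hc
  obtain ⟨m₁, m₂, m₃, ⟨e1, e2, e3⟩, ⟨e4, e5, e6⟩, e7, e8, e9⟩ := exists_exponents c1 c2 c3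
  have hev : ∀ᶠ s in 𝓝 s₀, m₁ ≤ (f₁ s).re ∧ m₂ ≤ (f₂ s).re ∧ m₃ ≤ (f₃ s).re ∧ 0 < (f₄ s).re := by
    have key : ∀ {f : ℂ → ℂ} {m : ℝ}, Continuous f → m < (f s₀).re → ∀ᶠ s in 𝓝 s₀, m < (f s).re :=
      fun hf hm => (Complex.continuous_re.comp hf).continuousAt.eventually (lt_mem_nhds hm)
    filter_upwards [key h₁ e3, key h₂ e6, key h₃ e9, key h₄ c4] with s d1 d2 d3 d4
      using ⟨d1.le, d2.le, d3.le, d4⟩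
  obtain ⟨ε, hε, hb⟩ := Metric.eventually_nhds_iff_ball.1 hev
  exact ⟨m₁, m₂, m₃, ε, ⟨e1, e2⟩, ⟨e4, e5⟩, ⟨e7, e8⟩, hε, hb⟩

/-- The four parameters are entire functions of one variable in order to cover both a simultaneous
shift of all of them and the variation of `λ₁` alone. -/
theorem differentiableAt_integralJ (h₁ : Differentiable ℂ f₁) (h₂ : Differentiable ℂ f₂)
    (h₃ : Differentiable ℂ f₃) (h₄ : Differentiable ℂ f₄) {s₀ : ℂ}
    (hc : Converges (f₂ s₀) (f₄ s₀) (f₃ s₀) (f₁ s₀)) {x : ℝ} (hx : x ∈ Ioo (0 : ℝ) 1) (p : ℕ) :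
    DifferentiableAt ℂ (fun s => integralJ N p q (f₂ s) (f₄ s) (f₃ s) (f₁ s) x) s₀ := by
  obtain ⟨m₁, m₂, m₃, ε, ⟨e1, e2⟩, ⟨e3, e4⟩, ⟨e5, e6⟩, hε, hb⟩ := exists_uniform_exponents
    h₁.continuous h₂.continuous h₃.continuous h₄.continuous hc
  obtain ⟨δ, hδ, hδx⟩ := exists_margin hx.1 hx.2
  obtain ⟨d1, d2⟩ := hδx x ⟨le_rfl, le_rfl⟩
  refine differentiableAt_integral_of_bound hε ((integrable_prod_majorant e1 e3 e5 x).const_mul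
    (boundConst N p m₁ m₂ m₃ δ)).integrableOn (fun s _ =>
    ((measurable_integrandJ p _ _ _ _).comp measurable_prodMk_left).aestronglyMeasurable) ?_
  filter_upwards [ae_restrict_mem (measurableSet_domain x)] with t ht s hs
  obtain ⟨b1, b2, b3, b4⟩ := hb s hs
  refine ⟨norm_integrandJ_le e2 e4 e6 b1 b2 b3 b4 hδ d1 d2 p ht, ?_⟩
  have ht' := domain_subset hx ht
  simp only [integrandJ, integrandF]
  refine DifferentiableAt.mul_const (DifferentiableAt.mul
    (DifferentiableAt.fun_finsetProd fun j _ => ?_)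
    (DifferentiableAt.fun_finsetProd fun j _ => DifferentiableAt.fun_finsetProd fun k _ => ?_)) _
  · have c1 : (t j : ℂ) ≠ 0 := by exact_mod_cast (ht' j).1.1.ne'
    have c2 : 1 - (t j : ℂ) ≠ 0 := sub_ne_zero.2 (by exact_mod_cast (ht' j).1.2.ne')
    have c3 : ((|x - t j| : ℝ) : ℂ) ≠ 0 := by
      exact_mod_cast (abs_pos.2 (sub_ne_zero.2 (ht' j).2.symm)).ne'
    exact (((h₁ s).const_cpow (Or.inl c1)).mul ((h₂ s).const_cpow (Or.inl c2))).mul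
      (((h₃ s).sub_const 1).const_cpow (Or.inl c3))
  · refine ((h₄ s).const_mul 2).const_cpow (Or.inr fun h => ?_)
    have : f₄ s = 0 := by simpa using h
    rw [this] at b4
    simp at b4

/-- Uniformity in `x` as well as in `s` provides the domination under which integrals over `x` are
holomorphic in `s`. -/
theorem exists_uniform_bound (h₁ : Continuous f₁) (h₂ : Continuous f₂) (h₃ : Continuous f₃)
    (h₄ : Continuous f₄) {s₀ : ℂ} (hc : Converges (f₂ s₀) (f₄ s₀) (f₃ s₀) (f₁ s₀)) {y z : ℝ}
    (hy : 0 < y) (hz : z < 1) (p : ℕ) : ∃ M : ℝ, 0 ≤ M ∧ ∀ᶠ s in 𝓝 s₀, ∀ x ∈ Icc y z,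
      ‖integralJ N p q (f₂ s) (f₄ s) (f₃ s) (f₁ s) x‖ ≤ M := by
  obtain ⟨m₁, m₂, m₃, ε, ⟨e1, e2⟩, ⟨e3, e4⟩, ⟨e5, e6⟩, hε, hb⟩ := exists_uniform_exponents
    h₁ h₂ h₃ h₄ hc
  obtain ⟨δ, hδ, hδx⟩ := exists_margin hy hz
  refine ⟨max (boundConst N p m₁ m₂ m₃ δ * ((∫ v, powInd m₁ v) + (∫ v, powInd m₂ v) +
      ((∫ v, powInd (m₃ - 1) v) + ∫ v, powInd (m₃ - 1) v)) ^ N) 0, le_max_right _ _, ?_⟩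
  filter_upwards [Metric.ball_mem_nhds s₀ hε] with s hs x hx
  obtain ⟨b1, b2, b3, b4⟩ := hb s hs
  obtain ⟨d1, d2⟩ := hδx x hx
  exact (norm_integralJ_le e1 e3 e5 e2 e4 e6 b1 b2 b3 b4 hδ d1 d2 p).trans (le_max_left _ _)

end ParameterDependence

/-! ### The differential equations for all convergent parameters. -/

section Continuation

variable {N q : ℕ} (l₂ l a l₁ : ℂ)

/-- The right-hand side of the differential equation for the integral `J_p` with all parameters
shifted by `s`. -/
noncomputable def shiftedRHS (N q : ℕ) (p : ℕ) (s : ℂ) (u : ℝ) : ℂ :=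
  ((u : ℂ) * (1 - u))⁻¹ * odeRHS N (l₂ + s) (l + s) (a + s) (l₁ + s) u
    (fun p => integralJ N p q (l₂ + s) (l + s) (a + s) (l₁ + s) u) p

variable {l₂ l a l₁}

theorem differentiableAt_shiftedRHS {s : ℂ} (hc : Converges (l₂ + s) (l + s) (a + s) (l₁ + s))
    {u : ℝ} (hu : u ∈ Ioo (0 : ℝ) 1) (p : ℕ) :
    DifferentiableAt ℂ (fun s => shiftedRHS l₂ l a l₁ N q p s u) s := by
  have hJ : ∀ p, DifferentiableAt ℂ
      (fun s => integralJ N p q (l₂ + s) (l + s) (a + s) (l₁ + s) u) s := fun p =>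
    differentiableAt_integralJ (f₁ := fun s => l₁ + s) (f₂ := fun s => l₂ + s)
      (f₃ := fun s => a + s) (f₄ := fun s => l + s) (by fun_prop) (by fun_prop) (by fun_prop)
      (by fun_prop) hc hu p
  have hprev : DifferentiableAt ℂ
      (fun s => prev (fun p => integralJ N p q (l₂ + s) (l + s) (a + s) (l₁ + s) u) p) s := by
    rcases p with _ | p
    · exact differentiableAt_const 0
    · exact hJ p
  have h1 := hJ p
  have h2 := hJ (p + 1)
  simp only [shiftedRHS, odeRHS]
  fun_prop

theorem exists_bound_shiftedRHS {s₀ : ℂ}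
    (hc : Converges (l₂ + s₀) (l + s₀) (a + s₀) (l₁ + s₀)) {y z : ℝ}
    (hy : 0 < y) (hz : z < 1) (p : ℕ) : ∃ M : ℝ, 0 ≤ M ∧ ∀ᶠ s in 𝓝 s₀, ∀ x ∈ Icc y z,
      ‖shiftedRHS l₂ l a l₁ N q p s x‖ ≤ M := by
  have hJ : ∀ p, ∃ M : ℝ, 0 ≤ M ∧ ∀ᶠ s in 𝓝 s₀, ∀ x ∈ Icc y z,
      ‖integralJ N p q (l₂ + s) (l + s) (a + s) (l₁ + s) x‖ ≤ M := fun p =>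
    exists_uniform_bound (f₁ := fun s => l₁ + s) (f₂ := fun s => l₂ + s)
      (f₃ := fun s => a + s) (f₄ := fun s => l + s) (by fun_prop) (by fun_prop) (by fun_prop)
      (by fun_prop) hc hy hz p
  have hprev : ∃ M : ℝ, 0 ≤ M ∧ ∀ᶠ s in 𝓝 s₀, ∀ x ∈ Icc y z,
      ‖prev (fun p => integralJ N p q (l₂ + s) (l + s) (a + s) (l₁ + s) x) p‖ ≤ M := by
    rcases p with _ | p
    · exact ⟨0, le_rfl, by simp [prev]⟩
    · exact hJ p
  obtain ⟨M₁, hM₁, h1⟩ := hJ p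
  obtain ⟨M₂, hM₂, h2⟩ := hJ (p + 1)
  obtain ⟨M₃, hM₃, h3⟩ := hprev
  have hcpt : IsCompact (Metric.closedBall s₀ 1 ×ˢ Icc y z) :=
    (isCompact_closedBall s₀ 1).prod isCompact_Icc
  have hof : Continuous fun w : ℂ × ℝ => (w.2 : ℂ) := Complex.continuous_ofReal.comp continuous_snd
  have hinv : ContinuousOn (fun w : ℂ × ℝ => ((w.2 : ℂ) * (1 - w.2))⁻¹)
      (Metric.closedBall s₀ 1 ×ˢ Icc y z) := by
    refine ContinuousOn.inv₀ (by fun_prop) fun w hw => mul_ne_zero ?_ ?_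
    · exact_mod_cast (hy.trans_le hw.2.1).ne'
    · exact sub_ne_zero.2 (by exact_mod_cast (hw.2.2.trans_lt hz).ne')
  obtain ⟨C₁, hC₁⟩ := hcpt.exists_bound_of_continuousOn (f := fun w : ℂ × ℝ =>
    ((w.2 : ℂ) * (1 - w.2))⁻¹ * ((N - p) * ((1 - w.2) * (l₁ + w.1 + (a + w.1) +
      (l + w.1) * (N - p - 1)) - w.2 * (l₂ + w.1 + (a + w.1) + (l + w.1) * (N - p - 1)))))
    (hinv.mul (by fun_prop))
  obtain ⟨C₂, hC₂⟩ := hcpt.exists_bound_of_continuousOn (f := fun w : ℂ × ℝ =>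
    ((w.2 : ℂ) * (1 - w.2))⁻¹ * ((p + 1) * (l₁ + w.1 + (l₂ + w.1) + (a + w.1) + 1 +
      (l + w.1) * (2 * N - 2 - p)))) (hinv.mul (by fun_prop))
  obtain ⟨C₃, hC₃⟩ := hcpt.exists_bound_of_continuousOn (f := fun w : ℂ × ℝ =>
    ((w.2 : ℂ) * (1 - w.2))⁻¹ * (w.2 * (1 - w.2) * (N - p + 1) * (a + w.1 + (l + w.1) * (N - p))))
    (hinv.mul (by fun_prop))
  refine ⟨max (C₁ * M₁ + C₂ * M₂ + C₃ * M₃) 0, le_max_right _ _, ?_⟩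
  filter_upwards [h1, h2, h3, Metric.closedBall_mem_nhds s₀ one_pos] with s a1 a2 a3 hs x hx
  refine le_trans ?_ (le_max_left _ _)
  have b1 := hC₁ (s, x) ⟨hs, hx⟩
  have b2 := hC₂ (s, x) ⟨hs, hx⟩
  have b3 := hC₃ (s, x) ⟨hs, hx⟩
  have key : ∀ {c d : ℂ} {C M : ℝ}, 0 ≤ M → ‖c‖ ≤ C → ‖d‖ ≤ M → ‖c * d‖ ≤ C * M :=
    fun hM hc hd => by
      rw [norm_mul]
      exact mul_le_mul hc hd (norm_nonneg _) ((norm_nonneg _).trans hc)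
  simp only [shiftedRHS, odeRHS, mul_sub, ← mul_assoc]
  simp only [mul_sub, ← mul_assoc] at b1 b2 b3
  exact (norm_sub_le _ _).trans (add_le_add ((norm_sub_le _ _).trans
    (add_le_add (key hM₁ b1 (a1 x hx)) (key hM₂ b2 (a2 x hx)))) (key hM₃ b3 (a3 x hx)))

theorem stronglyMeasurable_shiftedRHS (p : ℕ) (s : ℂ) :
    StronglyMeasurable (shiftedRHS l₂ l a l₁ N q p s) := by
  have hJ : ∀ p, Measurable (integralJ N p q (l₂ + s) (l + s) (a + s) (l₁ + s)) := fun p =>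
    (stronglyMeasurable_integralJ p _ _ _ _).measurable
  have hprev : Measurable
      (fun u => prev (fun p => integralJ N p q (l₂ + s) (l + s) (a + s) (l₁ + s) u) p) := by
    rcases p with _ | p
    · exact measurable_const
    · exact hJ p
  have h1 := hJ p
  have h2 := hJ (p + 1)
  refine Measurable.stronglyMeasurable ?_
  unfold shiftedRHS odeRHS
  fun_prop

theorem intervalIntegrable_shiftedRHS {s : ℂ}
    (hc : Converges (l₂ + s) (l + s) (a + s) (l₁ + s)) {y z : ℝ} (hy : y ∈ Ioo (0 : ℝ) 1)
    (hz : z ∈ Ioo (0 : ℝ) 1) (p : ℕ) :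
    IntervalIntegrable (shiftedRHS l₂ l a l₁ N q p s) volume y z := by
  have hmin : 0 < min y z := lt_min hy.1 hz.1
  have hmax : max y z < 1 := max_lt hy.2 hz.2
  obtain ⟨M, hM, hb⟩ := exists_bound_shiftedRHS (q := q) (N := N) hc hmin hmax p
  refine IntervalIntegrable.mono_fun' (g := fun _ => M) intervalIntegrable_const
    (stronglyMeasurable_shiftedRHS p s).aestronglyMeasurable ?_
  filter_upwards [ae_restrict_mem measurableSet_uIoc] with x hx
  exact hb.self_of_nhds x (Ioc_subset_Icc_self hx)

/-- For `s.re > 3` the shifted parameters satisfy the hypotheses of `hasDerivAt_integralJ_of_large`.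
-/
theorem integralJ_sub_of_large {s : ℂ} (hc : Converges l₂ l a l₁) (hs : 3 < s.re) {y z : ℝ}
    (hy : y ∈ Ioo (0 : ℝ) 1) (hz : z ∈ Ioo (0 : ℝ) 1) (p : ℕ) :
    ∫ u in y..z, shiftedRHS l₂ l a l₁ N q p s u =
      integralJ N p q (l₂ + s) (l + s) (a + s) (l₁ + s) z -
      integralJ N p q (l₂ + s) (l + s) (a + s) (l₁ + s) y := by
  obtain ⟨c1, c2, c3, c4⟩ := hc
  refine intervalIntegral.integral_eq_sub_of_hasDerivAt (fun x hx => ?_)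
    (intervalIntegrable_shiftedRHS ?_ hy hz p)
  · have hx' : x ∈ Ioo (0 : ℝ) 1 :=
      ⟨(lt_min hy.1 hz.1).trans_le hx.1, hx.2.trans_lt (max_lt hy.2 hz.2)⟩
    refine hasDerivAt_integralJ_of_large ?_ ?_ ?_ ?_ hx' p <;> simp <;> linarith
  · refine ⟨?_, ?_, ?_, ?_⟩ <;> simp <;> linarith

/-- Both sides are holomorphic in the shift `s` on a half plane containing `0` and agree for `s.re >
3`, hence also at `s = 0`. The integrated form is the one to continue, as it presupposes no
differentiability in `x`. -/
theorem integralJ_sub (hc : Converges l₂ l a l₁) {y z : ℝ}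
    (hy : y ∈ Ioo (0 : ℝ) 1) (hz : z ∈ Ioo (0 : ℝ) 1) (p : ℕ) :
    ∫ u in y..z, shiftedRHS l₂ l a l₁ N q p 0 u =
      integralJ N p q l₂ l a l₁ z - integralJ N p q l₂ l a l₁ y := by
  obtain ⟨c1, c2, c3, c4⟩ := hc
  -- `η` is smaller than the distance of each real part from its bound of convergence, so every
  -- shift with `s.re > -η` still converges.
  obtain ⟨η, hη, hη'⟩ := exists_between
    (lt_min (lt_min (by linarith : 0 < l₁.re + 1) (by linarith : 0 < l₂.re + 1)) (lt_min c3 c4))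
  obtain ⟨h12, h34⟩ := lt_min_iff.1 hη'
  obtain ⟨h1, h2⟩ := lt_min_iff.1 h12
  obtain ⟨h3, h4⟩ := lt_min_iff.1 h34
  let U : Set ℂ := {s | -η < s.re}
  have hUo : IsOpen U := isOpen_lt continuous_const Complex.continuous_re
  have hUc : IsPreconnected U := (convex_halfSpace_re_gt (-η)).isPreconnected
  have hconv : ∀ s ∈ U, Converges (l₂ + s) (l + s) (a + s) (l₁ + s) := fun s hs => by
    have hs' : -η < s.re := hs
    refine ⟨?_, ?_, ?_, ?_⟩ <;> simp <;> linarith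
  let Φ : ℂ → ℂ := fun s => (∫ u in y..z, shiftedRHS l₂ l a l₁ N q p s u) -
    (integralJ N p q (l₂ + s) (l + s) (a + s) (l₁ + s) z -
      integralJ N p q (l₂ + s) (l + s) (a + s) (l₁ + s) y)
  have hΦ : DifferentiableOn ℂ Φ U := by
    intro s hs
    have hJ : ∀ x ∈ Ioo (0 : ℝ) 1, DifferentiableAt ℂ
        (fun s => integralJ N p q (l₂ + s) (l + s) (a + s) (l₁ + s) x) s := fun x hx =>
      differentiableAt_integralJ (f₁ := fun s => l₁ + s) (f₂ := fun s => l₂ + s)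
        (f₃ := fun s => a + s) (f₄ := fun s => l + s) (by fun_prop) (by fun_prop) (by fun_prop)
        (by fun_prop) (hconv s hs) hx p
    refine (DifferentiableAt.sub ?_ ((hJ z hz).sub (hJ y hy))).differentiableWithinAt
    obtain ⟨M, hM, hb⟩ := exists_bound_shiftedRHS (q := q) (N := N) (hconv s hs)
      (lt_min hy.1 hz.1) (max_lt hy.2 hz.2) p
    obtain ⟨ε, hε, hball⟩ := Metric.eventually_nhds_iff_ball.1 (hb.and (hUo.mem_nhds hs))
    have hi : ∀ v w : ℝ, Ioc v w ⊆ Icc (min y z) (max y z) → DifferentiableAt ℂ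
        (fun s => ∫ u in Ioc v w, shiftedRHS l₂ l a l₁ N q p s u) s := by
      intro v w hvw
      refine differentiableAt_integral_of_bound hε (bound := fun _ => M)
        (integrableOn_const (measure_Ioc_lt_top.ne))
        (fun s _ => (stronglyMeasurable_shiftedRHS p s).aestronglyMeasurable) ?_
      filter_upwards [ae_restrict_mem measurableSet_Ioc] with x hx s' hs'
      refine ⟨(hball s' hs').1 x (hvw hx), differentiableAt_shiftedRHS (hconv s' (hball s' hs').2)
        ⟨(lt_min hy.1 hz.1).trans_le (hvw hx).1, (hvw hx).2.trans_lt (max_lt hy.2 hz.2)⟩ p⟩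
    simp only [intervalIntegral]
    exact (hi y z (Ioc_subset_Icc_self.trans (Icc_subset_Icc (min_le_left _ _)
      (le_max_right _ _)))).sub (hi z y (Ioc_subset_Icc_self.trans
      (Icc_subset_Icc (min_le_right _ _) (le_max_left _ _))))
  have h4U : (4 : ℂ) ∈ U := by
    show -η < (4 : ℂ).re
    simp; linarith
  have h0U : (0 : ℂ) ∈ U := by
    show -η < (0 : ℂ).re
    simp; linarith
  have hev : Φ =ᶠ[𝓝 4] 0 := by
    have : {s : ℂ | 3 < s.re} ∈ 𝓝 (4 : ℂ) :=
      (isOpen_lt continuous_const Complex.continuous_re).mem_nhds (by simp; norm_num)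
    filter_upwards [this] with s hs
    exact sub_eq_zero.2 (integralJ_sub_of_large ⟨c1, c2, c3, c4⟩ hs hy hz p)
  have := (hΦ.analyticOnNhd hUo).eqOn_zero_of_preconnected_of_eventuallyEq_zero hUc h4U hev h0U
  simpa [Φ, sub_eq_zero] using this

/-- The integrated equation with its bounded right-hand side gives continuity in `x`; then the
right-hand side is continuous too, and the fundamental theorem of calculus applies. -/
theorem hasDerivAt_integralJ (hc : Converges l₂ l a l₁) {x : ℝ} (hx : x ∈ Ioo (0 : ℝ) 1) (p : ℕ) :
    HasDerivAt (integralJ N p q l₂ l a l₁)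
      (((x : ℂ) * (1 - x))⁻¹ * odeRHS N l₂ l a l₁ x (fun p => integralJ N p q l₂ l a l₁ x) p) x := by
  have hc0 : Converges (l₂ + 0) (l + 0) (a + 0) (l₁ + 0) := by simpa using hc
  have hcont : ∀ p, ContinuousAt (integralJ N p q l₂ l a l₁) x := by
    intro p
    obtain ⟨y, hy0, hyx⟩ := exists_between hx.1
    obtain ⟨z, hxz, hz1⟩ := exists_between hx.2
    obtain ⟨M, hM, hb⟩ := exists_bound_shiftedRHS (q := q) (N := N) hc0 hy0 hz1 p
    have hle : ∀ᶠ u in 𝓝 x, ‖integralJ N p q l₂ l a l₁ u - integralJ N p q l₂ l a l₁ x‖ ≤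
        M * |u - x| := by
      filter_upwards [Ioo_mem_nhds hyx hxz] with u hu
      rw [← integralJ_sub hc hx ⟨hy0.trans hu.1, hu.2.trans hz1⟩ p]
      refine intervalIntegral.norm_integral_le_of_norm_le_const fun v hv => ?_
      exact hb.self_of_nhds v ⟨(le_min hyx.le hu.1.le).trans hv.1.le,
        hv.2.trans (max_le hxz.le hu.2.le)⟩
    rw [ContinuousAt, tendsto_iff_norm_sub_tendsto_zero]
    refine squeeze_zero' (Eventually.of_forall fun _ => norm_nonneg _) hle ?_
    have : Continuous fun u : ℝ => M * |u - x| := by fun_prop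
    exact this.tendsto' x 0 (by simp)
  have hprev : ContinuousAt (fun u => prev (fun p => integralJ N p q l₂ l a l₁ u) p) x := by
    rcases p with _ | p
    · exact continuousAt_const
    · exact hcont p
  have hR : ContinuousAt (shiftedRHS l₂ l a l₁ N q p 0) x := by
    have h1 := hcont p
    have h2 := hcont (p + 1)
    have hne : (x : ℂ) * (1 - x) ≠ 0 := by
      refine mul_ne_zero (by exact_mod_cast hx.1.ne') (sub_ne_zero.2 (by exact_mod_cast hx.2.ne'))
    have hof : ContinuousAt (fun u : ℝ => (u : ℂ)) x := Complex.continuous_ofReal.continuousAt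
    unfold shiftedRHS odeRHS
    simp only [add_zero]
    refine ContinuousAt.mul (ContinuousAt.inv₀ (by fun_prop) hne) ?_
    fun_prop
  have hftc := intervalIntegral.integral_hasDerivAt_right
    (intervalIntegrable_shiftedRHS (N := N) (q := q) hc0 hx hx p)
    ((stronglyMeasurable_shiftedRHS p 0).stronglyMeasurableAtFilter) hR
  have hval : shiftedRHS l₂ l a l₁ N q p 0 x = ((x : ℂ) * (1 - x))⁻¹ *
      odeRHS N l₂ l a l₁ x (fun p => integralJ N p q l₂ l a l₁ x) p := by
    simp only [shiftedRHS, add_zero]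
  rw [← hval]
  refine (hftc.add_const (integralJ N p q l₂ l a l₁ x)).congr_of_eventuallyEq ?_
  filter_upwards [isOpen_Ioo.mem_nhds hx] with u hu
  rw [integralJ_sub hc hx hu p, sub_add_cancel]

end Continuation


/-! ### From the equations for the integrals to the Fuchsian system. -/

section IntegralSolutions

variable {N q : ℕ} {l₂ l a l₁ : ℂ}

/-- For vectors that are restrictions of sequences no boundary case remains: at `p = N` the
coefficient `a_0` is zero. -/
theorem Yplus_mulVec (f : ℕ → ℂ) (p : Fin (N + 1)) :
    (Yplus N l₂ l a l₁).mulVec (fun r => f r) p =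
      sigma l a l₁ (N - p) * f p + aCoeff N l₂ l a l₁ (N - p) * f (p + 1) := by
  obtain ⟨p, hp⟩ := p
  rcases Nat.lt_or_ge (p + 1) (N + 1) with h | h
  · exact Yplus_mulVec_of_lt _ h
  · obtain rfl : p = N := by omega
    rw [Yplus_mulVec_last]
    simp [aCoeff]

theorem Yminus_mulVec (f : ℕ → ℂ) (p : Fin (N + 1)) :
    (Yminus N l₂ l a).mulVec (fun r => f r) p =
      bCoeff N l₂ l a (N - p) * f p + cCoeff N l a (N - p) * prev f p := by
  obtain ⟨p, hp⟩ := p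
  rcases p with _ | p
  · rw [Matrix.mulVec, dotProduct, Fintype.sum_eq_single (⟨0, hp⟩ : Fin (N + 1))]
    · simp [Yminus, prev]
    · intro r h
      have h3 : r.val ≠ 0 := fun h' => h (Fin.ext h')
      simp [Yminus, h3]
  · have hne : (⟨p + 1, hp⟩ : Fin (N + 1)) ≠ ⟨p, by omega⟩ := by simp
    rw [Matrix.mulVec, dotProduct, Fintype.sum_eq_add _ _ hne]
    · simp [Yminus, prev]
    · rintro r ⟨h1, h2⟩
      have h3 : r.val ≠ p + 1 := fun h => h1 (Fin.ext h)
      have h4 : r.val ≠ p := fun h => h2 (Fin.ext h)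
      simp [Yminus, h3, h4]

theorem integralJ_eq_zero_of_lt {p : ℕ} (hp : N < p) (x : ℝ) :
    integralJ N p q l₂ l a l₁ x = 0 := by
  have h : Finset.powersetCard p (Finset.univ : Finset (Fin N)) = ∅ :=
    Finset.powersetCard_eq_empty.2 (by simpa using hp)
  simp [integralJ, integrandJ, MvPolynomial.esymm, h]

theorem choose_succ_cast (M p : ℕ) :
    (M.choose (p + 1) : ℂ) * (p + 1) = M.choose p * (M - p) := by
  rcases le_or_gt p M with hp | hp
  · rw [← Nat.cast_sub hp]
    exact_mod_cast Nat.choose_succ_right_eq M p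
  · simp [Nat.choose_eq_zero_of_lt hp, Nat.choose_eq_zero_of_lt (hp.trans (Nat.lt_succ_self p))]

/-- The columns of the matrix of integrals solve the Fuchsian system. -/
theorem isSolution_integralMatrix (hc : Converges l₂ l a l₁) (q : Fin (N + 1)) :
    IsSolution N l₂ l a l₁ fun x => (integralMatrix N l₂ l a l₁ x).col q := by
  intro x hx
  refine hasDerivAt_pi.2 fun p => ?_
  set J : ℕ → ℂ := fun p => integralJ N p q l₂ l a l₁ x with hJdef
  set X : ℂ := (x : ℂ) - 1 with hX
  have hX0 : X ≠ 0 := sub_ne_zero.2 (by exact_mod_cast hx.2.ne)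
  have hx0 : (x : ℂ) ≠ 0 := by exact_mod_cast hx.1.ne'
  have hx1 : 1 - (x : ℂ) ≠ 0 := sub_ne_zero.2 (by exact_mod_cast hx.2.ne')
  have hp : p.val ≤ N := by omega
  set f : ℕ → ℂ := fun p => (N.choose q : ℂ) * ((N.choose p : ℂ)⁻¹ * X ^ (-(p : ℤ)) * J p) with hf
  have hcol : (integralMatrix N l₂ l a l₁ x).col q = fun r : Fin (N + 1) => f r := by
    ext r; simp [integralMatrix, f, J, X]
  have hC : ∀ {m : ℕ}, m ≤ N → (N.choose m : ℂ) ≠ 0 := fun h =>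
    Nat.cast_ne_zero.2 (Nat.choose_pos h).ne'
  -- The conversion is `(N - p) / binom(N, p + 1) = (p + 1) / binom(N, p)`; at `p = N` the integral
  -- `J (N + 1)` vanishes, since `e_{N+1}` of `N` variables is zero.
  have hA : aCoeff N l₂ l a l₁ (N - p) * f (p + 1) =
      (N.choose q : ℂ) * ((N.choose p : ℂ)⁻¹ * X ^ (-(p : ℤ))) * X⁻¹ *
        ((p + 1) * (l₁ + l₂ + a + 1 + l * (2 * N - 2 - p)) * J (p + 1)) := by
    rcases hp.lt_or_eq with h | h
    · have h1 := choose_succ_cast N p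
      have h2 := hC hp
      have h3 := hC (Nat.succ_le_of_lt h)
      have h4 : X ^ (-((p.val + 1 : ℕ) : ℤ)) = X ^ (-(p.val : ℤ)) * X⁻¹ := by
        rw [Nat.cast_succ, neg_add, zpow_add₀ hX0, zpow_neg_one]
      have h5 : ((N : ℂ) - p) * (N.choose (p.val + 1) : ℂ)⁻¹ = (p + 1) * (N.choose p : ℂ)⁻¹ := by
        field_simp
        linear_combination -h1
      simp only [hf, h4, aCoeff, Nat.cast_sub hp]
      linear_combination (N.choose q : ℂ) * X ^ (-(p.val : ℤ)) * X⁻¹ * J (p + 1) *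
        (l₁ + l₂ + a + 1 + l * (2 * N - 2 - p)) * h5
    · have h1 : J (p + 1) = 0 := integralJ_eq_zero_of_lt (by omega) x
      simp [hf, h1]
  have hB : cCoeff N l a (N - p) * prev f p =
      (N.choose q : ℂ) * ((N.choose p : ℂ)⁻¹ * X ^ (-(p : ℤ))) * X *
        ((N - p + 1) * (a + l * (N - p)) * prev J p) := by
    obtain ⟨p, hp'⟩ := p
    rcases p with _ | p
    · simp [prev]
    · simp only at hp ⊢
      have h1 := choose_succ_cast N p
      have h2 := hC hp
      have h3 := hC (m := p) (by omega)
      have h4 : X ^ (-(p : ℤ)) = X ^ (-((p + 1 : ℕ) : ℤ)) * X := by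
        rw [← zpow_add_one₀ hX0]; congr 1; push_cast; ring
      have h5 : ((p : ℂ) + 1) * (N.choose p : ℂ)⁻¹ = (N - p) * (N.choose (p + 1) : ℂ)⁻¹ := by
        field_simp
        linear_combination h1
      simp only [prev, hf, cCoeff, Nat.cast_sub hp, h4]
      push_cast at h5 ⊢
      linear_combination (N.choose q : ℂ) * X ^ (-((p : ℤ) + 1)) * X * J p *
        (a + l * (N - (p + 1))) * h5
  beta_reduce
  rw [hcol, Matrix.add_mulVec, Matrix.smul_mulVec, Matrix.smul_mulVec, Pi.add_apply,
    Pi.smul_apply, Pi.smul_apply, Yplus_mulVec, Yminus_mulVec, hA, hB]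
  have hz : HasDerivAt (fun y : ℝ => ((y : ℂ) - 1) ^ (-(p.val : ℤ)))
      (-(p.val : ℂ) * X ^ (-(p.val : ℤ)) * X⁻¹) x := by
    have h1 : HasDerivAt (fun z : ℂ => (z - 1) ^ (-(p.val : ℤ)))
        (-(p.val : ℂ) * X ^ (-(p.val : ℤ)) * X⁻¹) (x : ℂ) := by
      refine ((hasDerivAt_zpow (-(p.val : ℤ)) X (Or.inl hX0)).comp (x : ℂ)
        ((hasDerivAt_id (x : ℂ)).sub_const 1)).congr_deriv ?_
      rw [zpow_sub_one₀ hX0]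
      push_cast
      ring
    exact h1.comp_ofReal
  have hd := ((hz.const_mul (N.choose p : ℂ)⁻¹).mul (hasDerivAt_integralJ (N := N) (q := q) hc hx p)).const_mul
    (N.choose q : ℂ)
  refine hd.congr_deriv ?_
  have hXx : (x : ℂ) = X + 1 := by rw [hX]; ring
  have hx0' : X + 1 ≠ 0 := hXx ▸ hx0
  have hJp : ∀ p, integralJ N p q l₂ l a l₁ x = J p := fun _ => rfl
  simp only [odeRHS, smul_eq_mul, sigma, bCoeff, Nat.cast_sub hp, hf, hJp, ← hX]
  rw [hXx]
  -- What is left is a rational identity in `X = x - 1` and the parameters, linear in the three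
  -- integrals.
  generalize J (p + 1) = J1, prev J p = J0, J p = Jp, X ^ (-(p.val : ℤ)) = Z,
    (N.choose p : ℂ)⁻¹ = C1
  have e1 : 1 - (X + 1) = -X := by ring
  rw [e1]
  field_simp
  ring

end IntegralSolutions


/-! ### The contiguity relation between `λ₁` and `λ₁ + 1`. -/

section Contiguity

open Polynomial

variable {N q : ℕ} {l₂ l a l₁ : ℂ}

theorem prod_add_eq_sum_esym (s : Fin N → ℂ) (x : ℂ) :
    ∏ i, (x + s i) = ∑ p : Fin (N + 1), x ^ (N - p.val) * esym Finset.univ s p := by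
  rw [Finset.sum_range (fun p => x ^ (N - p) * esym Finset.univ s p) |>.symm]
  simp_rw [add_comm x, Finset.prod_add, Finset.sum_powerset, esym_eq_sum, Finset.mul_sum]
  rw [Finset.card_univ, Fintype.card_fin]
  refine Finset.sum_congr rfl fun p _ => Finset.sum_congr rfl fun T hT => ?_
  have hc := (Finset.mem_powersetCard.1 hT).2
  rw [Finset.prod_const, Finset.card_sdiff_of_subset (Finset.subset_univ T), hc, Finset.card_univ,
    Fintype.card_fin, mul_comm]

/-- Raising `λ₁` by one multiplies the integrand by `∏ t_j = ∏ (x + (t_j - x))`, which is expanded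
in the `e_p(t - x)`. -/
theorem integrandJ_zero_add_one {x : ℝ} {t : Fin N → ℝ} (ht : ∀ j, t j ≠ 0) :
    integrandJ N 0 l₂ l a (l₁ + 1) x t =
      ∑ p : Fin (N + 1), (x : ℂ) ^ (N - p.val) * integrandJ N p l₂ l a l₁ x t := by
  have h1 : ∏ j, (t j : ℂ) = ∑ p : Fin (N + 1), (x : ℂ) ^ (N - p.val) *
      esym Finset.univ (fun j => (t j : ℂ) - x) p := by
    rw [← prod_add_eq_sum_esym]
    simp
  have h2 : integrandF N l₂ l a (l₁ + 1) x t = (∏ j, (t j : ℂ)) * integrandF N l₂ l a l₁ x t := by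
    have h : ∀ j, (t j : ℂ) ^ (l₁ + 1) * (1 - (t j : ℂ)) ^ l₂ * ((|x - t j| : ℝ) : ℂ) ^ (a - 1) =
        t j * ((t j : ℂ) ^ l₁ * (1 - (t j : ℂ)) ^ l₂ * ((|x - t j| : ℝ) : ℂ) ^ (a - 1)) := fun j => by
      rw [Complex.cpow_add _ _ (by exact_mod_cast ht j), Complex.cpow_one]
      ring
    simp only [integrandF]
    rw [Finset.prod_congr rfl fun j _ => h j, Finset.prod_mul_distrib, mul_assoc]
  simp only [integrandJ, eval_esymm, esym_zero, mul_one]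
  rw [h2, h1, Finset.sum_mul]
  exact Finset.sum_congr rfl fun p _ => by ring

/-- The integrals with parameter `λ₁ + 1` in the first row, in terms of those with parameter
`λ₁`. -/
theorem integralMatrix_add_one_zero (hc : Converges l₂ l a l₁) {x : ℝ} (hx : x ∈ Ioo (0 : ℝ) 1)
    (q : Fin (N + 1)) :
    integralMatrix N l₂ l a (l₁ + 1) x 0 q = ∑ p : Fin (N + 1),
      (x : ℂ) ^ (N - p.val) * (N.choose p) * ((x : ℂ) - 1) ^ p.val *
        integralMatrix N l₂ l a l₁ x p q := by
  have hX0 : (x : ℂ) - 1 ≠ 0 := sub_ne_zero.2 (by exact_mod_cast hx.2.ne)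
  have h1 : integralJ N 0 q l₂ l a (l₁ + 1) x =
      ∑ p : Fin (N + 1), (x : ℂ) ^ (N - p.val) * integralJ N p q l₂ l a l₁ x := by
    simp only [integralJ]
    simp_rw [← integral_const_mul]
    rw [← integral_finsetSum]
    · refine setIntegral_congr_fun (measurableSet_domain x) fun t ht => ?_
      exact integrandJ_zero_add_one fun j => ((domain_subset hx ht j).1.1).ne'
    · intro p _
      exact (integrableOn_integrandJ hc.1 hc.2.1 hc.2.2.1 hc.2.2.2 hx p).const_mul _
  simp only [integralMatrix, Matrix.of_apply, Fin.val_zero, h1]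
  simp only [Nat.choose_zero_right, Nat.cast_one, inv_one, Nat.cast_zero, neg_zero, zpow_zero,
    one_mul, Finset.mul_sum]
  refine Finset.sum_congr rfl fun p _ => ?_
  have h2 : (N.choose p : ℂ) ≠ 0 := Nat.cast_ne_zero.2 (Nat.choose_pos (by omega)).ne'
  rw [zpow_neg, zpow_natCast]
  field_simp

/-- The coefficient of `λ₁` in `Y⁺`. -/
noncomputable def Ylin (N : ℕ) : Matrix (Fin (N + 1)) (Fin (N + 1)) ℂ :=
  Matrix.of fun p r => if r.val = p.val then N - p else if r.val = p.val + 1 then N - p else 0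

/-- `Y⁺` is affine in `λ₁`; after division by `t` only the constant matrix `Ylin` survives as `1 / t
→ 0`. -/
theorem Yplus_add (t c : ℂ) : Yplus N l₂ l a (t + c) = t • Ylin N + Yplus N l₂ l a c := by
  ext p r
  have hp : p.val ≤ N := by omega
  simp only [Yplus, Ylin, Matrix.of_apply, Matrix.add_apply, Matrix.smul_apply, smul_eq_mul, sigma,
    aCoeff, Nat.cast_sub hp]
  split_ifs <;> ring

theorem Ylin_mulVec (f : ℕ → ℂ) (p : Fin (N + 1)) :
    (Ylin N).mulVec (fun r => f r) p = (N - p) * (f p + f (p + 1)) := by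
  have hp : p.val ≤ N := by omega
  have h := congrArg (fun M : Matrix (Fin (N + 1)) (Fin (N + 1)) ℂ => M.mulVec (fun r => f r) p)
    (Yplus_add (N := N) (l₂ := 0) (l := 0) (a := 0) 1 0)
  simp only [Matrix.add_mulVec, one_smul, Pi.add_apply, Yplus_mulVec, sigma, aCoeff,
    Nat.cast_sub hp] at h
  linear_combination -h

/-- The row vectors obtained from `s` by iterating `x (1 - x) / λ₁ • d/dx` along solutions of the
Fuchsian system with parameter `λ₁ + c`; the inner variable stands for `1 / λ₁`. -/
noncomputable def iterRow (N : ℕ) (l₂ l a c : ℂ) (s : Fin (N + 1) → ℂ[X][X]) :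
    ℕ → Fin (N + 1) → ℂ[X][X]
  | 0 => s
  | j + 1 => fun k => C X * (X * (1 - X)) * derivative (iterRow N l₂ l a c s j k) +
      ∑ p, iterRow N l₂ l a c s j p *
        ((1 - X) * C (C (Ylin N p k) + X * C (Yplus N l₂ l a c p k)) +
          X * C (X * C (Yminus N l₂ l a p k)))

theorem evalEval_iterRow_succ (c : ℂ) (s : Fin (N + 1) → ℂ[X][X]) (j : ℕ) (k : Fin (N + 1))
    (e x : ℂ) :
    (iterRow N l₂ l a c s (j + 1) k).evalEval e x =
      e * (x * (1 - x)) * (derivative (iterRow N l₂ l a c s j k)).evalEval e x +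
      ∑ p, (iterRow N l₂ l a c s j p).evalEval e x *
        ((1 - x) * (Ylin N p k + e * Yplus N l₂ l a c p k) + x * (e * Yminus N l₂ l a p k)) := by
  rw [iterRow]
  simp [evalEval_finsetSum, evalEval_C, mul_comm e]

theorem hasDerivAt_evalEval (f : ℂ[X][X]) (e : ℂ) (x : ℝ) :
    HasDerivAt (fun y : ℝ => f.evalEval e y) ((derivative f).evalEval e x) x := by
  have h := ((f.map (evalRingHom e)).hasDerivAt (x : ℂ)).comp_ofReal
  simpa only [derivative_map, map_evalRingHom_eval] using h

theorem sum_mul_add_mul_sum {ι : Type*} [Fintype ι] (R R' w : ι → ℂ) (B : ι → ι → ℂ) {c e : ℂ}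
    (h : c * e = 1) : ∑ p, (R' p * w p + R p * (c * ∑ k, B p k * w k)) =
      c * ∑ k, (e * R' k + ∑ p, R p * B p k) * w k := by
  simp only [add_mul, Finset.sum_add_distrib, mul_add]
  congr 1
  · rw [Finset.mul_sum]
    exact Finset.sum_congr rfl fun p _ => by linear_combination -(R' p * w p) * h
  · simp only [Finset.mul_sum, Finset.sum_mul]
    rw [Finset.sum_comm]
    exact Finset.sum_congr rfl fun p _ => Finset.sum_congr rfl fun k _ => by ring

theorem hasDerivAt_iterRow {c t : ℂ} (ht : t ≠ 0) {w : ℝ → Fin (N + 1) → ℂ}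
    (hw : IsSolution N l₂ l a (t + c) w) (s : Fin (N + 1) → ℂ[X][X]) (j : ℕ) {x : ℝ}
    (hx : x ∈ Ioo (0 : ℝ) 1) :
    HasDerivAt (fun y : ℝ => ∑ p, (iterRow N l₂ l a c s j p).evalEval t⁻¹ y * w y p)
      (t / (x * (1 - x)) * ∑ p, (iterRow N l₂ l a c s (j + 1) p).evalEval t⁻¹ x * w x p) x := by
  have hx0 : (x : ℂ) ≠ 0 := by exact_mod_cast hx.1.ne'
  have hx1 : 1 - (x : ℂ) ≠ 0 := sub_ne_zero.2 (by exact_mod_cast hx.2.ne')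
  refine (HasDerivAt.fun_sum fun p _ => (hasDerivAt_evalEval _ _ x).mul
    (hasDerivAt_pi.1 (hw x hx) p)).congr_deriv ?_
  have h1 : ∀ p, ((x : ℂ)⁻¹ • Yplus N l₂ l a (t + c) + (1 - (x : ℂ))⁻¹ • Yminus N l₂ l a).mulVec
      (w x) p = t / (x * (1 - x)) * ∑ k, ((1 - (x : ℂ)) * (Ylin N p k + t⁻¹ * Yplus N l₂ l a c p k) +
        x * (t⁻¹ * Yminus N l₂ l a p k)) * w x k := by
    intro p
    rw [Matrix.mulVec, dotProduct, Finset.mul_sum]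
    refine Finset.sum_congr rfl fun k _ => ?_
    rw [Yplus_add]
    simp only [Matrix.add_apply, Matrix.smul_apply, smul_eq_mul]
    field_simp
  simp only [h1, evalEval_iterRow_succ]
  refine sum_mul_add_mul_sum _ _ _ _ ?_
  field_simp

/-- The systems have parameters `t + c` and `t + d`, but the same operator `x (1 - x) / t • d/dx` is
applied to both sides; this is why the offset is separated from `t`. -/
theorem iterRow_eq {c d t : ℂ} (ht : t ≠ 0) {w u : ℝ → Fin (N + 1) → ℂ}
    (hw : IsSolution N l₂ l a (t + c) w) (hu : IsSolution N l₂ l a (t + d) u)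
    {r s : Fin (N + 1) → ℂ[X][X]}
    (h0 : ∀ x ∈ Ioo (0 : ℝ) 1, ∑ p, (r p).evalEval t⁻¹ x * w x p =
      ∑ p, (s p).evalEval t⁻¹ x * u x p) (j : ℕ) :
    ∀ x ∈ Ioo (0 : ℝ) 1, ∑ p, (iterRow N l₂ l a c r j p).evalEval t⁻¹ x * w x p =
      ∑ p, (iterRow N l₂ l a d s j p).evalEval t⁻¹ x * u x p := by
  induction j with
  | zero => exact h0
  | succ j ih =>
    intro x hx
    have h1 := hasDerivAt_iterRow ht hw r j hx
    have h2 := (hasDerivAt_iterRow ht hu s j hx).congr_of_eventuallyEq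
      (f₁ := fun y : ℝ => ∑ p, (iterRow N l₂ l a c r j p).evalEval t⁻¹ y * w y p)
      (eventually_of_mem (isOpen_Ioo.mem_nhds hx) ih)
    have hx0 : (x : ℂ) ≠ 0 := by exact_mod_cast hx.1.ne'
    have hx1 : 1 - (x : ℂ) ≠ 0 := sub_ne_zero.2 (by exact_mod_cast hx.2.ne')
    exact mul_left_cancel₀ (div_ne_zero ht (mul_ne_zero hx0 hx1)) (h1.unique h2)

/-- The row vector expressing the first component with parameter `λ₁ + 1`. -/
noncomputable def contigRow (N : ℕ) (p : Fin (N + 1)) : ℂ[X][X] :=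
  X ^ (N - p.val) * (N.choose p : ℂ[X][X]) * (X - 1) ^ p.val

/-- After cancellation of `binom(N, p)` the sum is `x ^ k (x + (1 - x)) ^ (N - k)`. It is the
pairing of `contigRow` with the eigenvectors of `Ylin`. -/
theorem sum_contigRow (e x : ℂ) (k : Fin (N + 1)) :
    ∑ p, (contigRow N p).evalEval e x *
      ((-1) ^ p.val * ((N - k.val).choose p : ℂ) / (N.choose p)) = x ^ k.val := by
  have h : ∀ p : Fin (N + 1), (contigRow N p).evalEval e x *
      ((-1) ^ p.val * ((N - k.val).choose p : ℂ) / (N.choose p)) =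
      x ^ (N - p.val) * (1 - x) ^ p.val * ((N - k.val).choose p) := by
    intro p
    have h2 : (N.choose p : ℂ) ≠ 0 := Nat.cast_ne_zero.2 (Nat.choose_pos (by omega)).ne'
    simp only [contigRow, evalEval_mul, evalEval_pow, evalEval_X, evalEval_natCast, evalEval_sub,
      evalEval_one]
    rw [← neg_sub x 1, neg_pow (x - 1)]
    field_simp
  rw [Finset.sum_congr rfl fun p _ => h p,
    ← Finset.sum_range (fun p => x ^ (N - p) * (1 - x) ^ p * ((N - k.val).choose p : ℂ))]
  rw [show Finset.range (N + 1) = Finset.range (N - k.val + 1 + k.val) by congr 1; omega,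
    Finset.sum_range_add]
  have h2 : ∑ p ∈ Finset.range k.val, x ^ (N - (N - k.val + 1 + p)) *
      (1 - x) ^ (N - k.val + 1 + p) * ((N - k.val).choose (N - k.val + 1 + p) : ℂ) = 0 :=
    Finset.sum_eq_zero fun p _ => by rw [Nat.choose_eq_zero_of_lt (by omega)]; simp
  rw [h2, add_zero]
  have h3 := add_pow (1 - x) x (N - k.val)
  rw [sub_add_cancel, one_pow] at h3
  conv_rhs => rw [← mul_one (x ^ k.val), h3, Finset.mul_sum]
  refine Finset.sum_congr rfl fun p hp => ?_
  have : N - p = k.val + (N - k.val - p) := by have := Finset.mem_range.1 hp; omega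
  rw [this, pow_add]
  ring

/-- Eigenvectors of the coefficient of `λ₁` in `Y⁺`. -/
theorem Ylin_mulVec_eigenvector (k : Fin (N + 1)) :
    (Ylin N).mulVec (fun p : Fin (N + 1) =>
      (-1) ^ p.val * ((N - k.val).choose p : ℂ) / (N.choose p)) =
    (k.val : ℂ) • fun p : Fin (N + 1) =>
      (-1) ^ p.val * ((N - k.val).choose p : ℂ) / (N.choose p) := by
  ext p
  rw [Ylin_mulVec (fun p => (-1) ^ p * ((N - k.val).choose p : ℂ) / (N.choose p)), Pi.smul_apply,
    smul_eq_mul]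
  obtain ⟨p, hp⟩ := p
  have h1 := choose_succ_cast N p
  have h2 := choose_succ_cast (N - k.val) p
  rw [Nat.cast_sub (by omega)] at h2
  have h3 : (N.choose p : ℂ) ≠ 0 := Nat.cast_ne_zero.2 (Nat.choose_pos (by omega)).ne'
  rcases Nat.lt_or_ge p N with h | h
  · have h4 : (N.choose (p + 1) : ℂ) ≠ 0 := Nat.cast_ne_zero.2 (Nat.choose_pos (by omega)).ne'
    have h5 : ((N : ℂ) - p) * (((N - k.val).choose (p + 1) : ℂ) / N.choose (p + 1)) =
        (N - k - p) * (((N - k.val).choose p : ℂ) / N.choose p) := by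
      have h6 : (p : ℂ) + 1 ≠ 0 := by exact_mod_cast Nat.succ_ne_zero p
      field_simp
      refine mul_left_cancel₀ h6 ?_
      linear_combination (-((N - k.val).choose (p + 1) : ℂ) * (p + 1)) * h1 +
        (N.choose (p + 1) : ℂ) * (p + 1) * h2
    simp only [pow_succ, mul_div_assoc]
    linear_combination -(-1) ^ p * h5
  · obtain rfl : p = N := by omega
    by_cases hk : k.val = 0
    · simp [hk]
    · rw [Nat.choose_eq_zero_of_lt (by omega : p - k.val < p)]; simp

/-- The determinant of the contiguity relations, as a polynomial in `1 / λ₁`. -/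
noncomputable def contigDet (N : ℕ) (l₂ l a x : ℂ) : ℂ[X] :=
  (Matrix.of fun j p : Fin (N + 1) =>
    (iterRow N l₂ l a 0 (contigRow N) j p).eval (C x)).det

theorem eval_contigDet (x e : ℂ) : (contigDet N l₂ l a x).eval e =
    (Matrix.of fun j p : Fin (N + 1) =>
      (iterRow N l₂ l a 0 (contigRow N) j p).evalEval e x).det := by
  rw [contigDet, ← coe_evalRingHom, RingHom.map_det]
  rfl

/-- At `1 / λ₁ = 0` one step of the iteration is right multiplication by `(1 - x) Ylin`. Row `j`
paired with the eigenvector of eigenvalue `k` then gives `x ^ k ((1 - x) k) ^ j`: a Vandermonde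
matrix with distinct nodes times an invertible diagonal matrix. -/
theorem contigDet_ne_zero {x : ℂ} (hx0 : x ≠ 0) (hx1 : 1 - x ≠ 0) :
    contigDet N l₂ l a x ≠ 0 := by
  intro h
  have h0 := eval_contigDet (N := N) (l₂ := l₂) (l := l) (a := a) x 0
  rw [h, eval_zero] at h0
  let v : Fin (N + 1) → Fin (N + 1) → ℂ := fun k p =>
    (-1) ^ p.val * ((N - k.val).choose p : ℂ) / (N.choose p)
  have hrow : ∀ (j : ℕ) (k : Fin (N + 1)),
      ∑ p, (iterRow N l₂ l a 0 (contigRow N) j p).evalEval 0 x * v k p =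
        x ^ k.val * ((1 - x) * k.val) ^ j := by
    intro j k
    induction j with
    | zero => simpa [iterRow, v] using sum_contigRow 0 x k
    | succ j ih =>
      simp only [evalEval_iterRow_succ, zero_mul, zero_add, mul_zero, add_zero]
      have h1 : ∀ p, ∑ r, Ylin N p r * v k r = k.val * v k p := fun p =>
        congrFun (Ylin_mulVec_eigenvector k) p
      calc _ = ∑ p, (iterRow N l₂ l a 0 (contigRow N) j p).evalEval 0 x *
            ((1 - x) * ∑ r, Ylin N p r * v k r) := by
            simp only [Finset.mul_sum, Finset.sum_mul]
            rw [Finset.sum_comm]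
            exact Finset.sum_congr rfl fun p _ => Finset.sum_congr rfl fun r _ => by ring
        _ = _ := by
            simp only [h1]
            rw [pow_succ, ← mul_assoc, ← ih, Finset.sum_mul]
            exact Finset.sum_congr rfl fun p _ => by ring
  have hmul : (Matrix.of fun j p : Fin (N + 1) =>
      (iterRow N l₂ l a 0 (contigRow N) j p).evalEval 0 x) * (Matrix.of fun p k => v k p) =
      (Matrix.vandermonde fun k : Fin (N + 1) => (1 - x) * (k.val : ℂ)).transpose *
        Matrix.diagonal fun k : Fin (N + 1) => x ^ k.val := by
    ext j k
    rw [Matrix.mul_apply, Matrix.mul_diagonal, Matrix.transpose_apply, Matrix.vandermonde_apply,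
      mul_comm]
    exact hrow j k
  have hdet := congrArg Matrix.det hmul
  rw [Matrix.det_mul, ← h0, zero_mul, Matrix.det_mul, Matrix.det_transpose,
    Matrix.det_diagonal] at hdet
  refine mul_ne_zero (Matrix.det_vandermonde_ne_zero_iff.2 fun i j hij => ?_)
    (Finset.prod_ne_zero_iff.2 fun k _ => pow_ne_zero _ hx0) hdet.symm
  exact Fin.ext (Nat.cast_injective (mul_left_cancel₀ hx1 hij))

/-- The matrix of the contiguity relation between the parameters `λ₁` and `λ₁ + 1`. -/
noncomputable def contigMatrix (N : ℕ) (l₂ l a : ℂ) (x : ℝ) (t : ℂ) :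
    Matrix (Fin (N + 1)) (Fin (N + 1)) ℂ :=
  (Matrix.of fun j p : Fin (N + 1) =>
      (iterRow N l₂ l a 0 (contigRow N) j p).evalEval t⁻¹ x)⁻¹ *
    Matrix.of fun j p : Fin (N + 1) =>
      (iterRow N l₂ l a 1 (Pi.single 0 1) j p).evalEval t⁻¹ x

theorem meromorphicAt_contigMatrix (x : ℝ) (t : ℂ) (i j : Fin (N + 1)) :
    MeromorphicAt (fun t => contigMatrix N l₂ l a x t i j) t := by
  have h : ∀ f : ℂ[X][X], MeromorphicAt (fun t : ℂ => f.evalEval t⁻¹ x) t := by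
    intro f
    have h1 : MeromorphicAt (fun t : ℂ => t⁻¹) t := (MeromorphicAt.id t).inv
    simp only [evalEval]
    generalize eval (C (x : ℂ)) f = g
    simp only [eval_eq_sum_range]
    exact MeromorphicAt.fun_sum fun n _ => (MeromorphicAt.const _ t).mul (h1.pow n)
  exact meromorphicAt_mul (fun i j => meromorphicAt_inv (fun i j => h _) i j) (fun i j => h _) i j

/-- The exceptional `t` are `0` and those for which `1 / t` is a root of `contigDet`; there are
finitely many. -/
theorem eventually_integralMatrix_eq (h₂ : -1 < l₂.re) (hl : 0 < l.re) (ha : 0 < a.re) {x : ℝ}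
    (hx : x ∈ Ioo (0 : ℝ) 1) : ∀ᶠ t in codiscrete ℂ, -1 < t.re →
      integralMatrix N l₂ l a t x =
        contigMatrix N l₂ l a x t * integralMatrix N l₂ l a (t + 1) x := by
  have hx0 : (x : ℂ) ≠ 0 := by exact_mod_cast hx.1.ne'
  have hx1 : 1 - (x : ℂ) ≠ 0 := sub_ne_zero.2 (by exact_mod_cast hx.2.ne')
  have hfin : {t : ℂ | t = 0 ∨ (contigDet N l₂ l a x).eval t⁻¹ = 0}.Finite := by
    refine (finite_singleton 0).union ?_
    refine Finite.preimage inv_injective.injOn (s := {e | (contigDet N l₂ l a x).eval e = 0}) ?_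
    exact finite_setOfPred_isRoot (contigDet_ne_zero hx0 hx1)
  filter_upwards [codiscrete_le_cofinite hfin.compl_mem_cofinite] with t ht htre
  obtain ⟨ht0, htd⟩ := not_or.1 ht
  have hc : Converges l₂ l a t := ⟨htre, h₂, ha, hl⟩
  have hc1 : Converges l₂ l a (t + 1) := ⟨by simp; linarith, h₂, ha, hl⟩
  rw [eval_contigDet] at htd
  have hmul : (Matrix.of fun j p : Fin (N + 1) =>
      (iterRow N l₂ l a 0 (contigRow N) j p).evalEval t⁻¹ x) * integralMatrix N l₂ l a t x =
      (Matrix.of fun j p : Fin (N + 1) =>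
        (iterRow N l₂ l a 1 (Pi.single 0 1) j p).evalEval t⁻¹ x) *
          integralMatrix N l₂ l a (t + 1) x := by
    ext j q
    simp only [Matrix.mul_apply, Matrix.of_apply]
    -- Row `j` is the `j`-fold derivative of the first-row relation `integralMatrix_add_one_zero`.
    refine iterRow_eq (w := fun x => (integralMatrix N l₂ l a t x).col q)
      (u := fun x => (integralMatrix N l₂ l a (t + 1) x).col q) ht0
      (by simpa using isSolution_integralMatrix hc q) (isSolution_integralMatrix hc1 q)
      (fun y hy => ?_) j x hx
    have h1 : ∀ p : Fin (N + 1), ((Pi.single 0 1 : Fin (N + 1) → ℂ[X][X]) p).evalEval t⁻¹ (y : ℂ) *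
        integralMatrix N l₂ l a (t + 1) y p q =
        if p = 0 then integralMatrix N l₂ l a (t + 1) y 0 q else 0 := by
      intro p
      by_cases h : p = 0
      · subst h; simp
      · simp [h]
    simp only [Matrix.col_apply]
    rw [Finset.sum_congr rfl fun p _ => h1 p, Finset.sum_ite_eq' Finset.univ,
      if_pos (Finset.mem_univ _), integralMatrix_add_one_zero hc hy]
    simp [contigRow]
  rw [contigMatrix, Matrix.mul_assoc, ← hmul, ← Matrix.mul_assoc,
    Matrix.nonsing_inv_mul _ (isUnit_iff_ne_zero.2 htd), Matrix.one_mul]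

end Contiguity


/-! ### Meromorphic continuation by a linear difference equation. -/

section MeromorphicContinuation

variable {n : ℕ}

/-- The continuation of `H` to the left by `m` applications of the relation
`H z = T z * H (z + 1)`. -/
noncomputable def shiftContinuation (T H : ℂ → Matrix (Fin n) (Fin n) ℂ) :
    ℕ → ℂ → Matrix (Fin n) (Fin n) ℂ
  | 0 => H
  | m + 1 => fun z => if -1 < z.re then H z else T z * shiftContinuation T H m (z + 1)

variable {T H : ℂ → Matrix (Fin n) (Fin n) ℂ}

theorem shiftContinuation_of_lt (m : ℕ) {z : ℂ} (hz : -1 < z.re) :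
    shiftContinuation T H m z = H z := by
  rcases m with _ | m
  · rfl
  · exact if_pos hz

theorem shiftContinuation_succ_of_not_lt (m : ℕ) {z : ℂ} (hz : ¬-1 < z.re) :
    shiftContinuation T H (m + 1) z = T z * shiftContinuation T H m (z + 1) :=
  if_neg hz

theorem shiftContinuation_succ_eq (m : ℕ) {z : ℂ} (hz : -1 - m < z.re) :
    shiftContinuation T H (m + 1) z = shiftContinuation T H m z := by
  induction m generalizing z with
  | zero => exact if_pos (by simpa using hz)
  | succ m ih =>
    by_cases h : -1 < z.re
    · rw [shiftContinuation_of_lt _ h, shiftContinuation_of_lt _ h]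
    · rw [shiftContinuation_succ_of_not_lt _ h, ih, shiftContinuation_succ_of_not_lt _ h]
      push_cast at hz
      rw [Complex.add_re, Complex.one_re]
      linarith

theorem shiftContinuation_eq_of_le {m m' : ℕ} (h : m ≤ m') {z : ℂ} (hz : -1 - m < z.re) :
    shiftContinuation T H m' z = shiftContinuation T H m z := by
  induction m', h using Nat.le_induction with
  | base => rfl
  | succ k hk ih =>
    rw [shiftContinuation_succ_eq, ih]
    have : (m : ℝ) ≤ k := by exact_mod_cast hk
    linarith

/-- The case distinction along `z.re = -1` does no harm: by the difference equation both branches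
coincide on a punctured neighbourhood, and meromorphy ignores the centre. -/
theorem meromorphicAt_shiftContinuation (hT : ∀ i j, Meromorphic fun z => T z i j)
    (hH : ∀ z : ℂ, -1 < z.re → ∀ i j, MeromorphicAt (fun z => H z i j) z)
    (h : ∀ᶠ z in codiscrete ℂ, -1 < z.re → H z = T z * H (z + 1)) (m : ℕ) {w : ℂ}
    (hw : -1 - m < w.re) (i j : Fin n) :
    MeromorphicAt (fun z => shiftContinuation T H m z i j) w := by
  induction m generalizing w i j with
  | zero => exact hH w (by simpa using hw) i j
  | succ m ih =>
    have hw' : -1 - (m : ℝ) < (w + 1).re := by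
      push_cast at hw
      rw [Complex.add_re, Complex.one_re]
      linarith
    have hs : ∀ i j, MeromorphicAt (fun z => shiftContinuation T H m (z + 1) i j) w := fun i j =>
      (ih hw' i j).comp_analyticAt (g := fun z : ℂ => z + 1) (by fun_prop)
    refine (meromorphicAt_mul (fun i j => hT i j w) hs i j).congr ?_
    filter_upwards [eventually_punctured_of_codiscrete h w] with z hz
    by_cases hre : -1 < z.re
    · rw [shiftContinuation_of_lt _ hre, shiftContinuation_of_lt _ (by
        rw [Complex.add_re, Complex.one_re]; linarith), hz hre]
    · rw [shiftContinuation_succ_of_not_lt _ hre]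

/-- A function on a half plane satisfying a meromorphic linear difference equation extends
meromorphically to the plane. -/
theorem exists_meromorphic_continuation (hT : ∀ i j, Meromorphic fun z => T z i j)
    (hH : ∀ z : ℂ, -1 < z.re → ∀ i j, MeromorphicAt (fun z => H z i j) z)
    (h : ∀ᶠ z in codiscrete ℂ, -1 < z.re → H z = T z * H (z + 1)) :
    ∃ K : ℂ → Matrix (Fin n) (Fin n) ℂ, (∀ i j, Meromorphic fun z => K z i j) ∧
      ∀ z : ℂ, -1 < z.re → K z = H z := by
  -- Since `z.re ≥ -‖z‖`, this number of shifts to the right brings `z` into the half plane; near a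
  -- given point one fixed larger number yields the same values.
  refine ⟨fun z => shiftContinuation T H ⌈‖z‖⌉₊ z, fun i j w => ?_,
    fun z hz => shiftContinuation_of_lt _ hz⟩
  have hre : ∀ z : ℂ, -1 - (⌈‖z‖⌉₊ : ℝ) < z.re := fun z => by
    have h1 := Nat.le_ceil ‖z‖
    have h2 := neg_le_of_abs_le (Complex.abs_re_le_norm z)
    linarith
  have hle : ∀ z : ℂ, ‖z‖ < ‖w‖ + 1 → ⌈‖z‖⌉₊ ≤ ⌈‖w‖ + 1⌉₊ := fun z hz => Nat.ceil_mono hz.le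
  refine (meromorphicAt_shiftContinuation hT hH h ⌈‖w‖ + 1⌉₊ (w := w) ?_ i j).congr ?_
  · have h1 : (⌈‖w‖⌉₊ : ℝ) ≤ ⌈‖w‖ + 1⌉₊ := by exact_mod_cast hle w (lt_add_one _)
    have h2 := hre w
    linarith
  · have : ∀ᶠ z in 𝓝 w, ‖z‖ < ‖w‖ + 1 :=
      continuous_norm.continuousAt.eventually_lt continuousAt_const (lt_add_one _)
    filter_upwards [this.filter_mono nhdsWithin_le_nhds] with z hz
    rw [shiftContinuation_eq_of_le (hle z hz) (hre z)]

end MeromorphicContinuation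

/-! ### Continuation of the matrix of integrals in `λ₁`. -/

section ConnectionMatrix

variable {N : ℕ} {l₂ l a : ℂ}

theorem meromorphicAt_integralMatrix (h₂ : -1 < l₂.re) (hl : 0 < l.re) (ha : 0 < a.re) {x : ℝ}
    (hx : x ∈ Ioo (0 : ℝ) 1) {l₁ : ℂ} (h₁ : -1 < l₁.re) (p q : Fin (N + 1)) :
    MeromorphicAt (fun l₁ => integralMatrix N l₂ l a l₁ x p q) l₁ := by
  have hU : IsOpen {z : ℂ | -1 < z.re} := isOpen_lt continuous_const Complex.continuous_re
  have hd : DifferentiableOn ℂ (fun l₁ => integralJ N p q l₂ l a l₁ x) {z : ℂ | -1 < z.re} :=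
    fun z hz => (differentiableAt_integralJ (f₁ := fun s => s) (f₂ := fun _ => l₂)
      (f₃ := fun _ => a) (f₄ := fun _ => l) differentiable_id (differentiable_const _)
      (differentiable_const _) (differentiable_const _) ⟨hz, h₂, ha, hl⟩ hx p).differentiableWithinAt
  have hJ : MeromorphicAt (fun l₁ => integralJ N p q l₂ l a l₁ x) l₁ :=
    (hd.analyticAt (hU.mem_nhds h₁)).meromorphicAt
  simp only [integralMatrix, Matrix.of_apply]
  exact (MeromorphicAt.const _ _).mul ((MeromorphicAt.const _ _).mul hJ)

/-- The meromorphic continuation in `λ₁` of the matrix of integrals at a given point. -/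
theorem exists_continuation_integralMatrix (h₂ : -1 < l₂.re) (hl : 0 < l.re) (ha : 0 < a.re) {x : ℝ}
    (hx : x ∈ Ioo (0 : ℝ) 1) :
    ∃ K : ℂ → Matrix (Fin (N + 1)) (Fin (N + 1)) ℂ, (∀ i j, Meromorphic fun z => K z i j) ∧
      ∀ z : ℂ, -1 < z.re → K z = integralMatrix N l₂ l a z x :=
  exists_meromorphic_continuation (fun i j t => meromorphicAt_contigMatrix x t i j)
    (fun _ hz => meromorphicAt_integralMatrix h₂ hl ha hx hz)
    (eventually_integralMatrix_eq h₂ hl ha hx)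

end ConnectionMatrix

end SelbergFuchs

/-! ### The connection matrix. -/

theorem proposition3 (N : ℕ) (l₂ l a : ℂ)
    (hl₂ : -1 < l₂.re) (hl : 0 < l.re) (ha : 0 < a.re)
    -- a meromorphic choice of normalization of the Frobenius series solutions
    (n : Fin (N + 1) → ℂ → ℂ) (hn : ∀ k, Meromorphic (n k))
    (hn₀ : ∀ k, ∀ᶠ l₁ in Filter.codiscrete ℂ, n k l₁ ≠ 0) :
    -- all `λ₁` outside a closed discrete set are admissible
    (∀ᶠ l₁ in Filter.codiscrete ℂ, SelbergFuchs.Generic N l₂ l a l₁ ∧ ∀ k, n k l₁ ≠ 0) ∧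
    ∃ (W H : ℂ → ℝ → Matrix (Fin (N + 1)) (Fin (N + 1)) ℂ)
      (C : ℂ → Matrix (Fin (N + 1)) (Fin (N + 1)) ℂ),
      -- `W` is the matrix of Frobenius series solutions, and it is meromorphic in `λ₁`
      (∀ l₁, SelbergFuchs.Generic N l₂ l a l₁ → (∀ k, n k l₁ ≠ 0) → ∀ k : Fin (N + 1),
        ∃ p : ℕ → Fin (N + 1) → ℂ,
          SelbergFuchs.IsFrobeniusSolution N l₂ l a l₁ k p ∧ p 0 0 = n k l₁ ∧
          (∀ p' : ℕ → Fin (N + 1) → ℂ,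
            SelbergFuchs.IsFrobeniusSolution N l₂ l a l₁ k p' → p' 0 0 = n k l₁ → p' = p) ∧
          ∀ x ∈ Set.Ioo (0 : ℝ) 1, (W l₁ x).col k =
            SelbergFuchs.frobeniusSum (SelbergFuchs.sigma l a l₁ k) p x) ∧
      (∀ x ∈ Set.Ioo (0 : ℝ) 1, ∀ i k, Meromorphic fun l₁ => W l₁ x i k) ∧
      -- `H` continues the matrix of integral solutions, and it is meromorphic in `λ₁`
      (∀ l₁ : ℂ, -1 < l₁.re → ∀ x ∈ Set.Ioo (0 : ℝ) 1,
        (∀ p q : Fin (N + 1), MeasureTheory.IntegrableOn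
          (SelbergFuchs.integrandJ N p l₂ l a l₁ x) (SelbergFuchs.domain N q x)) ∧
        H l₁ x = SelbergFuchs.integralMatrix N l₂ l a l₁ x) ∧
      (∀ x ∈ Set.Ioo (0 : ℝ) 1, ∀ i q, Meromorphic fun l₁ => H l₁ x i q) ∧
      -- `C` is the connection matrix: it is the only matrix with `H = W C`, is already determined
      -- by the first row of this relation, and is meromorphic in `λ₁`
      (∀ l₁, SelbergFuchs.Generic N l₂ l a l₁ → (∀ k, n k l₁ ≠ 0) → -1 < l₁.re →
        (∀ x ∈ Set.Ioo (0 : ℝ) 1, H l₁ x = W l₁ x * C l₁) ∧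
        ∀ D : Matrix (Fin (N + 1)) (Fin (N + 1)) ℂ,
          (∀ x ∈ Set.Ioo (0 : ℝ) 1, ∀ q, H l₁ x 0 q = (W l₁ x * D) 0 q) → D = C l₁) ∧
      (∀ᶠ l₁ in Filter.codiscrete ℂ, ∀ x ∈ Set.Ioo (0 : ℝ) 1, H l₁ x = W l₁ x * C l₁) ∧
      (∀ i q, Meromorphic fun l₁ => C l₁ i q) := by
  have hadm : ∀ᶠ l₁ in codiscrete ℂ, SelbergFuchs.Generic N l₂ l a l₁ ∧ ∀ k, n k l₁ ≠ 0 :=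
    (SelbergFuchs.eventually_generic N l₂ l a).and (eventually_all.2 hn₀)
  have hx₀ : (1 / 2 : ℝ) ∈ Ioo (0 : ℝ) 1 := by norm_num
  obtain ⟨K, hK, hKH⟩ :=
    SelbergFuchs.exists_continuation_integralMatrix (N := N) hl₂ hl ha hx₀
  set W : ℂ → ℝ → Matrix (Fin (N + 1)) (Fin (N + 1)) ℂ := fun l₁ =>
    SelbergFuchs.frobMatrix N l₂ l a l₁ fun k => n k l₁ with hW
  -- As `W⁻¹ H` is constant in `x`, the continuation of the integrals at the single point `1 / 2`
  -- determines it.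
  set C : ℂ → Matrix (Fin (N + 1)) (Fin (N + 1)) ℂ := fun l₁ => (W l₁ (1 / 2))⁻¹ * K l₁ with hC
  have hWm : ∀ x ∈ Ioo (0 : ℝ) 1, ∀ i k, Meromorphic fun l₁ => W l₁ x i k := fun x hx i k =>
    SelbergFuchs.meromorphic_frobeniusSum (hn k) k i hx
  have hCm : ∀ i q, Meromorphic fun l₁ => C l₁ i q := fun i q z =>
    SelbergFuchs.meromorphicAt_mul
      (SelbergFuchs.meromorphicAt_inv fun i j => hWm _ hx₀ i j z) (fun i j => hK i j z) i q
  -- To the left of the half plane `H` is defined by the relation it has to satisfy. On the half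
  -- plane that relation is a theorem at admissible `λ₁`, so `H` agrees with the meromorphic `W C`
  -- off a discrete set.
  set H : ℂ → ℝ → Matrix (Fin (N + 1)) (Fin (N + 1)) ℂ := fun l₁ x =>
    if -1 < l₁.re then SelbergFuchs.integralMatrix N l₂ l a l₁ x else W l₁ x * C l₁ with hH
  have hHeq : ∀ l₁ : ℂ, -1 < l₁.re → ∀ x, H l₁ x = SelbergFuchs.integralMatrix N l₂ l a l₁ x :=
    fun l₁ h x => if_pos h
  have hHC : ∀ l₁, SelbergFuchs.Generic N l₂ l a l₁ → (∀ k, n k l₁ ≠ 0) →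
      ∀ x ∈ Ioo (0 : ℝ) 1, H l₁ x = W l₁ x * C l₁ := by
    intro l₁ hg hc x hx
    by_cases h : -1 < l₁.re
    · rw [hHeq l₁ h, hC]
      beta_reduce
      rw [hKH l₁ h]
      exact hg.eq_frobMatrix_mul hc
        (SelbergFuchs.isSolution_integralMatrix ⟨h, hl₂, ha, hl⟩) hx₀ hx
    · exact if_neg h
  refine ⟨hadm, W, H, C, fun l₁ hg hc k => ?_, hWm, fun l₁ h x hx =>
    ⟨fun p q => SelbergFuchs.integrableOn_integrandJ h hl₂ ha hl hx p, hHeq l₁ h x⟩,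
    fun x hx i q => ?_, fun l₁ hg hc h => ⟨hHC l₁ hg hc, fun D hD => ?_⟩, ?_, hCm⟩
  · exact ⟨_, hg.isFrobeniusSolution k (hc k), SelbergFuchs.frobCoeff_zero_zero _ _,
      fun p' hp' h0 => hg.frobenius_unique k hp' h0, fun x _ => rfl⟩
  · have hm : Meromorphic fun l₁ => (W l₁ x * C l₁) i q := fun z =>
      SelbergFuchs.meromorphicAt_mul (fun i j => hWm x hx i j z) (fun i j => hCm i j z) i q
    refine fun z => (hm z).congr ?_
    filter_upwards [SelbergFuchs.eventually_punctured_of_codiscrete hadm z] with l₁ hl₁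
    rw [hHC l₁ hl₁.1 hl₁.2 x hx]
  · refine hg.eq_of_first_row_eq hc fun x hx q => ?_
    rw [← hD x hx q, hHC l₁ hg hc x hx]
  · filter_upwards [hadm] with l₁ hl₁ using hHC l₁ hl₁.1 hl₁.2
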